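/- Let $G$ be a real Lie group with semisimple Lie algebra $\mathfrak g$, and let $P\le G$ be a closed subgroup whose Lie algebra $\mathfrak p$ is parabolic, i.e. the nilpotent radical $\mathfrak n$ of $\mathfrak p$ (the intersection of the kernels of all simple $\mathfrak p$-modules) equals the Killing perp $\mathfrak p^\perp$. Fix an opposite parabolic subalgebra $\mathfrak p^{\mathrm{op}}$, i.e. one with $\mathfrak g=\mathfrak p^\perp\oplus\mathfrak p^{\mathrm{op}}$; let $\mathfrak m$ be its nilpotent radical and $\mathfrak p_0=\mathfrak p\cap\mathfrak p^{\mathrm{op}}$, so that $\mathfrak g=\mathfrak m\oplus\mathfrak p_0\oplus\mathfrak n$, and identify $P_0=P/\exp\mathfrak n$ with the subgroup of $P$ preserving $\mathfrak p^{\mathrm{op}}$ under the adjoint action. Identify $T(G/P)$ with $G\times_P(\mathfrak g/\mathfrak p)$ via the Maurer--Cartan form $\theta$ of $G$, put $\mathfrak h=\{x\in\mathfrak g/\mathfrak p: \xi\cdot x=0\ \ \forall\,\xi\in\mathfrak n\}$ and let $\mathcal H=G\times_P\mathfrak h\le T(G/P)$ be the horizontal distribution. A Weyl structure over an open set $U\subseteq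 G/P$ is a smooth $P_0$-equivariant splitting over $U$ of the projection $G\to G/\exp\mathfrak n$ (equivalently, a reduction of $G|_U$ to $P_0$); its Weyl connection is the $\mathfrak p_0$-component of the pullback of $\theta$, and it induces covariant derivatives $\nabla$ on bundles associated to $P_0$-modules (and, through the reduction, on bundles associated to $P$-modules). A horizontal metric over $U$ is a smooth nondegenerate section of $S^2\mathcal H^*$ over $U$; it is compatible if $\nabla_Z g=0$ for all horizontal $Z$ for the connection $\nabla$ of some Weyl structure over $U$. $G/P$ is locally metrizable if every point has an open neighbourhood carrying a compatible horizontal metric. Then: (1) The image $M$ of $\exp\mathfrak m$ in $G/P$ is open, and $\exp\mathfrak m\cdot P_0\subseteq G$ is a reduction of $G\to G/P$ to $P_0$ over $M$, i.e. the image of a Weyl structure over $M$ (the normal flat Weyl structure). (2) For every finite dimensional (continuous, real) $P_0$-module $V$ and every $f_0\in V$, there is a smooth section over $M$ of the bundle induced by $V$ whose representing equivariant function is equal to the constant $f_0$ on $\exp\mathfrak m$, and any such section is covariantly constant, in all directions, for the normal flat Weyl connection. (3) Every nondegenerate symmetric bilinear form on $\mathfrak m\cong\mathfrak g/\mathfrak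 p$ (respectively on $\mathfrak h$) defines, as the constant function on $\exp\mathfrak m$, a smooth pseudo-Riemannian metric on $TM$ (respectively on $\mathcal H|_M$) which is covariantly constant, in all directions, for the normal flat Weyl connection. In particular every nondegenerate symmetric form on $\mathfrak h$ extends in this way to a compatible horizontal metric on $M$. (4) $G/P$ is locally metrizable. -/

import Mathlib

open Set
open scoped Manifold ContDiff

noncomputable section

namespace ParabolicGeometry

/-! ### Lie groups: Lie algebra, exponential map, adjoint action, Maurer-Cartan form -/

section LieGroups

variable (E G : Type*) [NormedAddCommGroup E] [NormedSpace ℝ E]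
  [TopologicalSpace G] [ChartedSpace E G] [Group G]

/-- The Lie algebra of the real Lie group `G` (modelled on `E`): Mathlib's Lie algebra of
left-invariant vector fields, on the tangent space at the identity. -/
abbrev LieAlg : Type _ := GroupLieAlgebra 𝓘(ℝ, E) G

variable [LieGroup 𝓘(ℝ, E) ∞ G]

instance lieGroup_minSmoothness : LieGroup 𝓘(ℝ, E) (minSmoothness ℝ 3) G := by
  rw [minSmoothness_of_isRCLikeNormedField]; infer_instance

instance finiteDimensional_lieAlg [FiniteDimensional ℝ E] : FiniteDimensional ℝ (LieAlg E G) :=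
  inferInstanceAs (FiniteDimensional ℝ E)

variable {E G}

/-- The left Maurer-Cartan form `θ_g(v) = d(L_{g⁻¹})_g v`. -/
def maurerCartan (g : G) (v : TangentSpace 𝓘(ℝ, E) g) : LieAlg E G :=
  mfderiv 𝓘(ℝ, E) 𝓘(ℝ, E) (fun x : G => g⁻¹ * x) g v

/-- The adjoint action: the derivative at `1` of conjugation by `g`. -/
def Ad (g : G) : LieAlg E G →ₗ[ℝ] LieAlg E G :=
  (mfderiv 𝓘(ℝ, E) 𝓘(ℝ, E) (fun x : G => g * x * g⁻¹) 1 : E →L[ℝ] E).toLinearMap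

lemma contMDiff_conj (g : G) :
    ContMDiff 𝓘(ℝ, E) 𝓘(ℝ, E) ∞ (fun x : G => g * x * g⁻¹) :=
  (contMDiff_const.mul contMDiff_id).mul contMDiff_const

lemma mdifferentiable_conj (g : G) :
    MDifferentiable 𝓘(ℝ, E) 𝓘(ℝ, E) (fun x : G => g * x * g⁻¹) :=
  (contMDiff_conj g).mdifferentiable (by simp)

lemma mdifferentiable_mul_left' (g : G) :
    MDifferentiable 𝓘(ℝ, E) 𝓘(ℝ, E) (fun x : G => g * x) :=
  (contMDiff_mul_left (n := ∞)).mdifferentiable (by simp)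

lemma Ad_one : Ad (1 : G) = (LinearMap.id : LieAlg E G →ₗ[ℝ] LieAlg E G) := by
  have h : (fun x : G => (1 : G) * x * (1 : G)⁻¹) = id := by ext x; simp
  unfold Ad
  rw [h, mfderiv_id]
  rfl

lemma mfderiv_comp_of_eq' {φ ψ : G → G} {x y : G} (hφ : MDifferentiable 𝓘(ℝ, E) 𝓘(ℝ, E) φ)
    (hψ : MDifferentiable 𝓘(ℝ, E) 𝓘(ℝ, E) ψ) (hy : φ x = y) (v : E) :
    (mfderiv 𝓘(ℝ, E) 𝓘(ℝ, E) (ψ ∘ φ) x : E →L[ℝ] E) v =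
      (mfderiv 𝓘(ℝ, E) 𝓘(ℝ, E) ψ y : E →L[ℝ] E)
        ((mfderiv 𝓘(ℝ, E) 𝓘(ℝ, E) φ x : E →L[ℝ] E) v) := by
  subst hy
  exact congrArg (fun T : E →L[ℝ] E => T v) (mfderiv_comp x (hψ _) (hφ x))

lemma Ad_mul (g h : G) : (Ad (g * h) : LieAlg E G →ₗ[ℝ] LieAlg E G) = Ad g ∘ₗ Ad h := by
  have e : (fun x : G => (g * h) * x * (g * h)⁻¹) =
      (fun x : G => g * x * g⁻¹) ∘ (fun x : G => h * x * h⁻¹) := by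
    ext x; simp [mul_assoc]
  apply LinearMap.ext
  intro v
  unfold Ad
  rw [e]
  exact mfderiv_comp_of_eq' (E := E) (mdifferentiable_conj h) (mdifferentiable_conj g) (by simp) v

lemma contMDiff_one_mulInvariant (ξ : LieAlg E G) :
    ContMDiff 𝓘(ℝ, E) 𝓘(ℝ, E).tangent 1
      (fun g : G => (⟨g, mulInvariantVectorField ξ g⟩ : TangentBundle 𝓘(ℝ, E) G)) :=
  (contMDiff_mulInvariantVectorField ξ).of_le
    (by rw [minSmoothness_of_isRCLikeNormedField]; norm_num)

lemma mfderiv_mul_left_mulInvariant (ξ : LieAlg E G) (g h : G) :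
    mfderiv 𝓘(ℝ, E) 𝓘(ℝ, E) (fun x : G => g * x) h (mulInvariantVectorField ξ h) =
      mulInvariantVectorField ξ (g * h) := by
  have e : (fun x : G => (g * h) * x) = (fun x : G => g * x) ∘ (fun x : G => h * x) := by
    ext x; simp [mul_assoc]
  unfold mulInvariantVectorField
  rw [e]
  exact (mfderiv_comp_of_eq' (E := E) (mdifferentiable_mul_left' h) (mdifferentiable_mul_left' g)
    (mul_one h) ξ).symm

lemma mfderiv_conj_mulInvariant (ξ : LieAlg E G) (g h : G) :
    mfderiv 𝓘(ℝ, E) 𝓘(ℝ, E) (fun x : G => g * x * g⁻¹) h (mulInvariantVectorField ξ h) =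
      mulInvariantVectorField (Ad g ξ : LieAlg E G) (g * h * g⁻¹) := by
  have e : (fun x : G => g * x * g⁻¹) ∘ (fun x : G => h * x) =
      (fun x : G => (g * h * g⁻¹) * x) ∘ (fun x : G => g * x * g⁻¹) := by
    ext x; simp [mul_assoc]
  have k1 := mfderiv_comp_of_eq' (E := E) (mdifferentiable_mul_left' h) (mdifferentiable_conj g)
    (mul_one h) ξ
  have k2 := mfderiv_comp_of_eq' (E := E) (x := 1) (y := 1) (mdifferentiable_conj g)
    (mdifferentiable_mul_left' (g * h * g⁻¹)) (by simp) ξ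
  rw [e] at k1
  exact k1.symm.trans k2

variable [FiniteDimensional ℝ E] [T2Space G]

/-- Left-invariant vector fields are complete. -/
lemma exists_integralCurve (ξ : LieAlg E G) :
    ∃ γ : ℝ → G, γ 0 = 1 ∧ IsMIntegralCurve (I := 𝓘(ℝ, E)) γ (mulInvariantVectorField ξ) := by
  have := FiniteDimensional.complete ℝ E
  obtain ⟨γ, h0, hγ⟩ := exists_isMIntegralCurveAt_of_contMDiffAt_boundaryless (t₀ := 0)
    ((contMDiff_one_mulInvariant ξ) (1 : G))
  obtain ⟨ε, hε, hγ⟩ := isMIntegralCurveAt_iff'.1 hγ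
  refine exists_isMIntegralCurve_of_isMIntegralCurveOn (contMDiff_one_mulInvariant ξ) hε
    (fun g => ⟨fun t => g * γ t, by simp [h0], ?_⟩) 1
  intro t ht
  rw [Real.ball_eq_Ioo, zero_sub, zero_add] at hγ
  have := (mdifferentiable_mul_left' (E := E) g (γ t)).hasMFDerivAt.comp_hasMFDerivWithinAt t
    (hγ t ht)
  refine this.congr_mfderiv (ContinuousLinearMap.ext fun s => ?_)
  exact (map_smul _ _ _).trans
    (congrArg (fun w : E => (show ℝ from s) • w) (mfderiv_mul_left_mulInvariant ξ g (γ t)))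

/-- The exponential map of `G`: `exp ξ = γ(1)`, where `γ` is the integral curve through `1` of the
left-invariant vector field generated by `ξ`. -/
def lieExp (ξ : LieAlg E G) : G := (exists_integralCurve ξ).choose 1

lemma lieExp_eq (ξ : LieAlg E G) {γ : ℝ → G} (h0 : γ 0 = 1)
    (h : IsMIntegralCurve (I := 𝓘(ℝ, E)) γ (mulInvariantVectorField ξ)) : lieExp ξ = γ 1 := by
  have := FiniteDimensional.complete ℝ E
  have hs := (exists_integralCurve ξ).choose_spec
  have := isMIntegralCurve_Ioo_eq_of_contMDiff_boundaryless (t₀ := 0)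
    (contMDiff_one_mulInvariant ξ) hs.2 h (by rw [hs.1, h0])
  exact congrFun this 1

lemma lieExp_Ad (g : G) (ξ : LieAlg E G) : lieExp (Ad g ξ) = g * lieExp ξ * g⁻¹ := by
  have hs := (exists_integralCurve ξ).choose_spec
  refine lieExp_eq (γ := fun t => g * (exists_integralCurve ξ).choose t * g⁻¹) (Ad g ξ)
    (by simp [hs.1]) ?_
  intro t
  have := (mdifferentiable_conj (E := E) g ((exists_integralCurve ξ).choose t)).hasMFDerivAt.comp t
    (hs.2 t)
  refine this.congr_mfderiv (ContinuousLinearMap.ext fun s => ?_)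
  exact (map_smul _ _ _).trans
    (congrArg (fun w : E => (show ℝ from s) • w) (mfderiv_conj_mulInvariant ξ g _))

end LieGroups

/-! ### Lie algebras: nilpotent radical, parabolic subalgebras -/

section LieAlgebras

/-- The nilpotent radical of a real Lie algebra: the intersection of the kernels of all its
finite dimensional simple modules. -/
def nilpotentRadical (L : Type*) [LieRing L] [LieAlgebra ℝ L] : LieIdeal ℝ L where
  carrier := {ξ | ∀ (V : Type) [AddCommGroup V] [Module ℝ V] [FiniteDimensional ℝ V]
    [LieRingModule L V] [LieModule ℝ L V], LieModule.IsIrreducible ℝ L V → ∀ v : V, ⁅ξ, v⁆ = 0}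
  add_mem' {a b} ha hb := by
    intro V _ _ _ _ _ hV v
    rw [add_lie, ha V hV v, hb V hV v, add_zero]
  zero_mem' := by
    intro V _ _ _ _ _ _ v
    exact zero_lie v
  smul_mem' c a ha := by
    intro V _ _ _ _ _ hV v
    rw [smul_lie, ha V hV v, smul_zero]
  lie_mem {x a} ha := by
    intro V _ _ _ _ _ hV v
    rw [lie_lie, ha V hV v, ha V hV ⁅x, v⁆, lie_zero, sub_zero]

variable {L : Type*} [LieRing L] [LieAlgebra ℝ L]

/-- The nilpotent radical of a subalgebra, as a subspace of the ambient Lie algebra. -/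
def radicalIn (p : LieSubalgebra ℝ L) : Submodule ℝ L :=
  (nilpotentRadical p).toSubmodule.map p.toSubmodule.subtype

/-- The orthogonal complement of a subalgebra with respect to the Killing form. -/
def killingPerp (p : LieSubalgebra ℝ L) : Submodule ℝ L :=
  LinearMap.BilinForm.orthogonal (killingForm ℝ L) p.toSubmodule

/-- A subalgebra is parabolic if its nilpotent radical is its Killing perp. -/
def IsParabolic (p : LieSubalgebra ℝ L) : Prop := radicalIn p = killingPerp p

lemma radicalIn_le (p : LieSubalgebra ℝ L) : radicalIn p ≤ p.toSubmodule :=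
  Submodule.map_subtype_le _ _

/-- For opposite parabolic subalgebras `p`, `q` of a semisimple Lie algebra, with nilpotent
radicals `n`, `m`, one has `L = (p ∩ q) ⊕ (m ⊕ n)`. -/
lemma isCompl_levi [FiniteDimensional ℝ L] [LieAlgebra.IsSemisimple ℝ L]
    {p q : LieSubalgebra ℝ L} (hp : IsParabolic p) (hq : IsParabolic q)
    (h : IsCompl (killingPerp p) q.toSubmodule) :
    IsCompl (p.toSubmodule ⊓ q.toSubmodule) (radicalIn q ⊔ radicalIn p) := by
  have hn : LinearMap.BilinForm.Nondegenerate (killingForm ℝ L) :=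
    LieAlgebra.IsKilling.killingForm_nondegenerate ℝ L
  have hle : killingPerp p ≤ p.toSubmodule := hp ▸ radicalIn_le p
  have hd : Disjoint p.toSubmodule (killingPerp q) := by
    rw [Submodule.disjoint_def]
    intro x hx hx'
    refine hn.2 x fun y => ?_
    obtain ⟨a, ha, b, hb, rfl⟩ := Submodule.mem_sup.1 (h.sup_eq_top ▸ Submodule.mem_top (x := y))
    rw [map_add, LinearMap.add_apply, hx' b hb, add_zero, LieModule.traceForm_comm]
    exact ha x hx
  have hc : p.toSubmodule ⊔ killingPerp q = ⊤ := by
    have e1 := LinearMap.BilinForm.finrank_orthogonal hn p.toSubmodule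
    have e2 := LinearMap.BilinForm.finrank_orthogonal hn q.toSubmodule
    have e3 := Submodule.finrank_add_eq_of_isCompl h
    have e4 := Submodule.finrank_sup_add_finrank_inf_eq p.toSubmodule (killingPerp q)
    rw [hd.eq_bot, finrank_bot] at e4
    have l1 := Submodule.finrank_le p.toSubmodule
    have l2 := Submodule.finrank_le q.toSubmodule
    apply Submodule.eq_top_of_finrank_eq
    unfold killingPerp at *
    omega
  rw [hp, hq]
  constructor
  · rw [Submodule.disjoint_def]
    rintro x ⟨hxp, hxq⟩ hx
    obtain ⟨a, ha, b, hb, rfl⟩ := Submodule.mem_sup.1 hx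
    have ha0 : a = 0 := Submodule.disjoint_def.1 hd a
      (by simpa using Submodule.sub_mem _ hxp (hle hb)) ha
    subst ha0
    rw [zero_add] at hxq ⊢
    exact Submodule.disjoint_def.1 h.disjoint b hb hxq
  · rw [codisjoint_iff, eq_top_iff]
    intro y _
    obtain ⟨c, hc, a, ha, rfl⟩ := Submodule.mem_sup.1 (hc ▸ Submodule.mem_top (x := y))
    obtain ⟨b, hb, d, hd, rfl⟩ := Submodule.mem_sup.1 (h.sup_eq_top ▸ Submodule.mem_top (x := c))
    refine Submodule.mem_sup.2 ⟨d, ⟨?_, hd⟩, a + b,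
      Submodule.add_mem_sup ha hb, by abel⟩
    simpa using Submodule.sub_mem _ hc (hle hb)

end LieAlgebras

/-! ### The homogeneous model -/

/-- A homogeneous model `G → G/P`: a closed subgroup `P` of `G` whose Lie algebra `p` is a
parabolic subalgebra, together with a chosen parabolic subalgebra `q` opposite to `p`. -/
structure ParabolicModel (E G : Type*) [NormedAddCommGroup E] [NormedSpace ℝ E]
    [FiniteDimensional ℝ E] [TopologicalSpace G] [ChartedSpace E G] [Group G]
    [LieGroup 𝓘(ℝ, E) ∞ G] [T2Space G] where
  P : Subgroup G
  isClosed_P : IsClosed (P : Set G)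
  p : LieSubalgebra ℝ (LieAlg E G)
  /-- `p` is the Lie algebra of `P`. -/
  mem_p : ∀ ξ : LieAlg E G, ξ ∈ p ↔ ∀ t : ℝ, lieExp (t • ξ) ∈ P
  parabolic_p : IsParabolic p
  q : LieSubalgebra ℝ (LieAlg E G)
  parabolic_q : IsParabolic q
  opposite : IsCompl (killingPerp p) q.toSubmodule

namespace ParabolicModel

variable {E G : Type*} [NormedAddCommGroup E] [NormedSpace ℝ E]
  [FiniteDimensional ℝ E] [TopologicalSpace G] [ChartedSpace E G] [Group G]
  [LieGroup 𝓘(ℝ, E) ∞ G] [T2Space G] (D : ParabolicModel E G)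

/-- The nilpotent radical of `p`. -/
def n : Submodule ℝ (LieAlg E G) := radicalIn D.p

/-- The nilpotent radical of the opposite parabolic `q`. -/
def m : Submodule ℝ (LieAlg E G) := radicalIn D.q

/-- The reductive part `p₀ = p ∩ q`. -/
def p₀ : Submodule ℝ (LieAlg E G) := D.p.toSubmodule ⊓ D.q.toSubmodule

/-- The subset `exp n` of `G`. -/
def expN : Set G := lieExp '' (D.n : Set (LieAlg E G))

/-- The subset `exp m` of `G`. -/
def expM : Set G := lieExp '' (D.m : Set (LieAlg E G))

/-- The group `P₀ = P / exp n`, identified with the subgroup of `P` preserving the chosen opposite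
parabolic subalgebra. -/
def P₀ : Subgroup G where
  carrier := {g | g ∈ D.P ∧ D.q.toSubmodule.map (Ad g) = D.q.toSubmodule}
  one_mem' := ⟨D.P.one_mem, by rw [Ad_one, Submodule.map_id]⟩
  mul_mem' {a b} ha hb :=
    ⟨D.P.mul_mem ha.1 hb.1, by rw [Ad_mul, Submodule.map_comp, hb.2, ha.2]⟩
  inv_mem' {a} ha := ⟨D.P.inv_mem ha.1, by
    conv_lhs => rw [← ha.2]
    rw [← Submodule.map_comp, ← Ad_mul, inv_mul_cancel, Ad_one, Submodule.map_id]⟩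

lemma p_le_comap_Ad (a : D.P) : D.p.toSubmodule ≤ D.p.toSubmodule.comap (Ad (a : G)) := by
  intro ξ hξ
  refine (D.mem_p _).2 fun t => ?_
  rw [← map_smul, lieExp_Ad]
  exact D.P.mul_mem (D.P.mul_mem a.2 ((D.mem_p ξ).1 hξ t)) (D.P.inv_mem a.2)

/-- The `P`-module `g/p`. The tangent bundle of `G/P` is the bundle `G ×_P (g/p)`. -/
abbrev QuotMod : Type _ := LieAlg E G ⧸ D.p.toSubmodule

/-- The action of `P` on `g/p` induced by the adjoint action. -/
def act (a : D.P) : D.QuotMod →ₗ[ℝ] D.QuotMod :=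
  D.p.toSubmodule.mapQ D.p.toSubmodule (Ad (a : G)) (D.p_le_comap_Ad a)

/-- The submodule `h = {x ∈ g/p | ξ · x = 0 for all ξ ∈ n}` of `g/p`, inducing the horizontal
distribution `H = G ×_P h ≤ T(G/P)`. -/
def h : Submodule ℝ D.QuotMod where
  carrier := {x | ∀ X : LieAlg E G, D.p.toSubmodule.mkQ X = x → ∀ ξ ∈ D.n, ⁅ξ, X⁆ ∈ D.p}
  add_mem' {a b} ha hb := by
    intro X hX ξ hξ
    obtain ⟨A, rfl⟩ := D.p.toSubmodule.mkQ_surjective a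
    have := add_mem (ha A rfl ξ hξ) (hb (X - A) (by rw [map_sub, hX]; abel) ξ hξ)
    rwa [← lie_add, add_sub_cancel] at this
  zero_mem' := by
    intro X hX ξ hξ
    exact D.p.lie_mem (radicalIn_le _ hξ) ((Submodule.Quotient.mk_eq_zero _).1 hX)
  smul_mem' c a ha := by
    intro X hX ξ hξ
    obtain ⟨A, rfl⟩ := D.p.toSubmodule.mkQ_surjective a
    have h1 : X - c • A ∈ D.p := (Submodule.Quotient.mk_eq_zero _).1
      (show D.p.toSubmodule.mkQ (X - c • A) = 0 by rw [map_sub, map_smul, hX, sub_self])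
    have := add_mem (D.p.smul_mem c (ha A rfl ξ hξ))
      (D.p.lie_mem (radicalIn_le _ hξ : ξ ∈ D.p) h1)
    rwa [← lie_smul, ← lie_add, add_sub_cancel] at this

/-- The total space over `U ⊆ G/P` of the principal bundle `G → G/P`. -/
def above (U : Set (G ⧸ D.P)) : Set G := {g | (g : G ⧸ D.P) ∈ U}

/-- A tangent vector of `G` projecting to a horizontal vector on `G/P`. -/
def IsHorizontal (g : G) (v : TangentSpace 𝓘(ℝ, E) g) : Prop :=
  D.p.toSubmodule.mkQ (maurerCartan g v) ∈ D.h

/-- Smooth sections over `U` of the bundle induced by a `P₀`-module `V`: smooth `P₀`-equivariant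
functions on the principal `P₀`-bundle `G/exp n` over `U`, pulled back to `G`. -/
structure IsSection {V : Type*} [NormedAddCommGroup V] [NormedSpace ℝ V]
    (ρ : Representation ℝ D.P₀ V) (U : Set (G ⧸ D.P)) (f : G → V) : Prop where
  smooth : ContMDiffOn 𝓘(ℝ, E) 𝓘(ℝ, V) ∞ f (D.above U)
  invariant : ∀ g ∈ D.above U, ∀ e ∈ D.expN, f (g * e) = f g
  equivariant : ∀ g ∈ D.above U, ∀ z : D.P₀, f (g * z) = ρ z⁻¹ (f g)

/-- Weyl structures over `U`: smooth `P₀`-equivariant splittings of the projection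
`G → G/exp n` over `U`; the splitting is described by its composite `σ` with that projection. -/
structure IsWeylStructure (U : Set (G ⧸ D.P)) (σ : G → G) : Prop where
  smooth : ContMDiffOn 𝓘(ℝ, E) 𝓘(ℝ, E) ∞ σ (D.above U)
  invariant : ∀ g ∈ D.above U, ∀ e ∈ D.expN, σ (g * e) = σ g
  equivariant : ∀ g ∈ D.above U, ∀ z ∈ D.P₀, σ (g * z) = σ g * z
  splitting : ∀ g ∈ D.above U, ∃ e ∈ D.expN, σ g = g * e

/-- (Pseudo-Riemannian) metrics over `U` on the subbundle `G ×_P W` of the tangent bundle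
`G ×_P (g/p)` of `G/P` induced by a subspace `W` of `g/p` (a `P`-submodule in all uses):
smooth `P`-equivariant functions with values in the nondegenerate symmetric forms on `W`. -/
structure IsMetric (W : Submodule ℝ D.QuotMod) (U : Set (G ⧸ D.P))
    (b : G → LinearMap.BilinForm ℝ W) : Prop where
  smooth : ∀ x y : W, ContMDiffOn 𝓘(ℝ, E) 𝓘(ℝ, ℝ) ∞ (fun g => b g x y) (D.above U)
  symm : ∀ g ∈ D.above U, (b g).IsSymm
  nondegenerate : ∀ g ∈ D.above U, (b g).Nondegenerate
  equivariant : ∀ g ∈ D.above U, ∀ a : D.P, ∀ x y x' y' : W,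
    (x' : D.QuotMod) = D.act a x → (y' : D.QuotMod) = D.act a y →
    b (g * a) x y = b g x' y'

variable [LieAlgebra.IsSemisimple ℝ (LieAlg E G)]

/-- The Weyl connection of a Weyl structure: the `p₀`-component (along `g = m ⊕ p₀ ⊕ n`) of the
pullback of the Maurer-Cartan form. -/
def weylConnection (σ : G → G) (g : G) (v : TangentSpace 𝓘(ℝ, E) g) : LieAlg E G :=
  Submodule.projection D.p₀ (D.m ⊔ D.n) (isCompl_levi D.parabolic_p D.parabolic_q D.opposite)
    (maurerCartan (σ g) (mfderiv 𝓘(ℝ, E) 𝓘(ℝ, E) σ g v))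

/-- The Weyl covariant derivative, in the direction of (the projection of) `v`, of the section of a
bundle given by the equivariant function `f`: restrict `f` to the image of the Weyl structure and
differentiate in the direction of the horizontal part `v - X_{ω(v)}` of `v`, where `X_ξ` is the
vector field generated by `ξ` and `ω` the Weyl connection. -/
def covDeriv {V : Type*} [NormedAddCommGroup V] [NormedSpace ℝ V] (σ : G → G) (f : G → V)
    (g : G) (v : TangentSpace 𝓘(ℝ, E) g) : V :=
  (mfderiv 𝓘(ℝ, E) 𝓘(ℝ, V) (f ∘ σ) g : E →L[ℝ] V)
    (v - mulInvariantVectorField (D.weylConnection σ g v) g)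

/-- A horizontal metric over `U` is compatible if it is covariantly constant in horizontal
directions for some Weyl connection over `U`. -/
def IsCompatibleMetric (U : Set (G ⧸ D.P)) (b : G → LinearMap.BilinForm ℝ D.h) : Prop :=
  D.IsMetric D.h U b ∧ ∃ σ : G → G, D.IsWeylStructure U σ ∧
    ∀ g ∈ D.above U, ∀ v : TangentSpace 𝓘(ℝ, E) g, D.IsHorizontal g v →
      ∀ x y : D.h, D.covDeriv σ (fun a => b a x y) g v = 0

/-- `G/P` is locally metrizable: compatible horizontal metrics exist near every point. -/
def LocallyMetrizable : Prop :=
  ∀ x : G ⧸ D.P, ∃ U : Set (G ⧸ D.P), IsOpen U ∧ x ∈ U ∧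
    ∃ b : G → LinearMap.BilinForm ℝ D.h, D.IsCompatibleMetric U b

/-- The image of `exp m` in `G/P`. -/
def cell : Set (G ⧸ D.P) := (fun g : G => (g : G ⧸ D.P)) '' D.expM

/-- The normal flat Weyl structure: the Weyl structure over the open cell given by the reduction
`exp m · P₀` of `G → G/P`. -/
def IsNormalFlat (σ : G → G) : Prop :=
  D.IsWeylStructure D.cell σ ∧ σ '' D.above D.cell = {g | ∃ u ∈ D.expM, ∃ z ∈ D.P₀, g = u * z}

end ParabolicModel
end ParabolicGeometry
end

set_option linter.unusedSectionVars false

open Set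
open scoped Manifold ContDiff

noncomputable section

/-! Everything rests on a grading element. Write `n`, `m` for the nilpotent radicals of `p` and of
its opposite `q`. The powers of `n`, with their Killing orthogonals in degrees at most `0`, form a
filtration `F` of the Lie algebra with `F⁰ = p`, `F¹ = n` and `(F⁻ʲ)^⊥ = Fʲ⁺¹`, compatible with the
bracket (`lie_mem_filt`). A linear operator acting as `j` on each `Fʲ/Fʲ⁺¹` is represented, through
traces and the Killing form, by an element `z` with `[z, x] ≡ j x` modulo `Fʲ⁺¹` for `x ∈ Fʲ`
(`exists_isGrading`), and `z` can be moved into `p ∩ q`. Since the degrees on `n` are positive,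
successive approximation conjugates every element of `z + n` to `z` by some `exp x` with `x ∈ n`,
and `x` depends smoothly on the element (`exists_smooth_conjugation`). A unipotent automorphism
fixing `z` is trivial (`eq_one_of_apply_grading`), and a complement of `n` stable under `ad z` is
unique (`le_of_stable_grading`).

On the group side, `Ad` has derivative `ad` and is locally injective, because a semisimple algebra
has no centre; this makes `exp` smooth and `exp n`, `exp m` subgroups. If `Ad g` moves `q` to a
complement of `n`, this complement meets `z + n` in one point. Conjugating the point back to `z`
splits `g` smoothly into an element of `exp n` and one normalizing `q` (`exists_unipotentPart`).
Applied to `(q, p)` and then to `(p, q)`, this gives the smooth unique decomposition `g = u z e`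
with `u ∈ exp m`, `z ∈ P₀`, `e ∈ exp n` over the cell. The cell is open because `P` is open in the
normalizer of `p` (`eventually_mem_P`), and `g ↦ u z` is the flat Weyl structure.

Its image lies in the normalizer of `q`, so the pulled back Maurer-Cartan form takes values in `q =
m ⊕ p₀`. The covariant derivative therefore differentiates only in directions of `m`, and it kills
every function that is constant along `exp m` at the points of the image (`covDeriv_eq_zero`).
Extending a constant from `exp m` by equivariance yields such functions, since `P₀` normalizes `exp
m`. Left translation by `G` carries a parallel metric to a neighbourhood of any point. -/

namespace ParabolicGeometry

/-! ### The nilpotent radical acts nilpotently on modules. -/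

section NilpotentRadical

variable {K : Type*} [LieRing K] [LieAlgebra ℝ K]

/-- The nilpotent radical annihilates the simple modules in every universe. -/
lemma lie_eq_zero_of_mem_nilpotentRadical {V : Type*} [AddCommGroup V] [Module ℝ V]
    [FiniteDimensional ℝ V] [LieRingModule K V] [LieModule ℝ K V]
    (hV : LieModule.IsIrreducible ℝ K V) {ξ : K} (hξ : ξ ∈ nilpotentRadical K) (v : V) :
    ⁅ξ, v⁆ = 0 := by
  -- The radical is defined by modules in `Type` only, so `V` is replaced by its coordinate space
  -- with the transported action.
  let e : V ≃ₗ[ℝ] (Fin (Module.finrank ℝ V) → ℝ) := (Module.finBasis ℝ V).equivFun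
  let _ : LieRingModule K (Fin (Module.finrank ℝ V) → ℝ) :=
    { bracket := fun x w => e ⁅x, e.symm w⁆
      add_lie := fun x y w => by simp [add_lie]
      lie_add := fun x v w => by simp [lie_add]
      leibniz_lie := fun x y w => by simp }
  have hb : ∀ (x : K) (w : Fin (Module.finrank ℝ V) → ℝ), ⁅x, w⁆ = e ⁅x, e.symm w⁆ :=
    fun _ _ => rfl
  have : LieModule ℝ K (Fin (Module.finrank ℝ V) → ℝ) :=
    { smul_lie := fun c x w => by simp [hb]
      lie_smul := fun c x w => by simp [hb] }
  have : Nontrivial V := LieModule.nontrivial_of_isIrreducible ℝ K V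
  have : Nontrivial (Fin (Module.finrank ℝ V) → ℝ) := e.symm.toEquiv.nontrivial
  have hirr : LieModule.IsIrreducible ℝ K (Fin (Module.finrank ℝ V) → ℝ) := by
    refine LieModule.IsIrreducible.mk fun N hN => ?_
    let N' : LieSubmodule ℝ K V :=
      { N.toSubmodule.comap (e : V →ₗ[ℝ] _) with
        lie_mem := fun {x w} hw => by
          have := N.lie_mem (x := x) (m := e w) hw
          rw [hb, e.symm_apply_apply] at this
          exact this }
    have hN' : N' = ⊤ := by
      refine (eq_bot_or_eq_top N').resolve_left fun h0 => hN ?_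
      rw [LieSubmodule.eq_bot_iff] at h0 ⊢
      intro w hw
      have : e.symm w = 0 := h0 _ (show e (e.symm w) ∈ N by simpa using hw)
      simpa using this
    rw [eq_top_iff]
    intro w _
    have : e.symm w ∈ N' := hN' ▸ LieSubmodule.mem_top _
    have h2 : e (e.symm w) ∈ N := this
    simpa using h2
  have := hξ (Fin (Module.finrank ℝ V) → ℝ) hirr (e v)
  rw [hb, e.symm_apply_apply] at this
  simpa using this

/-- The nilpotent radical is contained in the derived algebra. -/
lemma apply_eq_zero_of_mem_nilpotentRadical (χ : K →ₗ[ℝ] ℝ) (hχ : ∀ x y : K, χ ⁅x, y⁆ = 0)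
    {ξ : K} (hξ : ξ ∈ nilpotentRadical K) : χ ξ = 0 := by
  -- A functional vanishing on brackets is a character and turns `ℝ` into a one-dimensional, hence
  -- simple, module.
  let _ : LieRingModule K ℝ :=
    { bracket := fun x w => χ x * w
      add_lie := fun x y w => by simp only [map_add, add_mul]
      lie_add := fun x v w => by simp only [mul_add]
      leibniz_lie := fun x y w => by simp only [hχ]; ring }
  have hb : ∀ (x : K) (w : ℝ), ⁅x, w⁆ = χ x * w := fun _ _ => rfl
  have : LieModule ℝ K ℝ :=
    { smul_lie := fun c x w => by simp [hb, mul_assoc]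
      lie_smul := fun c x w => by simp only [hb, smul_eq_mul]; ring }
  have hirr : LieModule.IsIrreducible ℝ K ℝ := by
    refine LieModule.IsIrreducible.mk fun N hN => ?_
    obtain ⟨w, hw, hw0⟩ : ∃ w ∈ N, w ≠ 0 := by
      by_contra! h
      exact hN ((LieSubmodule.eq_bot_iff _).2 h)
    rw [eq_top_iff]
    intro t _
    have : (t / w) • w ∈ N := N.smul_mem _ hw
    rwa [smul_eq_mul, div_mul_cancel₀ _ hw0] at this
  have := hξ ℝ hirr 1
  rwa [hb, mul_one] at this

variable {V : Type*} [AddCommGroup V] [Module ℝ V] [FiniteDimensional ℝ V]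
  [LieRingModule K V] [LieModule ℝ K V]

/-- The quotient by a maximal proper submodule `M` is simple, so the radical kills it and maps `V`
into `M`. -/
lemma nilpotentRadical_lie_top_ne_top [Nontrivial V] :
    ⁅nilpotentRadical K, (⊤ : LieSubmodule ℝ K V)⁆ ≠ ⊤ := by
  obtain ⟨M, hM⟩ := IsCoatomic.exists_coatom (LieSubmodule ℝ K V)
  have hq : Nontrivial (V ⧸ M) := by
    obtain ⟨v, hv⟩ : ∃ v, v ∉ M := by
      by_contra! h
      exact hM.1 (eq_top_iff.2 fun v _ => h v)
    refine ⟨⟨LieSubmodule.Quotient.mk' M v, 0, fun h => hv ?_⟩⟩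
    exact (LieSubmodule.Quotient.mk_eq_zero' (N := M)).1 h
  have hirr : LieModule.IsIrreducible ℝ K (V ⧸ M) := by
    refine LieModule.IsIrreducible.mk fun N hN => ?_
    have hle : M ≤ N.comap (LieSubmodule.Quotient.mk' M) := by
      intro v hv
      rw [LieSubmodule.mem_comap]
      have : LieSubmodule.Quotient.mk' M v = 0 :=
        (LieSubmodule.Quotient.mk_eq_zero' (N := M)).2 hv
      rw [this]
      exact N.zero_mem
    rcases hM.le_iff.1 hle with h | h
    · rw [eq_top_iff]
      intro w _
      obtain ⟨v, rfl⟩ := LieSubmodule.Quotient.surjective_mk' M w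
      exact (h ▸ LieSubmodule.mem_top v : v ∈ N.comap (LieSubmodule.Quotient.mk' M))
    · exfalso
      apply hN
      rw [LieSubmodule.eq_bot_iff]
      intro w hw
      obtain ⟨v, rfl⟩ := LieSubmodule.Quotient.surjective_mk' M w
      have : v ∈ N.comap (LieSubmodule.Quotient.mk' M) := hw
      rw [h] at this
      exact (LieSubmodule.Quotient.mk_eq_zero' (N := M)).2 this
  intro htop
  have : ⁅nilpotentRadical K, (⊤ : LieSubmodule ℝ K V)⁆ ≤ M := by
    rw [LieSubmodule.lieIdeal_oper_eq_span, LieSubmodule.lieSpan_le]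
    rintro _ ⟨x, v, rfl⟩
    refine (LieSubmodule.Quotient.mk_eq_zero' (N := M)).1 ?_
    change LieSubmodule.Quotient.mk' M ⁅(x : K), (v : V)⁆ = 0
    rw [LieModuleHom.map_lie]
    exact lie_eq_zero_of_mem_nilpotentRadical hirr x.2 _
  exact hM.1 (eq_top_iff.2 (htop ▸ this))

/-- Nakayama-type statement: a nonzero `W` would contradict the previous lemma applied to the module
`W` itself. -/
lemma eq_bot_of_nilpotentRadical_lie_eq {W : LieSubmodule ℝ K V}
    (hW : ⁅nilpotentRadical K, W⁆ = W) : W = ⊥ := by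
  by_contra h
  have : Nontrivial W := (LieSubmodule.nontrivial_iff_ne_bot ℝ K V).2 h
  refine nilpotentRadical_lie_top_ne_top (K := K) (V := W) ?_
  have h1 := LieSubmodule.map_bracket_eq (I := nilpotentRadical K) (N := (⊤ : LieSubmodule ℝ K W)) W.incl
  have h2 : (⊤ : LieSubmodule ℝ K W).map W.incl = W :=
    LieSubmodule.map_incl_top W
  rw [h2, hW] at h1
  rw [eq_top_iff]
  intro w _
  have : (w : V) ∈ LieSubmodule.map W.incl ⁅nilpotentRadical K, (⊤ : LieSubmodule ℝ K W)⁆ :=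
    h1.symm ▸ w.2
  obtain ⟨w', hw', e⟩ := (LieSubmodule.mem_map _).1 this
  rwa [← Subtype.ext e]

/-- The nilpotent radical acts nilpotently on every finite dimensional module. -/
lemma exists_iterate_nilpotentRadical_lie_eq_bot :
    ∃ k : ℕ, (fun N : LieSubmodule ℝ K V => ⁅nilpotentRadical K, N⁆)^[k] ⊤ = ⊥ := by
  have := LieSubmodule.wellFoundedLT_of_isArtinian ℝ K V
  let c : ℕ →o (LieSubmodule ℝ K V)ᵒᵈ :=
    ⟨fun k => OrderDual.toDual ((fun N : LieSubmodule ℝ K V => ⁅nilpotentRadical K, N⁆)^[k] ⊤),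
      monotone_nat_of_le_succ fun k => by
        rw [OrderDual.toDual_le_toDual, Function.iterate_succ_apply']
        exact LieSubmodule.lie_le_right _ _⟩
  -- The decreasing chain of iterates stabilizes, and a stable term is reproduced by the radical,
  -- hence zero.
  obtain ⟨k, hk⟩ := WellFoundedGT.monotone_chain_condition c
  refine ⟨k, eq_bot_of_nilpotentRadical_lie_eq ?_⟩
  have := hk (k + 1) (Nat.le_succ k)
  rw [← Function.iterate_succ_apply' (fun N : LieSubmodule ℝ K V => ⁅nilpotentRadical K, N⁆) k ⊤]
  exact (OrderDual.toDual_inj.1 this).symm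

end NilpotentRadical

/-! ### Powers of the radical, opposite parabolics and self-normalization. -/

section Parabolic

variable {L : Type*} [LieRing L] [LieAlgebra ℝ L]

lemma lie_mem_radicalIn (p : LieSubalgebra ℝ L) {x y : L} (hx : x ∈ p) (hy : y ∈ radicalIn p) :
    ⁅x, y⁆ ∈ radicalIn p := by
  obtain ⟨y, hy, rfl⟩ := hy
  exact ⟨⁅(⟨x, hx⟩ : p), y⁆, (nilpotentRadical p).lie_mem hy, rfl⟩

/-- The bracket of two subspaces. -/
def brk (A B : Submodule ℝ L) : Submodule ℝ L :=
  Submodule.map₂ (LinearMap.mk₂ ℝ (fun a b : L => ⁅a, b⁆) add_lie smul_lie lie_add lie_smul) A B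

lemma lie_mem_brk {A B : Submodule ℝ L} {a b : L} (ha : a ∈ A) (hb : b ∈ B) : ⁅a, b⁆ ∈ brk A B :=
  Submodule.apply_mem_map₂ (LinearMap.mk₂ ℝ (fun a b : L => ⁅a, b⁆) _ _ _ _) ha hb

lemma brk_le {A B C : Submodule ℝ L} (h : ∀ a ∈ A, ∀ b ∈ B, ⁅a, b⁆ ∈ C) : brk A B ≤ C :=
  Submodule.map₂_le.2 h

/-- The descending central series of the nilpotent radical, starting with the algebra itself. -/
def radPow (p : LieSubalgebra ℝ L) : ℕ → Submodule ℝ L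
  | 0 => p.toSubmodule
  | 1 => radicalIn p
  | k + 2 => brk (radicalIn p) (radPow p (k + 1))

variable (p : LieSubalgebra ℝ L)

/-- The linear functional `x ↦ ⁅x, y⁆` as a linear map. -/
def lieRight (y : L) : L →ₗ[ℝ] L := -(LieAlgebra.ad ℝ L y : L →ₗ[ℝ] L)

lemma lieRight_apply (x y : L) : lieRight y x = ⁅x, y⁆ := by simp [lieRight]

lemma radPow_succ_le (k : ℕ) : radPow p (k + 1) ≤ radPow p k := by
  induction k with
  | zero => exact radicalIn_le p
  | succ k ih =>
    cases k with
    | zero => exact brk_le fun a ha b hb => lie_mem_radicalIn p (radicalIn_le p ha) hb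
    | succ k => exact brk_le fun a ha b hb => lie_mem_brk ha (ih hb)

lemma lie_mem_radPow {x : L} (hx : x ∈ p) (k : ℕ) {y : L} (hy : y ∈ radPow p k) :
    ⁅x, y⁆ ∈ radPow p k := by
  induction k generalizing y with
  | zero => exact p.lie_mem hx hy
  | succ k ih =>
    cases k with
    | zero => exact lie_mem_radicalIn p hx hy
    | succ k =>
      refine (brk_le (C := (radPow p (k + 2)).comap (LieAlgebra.ad ℝ L x : L →ₗ[ℝ] L)) ?_ :
        brk (radicalIn p) (radPow p (k + 1)) ≤ _) hy
      intro a ha b hb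
      rw [Submodule.mem_comap]
      change ⁅x, ⁅a, b⁆⁆ ∈ brk (radicalIn p) (radPow p (k + 1))
      rw [leibniz_lie]
      exact add_mem (lie_mem_brk (lie_mem_radicalIn p hx ha) hb) (lie_mem_brk ha (ih hb))

/-- Induction on `i`: elements of the next power are sums of `[a, b]` with `a ∈ n`, and Jacobi gives
`[[a, b], y] = [a, [b, y]] - [b, [a, y]]`, where both terms have a smaller first index. -/
lemma lie_mem_radPow_add (i : ℕ) : ∀ (j : ℕ) {x y : L}, x ∈ radPow p i → y ∈ radPow p j →
    ⁅x, y⁆ ∈ radPow p (i + j) := by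
  have h1 : ∀ (j : ℕ) {x y : L}, x ∈ radicalIn p → y ∈ radPow p j → ⁅x, y⁆ ∈ radPow p (j + 1) := by
    intro j x y hx hy
    cases j with
    | zero =>
      rw [← lie_skew]
      exact neg_mem (lie_mem_radicalIn p hy hx)
    | succ j => exact lie_mem_brk hx hy
  induction i with
  | zero =>
    intro j x y hx hy
    rw [zero_add]
    exact lie_mem_radPow p hx j hy
  | succ i ih =>
    intro j x y hx hy
    cases i with
    | zero => rw [add_comm]; exact h1 j hx hy
    | succ i =>
      have : brk (radicalIn p) (radPow p (i + 1)) ≤ (radPow p (i + 1 + 1 + j)).comap (lieRight y) := by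
        refine brk_le fun a ha b hb => ?_
        rw [Submodule.mem_comap, lieRight_apply, lie_lie]
        refine sub_mem ?_ ?_
        · have := h1 _ ha (ih j hb hy)
          rwa [show i + 1 + j + 1 = i + 1 + 1 + j by ring] at this
        · have := ih (j + 1) hb (h1 _ ha hy)
          rwa [show i + 1 + (j + 1) = i + 1 + 1 + j by ring] at this
      have := this hx
      rwa [Submodule.mem_comap, lieRight_apply] at this

/-- The algebra `L` is itself a `p`-module, and the powers of `n` are bounded by the iterated images
`n·(⋯(n·L))`, which vanish eventually. -/
lemma exists_radPow_eq_bot [FiniteDimensional ℝ L] : ∃ k, radPow p (k + 1) = ⊥ := by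
  obtain ⟨k, hk⟩ := exists_iterate_nilpotentRadical_lie_eq_bot (K := p) (V := L)
  refine ⟨k, eq_bot_iff.2 ?_⟩
  have : ∀ j, radPow p (j + 1) ≤
      ((fun N : LieSubmodule ℝ p L => ⁅nilpotentRadical p, N⁆)^[j] ⊤).toSubmodule := by
    intro j
    induction j with
    | zero => exact fun _ _ => trivial
    | succ j ih =>
      refine brk_le fun a ha b hb => ?_
      obtain ⟨a, ha, rfl⟩ := ha
      rw [Function.iterate_succ_apply']
      exact LieSubmodule.lie_mem_lie ha (ih hb)
  have h2 := this k
  rw [hk] at h2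
  exact h2

variable [FiniteDimensional ℝ L]

/-- Two parabolic subalgebras are opposite. -/
structure IsOpposite (p q : LieSubalgebra ℝ L) : Prop where
  left : IsParabolic p
  right : IsParabolic q
  isCompl : IsCompl (killingPerp p) q.toSubmodule

lemma killingForm_comm' (x y : L) : killingForm ℝ L x y = killingForm ℝ L y x :=
  LieModule.traceForm_comm ℝ L L x y

lemma killingForm_lie (x y z : L) : killingForm ℝ L ⁅x, y⁆ z = killingForm ℝ L x ⁅y, z⁆ :=
  LieModule.traceForm_apply_lie_apply ℝ L L x y z

variable [LieAlgebra.IsSemisimple ℝ L]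

variable (L) in
lemma killingForm_nondegenerate' : LinearMap.BilinForm.Nondegenerate (killingForm ℝ L) :=
  LieAlgebra.IsKilling.killingForm_nondegenerate ℝ L

variable (L) in
lemma killingForm_isRefl : LinearMap.BilinForm.IsRefl (killingForm ℝ L) :=
  (LieModule.traceForm_isSymm ℝ L L).isRefl

lemma orthogonal_orthogonal_killing (W : Submodule ℝ L) :
    LinearMap.BilinForm.orthogonal (killingForm ℝ L)
      (LinearMap.BilinForm.orthogonal (killingForm ℝ L) W) = W :=
  LinearMap.BilinForm.orthogonal_orthogonal (killingForm_nondegenerate' L) (killingForm_isRefl L) W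

variable {p} {q : LieSubalgebra ℝ L}

/-- An element of `p ∩ q^⊥` is orthogonal to `p^⊥ + q = L`, so it is zero; counting dimensions of
orthogonals then gives the complement. -/
lemma IsOpposite.symm (h : IsOpposite p q) : IsOpposite q p := by
  refine ⟨h.right, h.left, ?_⟩
  have hn := killingForm_nondegenerate' L
  have hd : Disjoint p.toSubmodule (killingPerp q) := by
    rw [Submodule.disjoint_def]
    intro x hx hx'
    refine hn.2 x fun y => ?_
    obtain ⟨a, ha, b, hb, rfl⟩ :=
      Submodule.mem_sup.1 (h.isCompl.sup_eq_top ▸ Submodule.mem_top (x := y))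
    rw [map_add, LinearMap.add_apply, hx' b hb, add_zero, killingForm_comm']
    exact ha x hx
  refine ⟨hd.symm, codisjoint_iff.2 ?_⟩
  have e1 := LinearMap.BilinForm.finrank_orthogonal hn p.toSubmodule
  have e2 := LinearMap.BilinForm.finrank_orthogonal hn q.toSubmodule
  have e3 := Submodule.finrank_add_eq_of_isCompl h.isCompl
  have e4 := Submodule.finrank_sup_add_finrank_inf_eq p.toSubmodule (killingPerp q)
  rw [hd.eq_bot, finrank_bot] at e4
  have l1 := Submodule.finrank_le p.toSubmodule
  have l2 := Submodule.finrank_le q.toSubmodule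
  rw [sup_comm]
  apply Submodule.eq_top_of_finrank_eq
  unfold killingPerp at *
  omega

lemma IsOpposite.isCompl' (h : IsOpposite p q) : IsCompl (radicalIn p) q.toSubmodule := by
  rw [h.left]; exact h.isCompl

/-- This is `p = p^⊥^⊥`, with `p^⊥` replaced by the nilpotent radical. -/
lemma mem_of_killing_radicalIn (hp : IsParabolic p) {x : L}
    (hx : ∀ y ∈ radicalIn p, killingForm ℝ L y x = 0) : x ∈ p := by
  have : x ∈ LinearMap.BilinForm.orthogonal (killingForm ℝ L)
    (LinearMap.BilinForm.orthogonal (killingForm ℝ L) p.toSubmodule) := by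
    intro y hy
    exact hx y (by rw [hp]; exact hy)
  rwa [orthogonal_orthogonal_killing] at this

/-- The nilpotent radical of a parabolic subalgebra `p` is equal to `[p, n]`. -/
lemma IsOpposite.radicalIn_le_brk (h : IsOpposite p q) :
    radicalIn p ≤ brk p.toSubmodule (radicalIn p) := by
  have hdis := h.isCompl'.disjoint
  rw [Submodule.disjoint_def] at hdis
  set B := brk p.toSubmodule (radicalIn p) with hB
  have hBn : B ≤ radicalIn p := brk_le fun a ha b hb => lie_mem_radicalIn p ha hb
  rintro y hy
  by_contra hyB
  obtain ⟨ξ, hξ, rfl⟩ := id hy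
  -- a functional vanishing on `(p ∩ q) + [p, n]` but not on `ξ`
  have hyC : (p.toSubmodule.subtype ξ) ∉ (p.toSubmodule ⊓ q.toSubmodule) ⊔ B := by
    intro hmem
    obtain ⟨a, ha, b, hb, hab⟩ := Submodule.mem_sup.1 hmem
    have ha0 : a = 0 := by
      refine hdis a ?_ ha.2
      have : a = p.toSubmodule.subtype ξ - b := by rw [← hab]; abel
      rw [this]
      exact sub_mem hy (hBn hb)
    rw [ha0, zero_add] at hab
    exact hyB (hab ▸ hb)
  obtain ⟨f, hf, hfC⟩ := Submodule.exists_le_ker_of_notMem hyC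
  refine hf ?_
  refine apply_eq_zero_of_mem_nilpotentRadical (K := p) (f ∘ₗ p.toSubmodule.subtype) ?_ hξ
  intro x y
  refine LinearMap.mem_ker.1 (hfC ?_)
  change ⁅(x : L), (y : L)⁆ ∈ _
  have hdec : ∀ x : p, ∃ a ∈ p.toSubmodule ⊓ q.toSubmodule, ∃ b ∈ radicalIn p, (x : L) = a + b := by
    intro x
    obtain ⟨b, hb, a, ha, hab⟩ :=
      Submodule.mem_sup.1 (h.isCompl'.sup_eq_top ▸ Submodule.mem_top (x := (x : L)))
    refine ⟨a, ⟨?_, ha⟩, b, hb, by rw [← hab]; abel⟩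
    have : a = (x : L) - b := by rw [← hab]; abel
    rw [this]
    exact sub_mem x.2 (radicalIn_le p hb)
  obtain ⟨a, ha, b, hb, hx⟩ := hdec x
  obtain ⟨c, hc, d, hd, hy⟩ := hdec y
  -- With `x = a + b` and `y = c + d` split along `p = (p ∩ q) ⊕ n`, the bracket `[x, y]` equals
  -- `[a, c] ∈ p ∩ q` up to `[p, n]`. The functional therefore kills all brackets of `p`, and with
  -- them its nilpotent radical.
  have : ⁅(x : L), (y : L)⁆ = ⁅a, c⁆ + (⁅(x : L), d⁆ - ⁅c, b⁆) := by
    rw [← lie_skew c b, hy, lie_add, hx]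
    simp only [add_lie]
    abel
  rw [this]
  refine Submodule.add_mem_sup ⟨p.lie_mem ha.1 hc.1, q.lie_mem ha.2 hc.2⟩ ?_
  exact sub_mem (lie_mem_brk x.2 hd) (lie_mem_brk hc.1 hb)

/-- Parabolic subalgebras are self-normalizing. -/
lemma IsOpposite.mem_of_normalizes (h : IsOpposite p q) {x : L} (hx : ∀ y ∈ p, ⁅x, y⁆ ∈ p) :
    x ∈ p := by
  refine mem_of_killing_radicalIn h.left fun y hy => ?_
  -- By invariance `K(x, [a, b]) = K([x, a], b)`, which vanishes since `[x, a] ∈ p` and `b ∈ p^⊥`;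
  -- and `[p, n]` exhausts `n`.
  have : brk p.toSubmodule (radicalIn p) ≤ LinearMap.ker (killingForm ℝ L x) := by
    refine brk_le fun a ha b hb => ?_
    rw [LinearMap.mem_ker, ← killingForm_lie]
    rw [h.left] at hb
    exact hb _ (hx a ha)
  rw [killingForm_comm']
  exact this (h.radicalIn_le_brk hy)

end Parabolic

/-! ### The two-sided filtration of a parabolic and its grading elements. -/

section Filtration

variable {L : Type*} [LieRing L] [LieAlgebra ℝ L]

/-- The filtration of the Lie algebra induced by a parabolic subalgebra. -/
def filt (p : LieSubalgebra ℝ L) (j : ℤ) : Submodule ℝ L :=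
  if 0 < j then radPow p j.toNat
  else LinearMap.BilinForm.orthogonal (killingForm ℝ L) (radPow p (1 - j).toNat)

variable [FiniteDimensional ℝ L] [LieAlgebra.IsSemisimple ℝ L] {p : LieSubalgebra ℝ L}

lemma filt_natCast (hp : IsParabolic p) (k : ℕ) : filt p k = radPow p k := by
  rcases Nat.eq_zero_or_pos k with rfl | hk
  · unfold filt
    rw [if_neg (by simp)]
    change LinearMap.BilinForm.orthogonal _ (radicalIn p) = p.toSubmodule
    rw [hp]
    exact orthogonal_orthogonal_killing _
  · unfold filt
    rw [if_pos (by exact_mod_cast hk), Int.toNat_natCast]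

lemma filt_neg_natCast (p : LieSubalgebra ℝ L) (k : ℕ) :
    filt p (-k) = LinearMap.BilinForm.orthogonal (killingForm ℝ L) (radPow p (k + 1)) := by
  unfold filt
  rw [if_neg (by simp)]
  congr 2
  omega

lemma filt_zero (hp : IsParabolic p) : filt p 0 = p.toSubmodule := filt_natCast hp 0

lemma filt_one (hp : IsParabolic p) : filt p 1 = radicalIn p := filt_natCast hp 1

lemma filt_antitone (hp : IsParabolic p) : Antitone (filt p) := by
  refine antitone_int_of_succ_le fun j => ?_
  obtain ⟨k, rfl | rfl⟩ := j.eq_nat_or_neg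
  · rw [filt_natCast hp, ← Nat.cast_succ, filt_natCast hp]
    exact radPow_succ_le p k
  · cases k with
    | zero =>
      rw [Nat.cast_zero, neg_zero, zero_add, filt_zero hp, filt_one hp]
      exact radicalIn_le p
    | succ k =>
      rw [filt_neg_natCast, show -((k + 1 : ℕ) : ℤ) + 1 = -(k : ℤ) by push_cast; ring,
        filt_neg_natCast]
      exact LinearMap.BilinForm.orthogonal_le (radPow_succ_le p _)

lemma exists_filt_eq_bot (hp : IsParabolic p) :
    ∃ N : ℕ, filt p N = ⊥ ∧ filt p (-N) = ⊤ := by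
  obtain ⟨k, hk⟩ := exists_radPow_eq_bot p
  refine ⟨k + 1, ?_, ?_⟩
  · rw [filt_natCast hp, hk]
  · have : radPow p (k + 1 + 1) = ⊥ := eq_bot_iff.2 (hk ▸ radPow_succ_le p (k + 1))
    rw [filt_neg_natCast, this]
    exact LinearMap.BilinForm.orthogonal_bot

/-- The duality `(F⁻ʲ)^⊥ ⊆ Fʲ⁺¹`. The shift by one comes from `p^⊥ = n`; in degrees at most `0` it
is the definition, in positive degrees it is the double orthogonal. -/
lemma mem_filt_succ (hp : IsParabolic p) (j : ℤ) {x : L}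
    (hx : ∀ y ∈ filt p (-j), killingForm ℝ L x y = 0) : x ∈ filt p (j + 1) := by
  obtain ⟨k, rfl | rfl⟩ := j.eq_nat_or_neg
  · rw [← Nat.cast_succ, filt_natCast hp, ← orthogonal_orthogonal_killing (radPow p _)]
    intro y hy
    rw [Nat.succ_eq_add_one, ← filt_neg_natCast] at hy
    rw [killingForm_comm']
    exact hx y hy
  · rw [neg_neg, filt_natCast hp] at hx
    cases k with
    | zero =>
      rw [Nat.cast_zero, neg_zero, zero_add, filt_one hp, hp]
      intro y hy
      rw [killingForm_comm']
      exact hx y hy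
    | succ k =>
      rw [show -((k + 1 : ℕ) : ℤ) + 1 = -(k : ℤ) by push_cast; ring, filt_neg_natCast]
      intro y hy
      rw [killingForm_comm']
      exact hx y hy

/-- The case of degrees `i` and `-k`. If `i ≤ k`, invariance of the Killing form reduces it to
brackets of powers of `n`. If `i = k + 1`, the target is `F¹ = p^⊥` and the same duality applies. If
`i > k + 1`, the element `x` is a sum of brackets with elements of `n`, and Jacobi lowers `i`. -/
lemma lie_mem_filt_aux (hp : IsParabolic p) (i : ℕ) : ∀ (k : ℕ) {x y : L}, x ∈ radPow p i →
    y ∈ LinearMap.BilinForm.orthogonal (killingForm ℝ L) (radPow p (k + 1)) →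
    ⁅x, y⁆ ∈ filt p (i - k) := by
  have hlow : ∀ (i k : ℕ) {x y : L}, i ≤ k → x ∈ radPow p i →
      y ∈ LinearMap.BilinForm.orthogonal (killingForm ℝ L) (radPow p (k + 1)) →
      ⁅x, y⁆ ∈ filt p (i - k) := by
    intro i k x y hik hx hy
    obtain ⟨l, rfl⟩ := Nat.exists_eq_add_of_le hik
    rw [show (i : ℤ) - (i + l : ℕ) = -(l : ℤ) by push_cast; ring, filt_neg_natCast]
    intro w hw
    rw [← killingForm_lie]
    refine hy _ ?_
    rw [show i + l + 1 = l + 1 + i by ring]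
    exact lie_mem_radPow_add p _ _ hw hx
  induction i with
  | zero => exact fun k x y hx hy => hlow 0 k (Nat.zero_le _) hx hy
  | succ i ih =>
    intro k x y hx hy
    rcases Nat.lt_trichotomy i k with hik | rfl | hik
    · exact hlow _ _ hik hx hy
    · rw [show ((i + 1 : ℕ) : ℤ) - i = 1 by push_cast; ring, filt_one hp, hp]
      intro w hw
      rw [← killingForm_lie]
      exact hy _ (lie_mem_radPow p hw _ hx)
    · obtain ⟨l, rfl⟩ := Nat.exists_eq_add_of_lt hik
      have e : (((k + l + 1 : ℕ) + 1 : ℕ) : ℤ) - k = ((l + 2 : ℕ) : ℤ) := by push_cast; ring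
      rw [e]
      have : brk (radicalIn p) (radPow p (k + l + 1)) ≤ (filt p (l + 2 : ℕ)).comap (lieRight y) := by
        refine brk_le fun a ha b hb => ?_
        rw [Submodule.mem_comap, lieRight_apply, lie_lie]
        refine sub_mem ?_ ?_
        · have := ih k hb hy
          rw [show ((k + l + 1 : ℕ) : ℤ) - k = ((l + 1 : ℕ) : ℤ) by push_cast; ring,
            filt_natCast hp] at this
          rw [filt_natCast hp]
          exact lie_mem_brk ha this
        · cases k with
          | zero =>
            have hy' : y ∈ p := mem_of_killing_radicalIn hp hy
            have h1 : ⁅a, y⁆ ∈ radPow p 1 := by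
              rw [← lie_skew]
              exact neg_mem (lie_mem_radicalIn p hy' ha)
            have := lie_mem_radPow_add p _ _ hb h1
            rw [filt_natCast hp]
            convert this using 2
            ring
          | succ k =>
            have h1 := hlow 1 (k + 1) (by omega) (show a ∈ radPow p 1 from ha) hy
            rw [show ((1 : ℕ) : ℤ) - (k + 1 : ℕ) = -(k : ℤ) by push_cast; ring,
              filt_neg_natCast] at h1
            have := ih k hb h1
            rwa [show ((k + 1 + l + 1 : ℕ) : ℤ) - k = ((l + 2 : ℕ) : ℤ) by push_cast; ring] at this
      have := this hx
      rwa [Submodule.mem_comap, lieRight_apply] at this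

/-- The filtration is compatible with the Lie bracket. -/
lemma lie_mem_filt (hp : IsParabolic p) {i j : ℤ} {x y : L} (hx : x ∈ filt p i)
    (hy : y ∈ filt p j) : ⁅x, y⁆ ∈ filt p (i + j) := by
  obtain ⟨k, rfl | rfl⟩ := i.eq_nat_or_neg <;> obtain ⟨l, rfl | rfl⟩ := j.eq_nat_or_neg
  · rw [filt_natCast hp] at hx hy
    rw [← Nat.cast_add, filt_natCast hp]
    exact lie_mem_radPow_add p _ _ hx hy
  · rw [filt_natCast hp] at hx
    rw [filt_neg_natCast] at hy
    exact lie_mem_filt_aux hp _ _ hx hy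
  · rw [filt_natCast hp] at hy
    rw [filt_neg_natCast] at hx
    rw [← lie_skew, show -(k : ℤ) + l = l - k by ring]
    exact neg_mem (lie_mem_filt_aux hp _ _ hy hx)
  · rw [filt_neg_natCast] at hx hy
    rw [show -(k : ℤ) + -(l : ℤ) = -((k + l : ℕ) : ℤ) by push_cast; ring, filt_neg_natCast]
    intro w hw
    rw [← lie_skew, map_neg, ← killingForm_lie, neg_eq_zero]
    refine hx _ ?_
    have := lie_mem_filt_aux hp _ _ hw hy
    rwa [show ((k + l + 1 : ℕ) : ℤ) - l = ((k + 1 : ℕ) : ℤ) by push_cast; ring,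
      filt_natCast hp] at this

/-- An endomorphism raising the degree of the filtration by `d`. -/
def degGE (p : LieSubalgebra ℝ L) (d : ℤ) : Submodule ℝ (Module.End ℝ L) where
  carrier := {T | ∀ j, ∀ x ∈ filt p j, T x ∈ filt p (j + d)}
  add_mem' ha hb j x hx := add_mem (ha j x hx) (hb j x hx)
  zero_mem' j x _ := zero_mem _
  smul_mem' c _ ha j x hx := Submodule.smul_mem _ c (ha j x hx)

lemma mul_mem_degGE {a b : ℤ} {S T : Module.End ℝ L} (hS : S ∈ degGE p a) (hT : T ∈ degGE p b) :
    S * T ∈ degGE p (a + b) := fun j x hx => by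
  have := hS _ _ (hT j x hx)
  rwa [show j + b + a = j + (a + b) by ring] at this

lemma degGE_antitone (hp : IsParabolic p) : Antitone (degGE p) := fun _ _ hab _ hT j x hx =>
  filt_antitone hp (by linarith) (hT j x hx)

lemma ad_mem_degGE (hp : IsParabolic p) {i : ℤ} {x : L} (hx : x ∈ filt p i) :
    LieAlgebra.ad ℝ L x ∈ degGE p i := fun j y hy => by
  rw [add_comm]
  exact lie_mem_filt hp hx hy

lemma pow_mem_degGE {T : Module.End ℝ L} {a : ℤ} (hT : T ∈ degGE p a) (k : ℕ) :
    T ^ k ∈ degGE p (k * a) := by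
  induction k with
  | zero => intro j x hx; simpa using hx
  | succ k ih =>
    rw [pow_succ]
    have := mul_mem_degGE ih hT
    rwa [show (k : ℤ) * a + a = ((k + 1 : ℕ) : ℤ) * a by push_cast; ring] at this

lemma isNilpotent_of_mem_degGE (hp : IsParabolic p) {T : Module.End ℝ L} (hT : T ∈ degGE p 1) :
    IsNilpotent T := by
  obtain ⟨N, h0, h1⟩ := exists_filt_eq_bot hp
  refine ⟨N + N, LinearMap.ext fun x => ?_⟩
  have := pow_mem_degGE hT (N + N) (-N) x (h1 ▸ Submodule.mem_top)
  rw [show -(N : ℤ) + (N + N : ℕ) * 1 = N by push_cast; ring, h0] at this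
  exact (Submodule.mem_bot ℝ).1 this

/-- The filtration is bounded on both sides, so an operator raising degrees by arbitrarily much is
zero. -/
lemma eq_zero_of_mem_degGE (hp : IsParabolic p) {T : Module.End ℝ L}
    (hT : ∀ k : ℕ, T ∈ degGE p (k + 1)) : T = 0 := by
  obtain ⟨N, h0, h1⟩ := exists_filt_eq_bot hp
  refine LinearMap.ext fun x => ?_
  have := hT (N + N) (-N) x (h1 ▸ Submodule.mem_top)
  have := filt_antitone hp (by push_cast; linarith : (N : ℤ) ≤ -(N : ℤ) + (((N + N : ℕ) : ℤ) + 1)) this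
  rw [h0] at this
  exact (Submodule.mem_bot ℝ).1 this

lemma trace_eq_zero_of_mem_degGE (hp : IsParabolic p) {T : Module.End ℝ L} (hT : T ∈ degGE p 1) :
    LinearMap.trace ℝ L T = 0 :=
  (LinearMap.isNilpotent_trace_of_isNilpotent (isNilpotent_of_mem_degGE hp hT)).eq_zero

/-- There is a linear operator acting on the `j`-th graded piece as multiplication by `j`. -/
lemma exists_grading_operator (hp : IsParabolic p) :
    ∃ D : Module.End ℝ L, ∀ j : ℤ, ∀ x ∈ filt p j, D x - (j : ℝ) • x ∈ filt p (j + 1) := by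
  obtain ⟨N, h0, h1⟩ := exists_filt_eq_bot hp
  choose π hπ using fun j : ℤ => (filt p j).subtype.exists_leftInverse_of_injective
    (LinearMap.ker_eq_bot.2 (filt p j).injective_subtype)
  have hπ1 : ∀ j : ℤ, ∀ x ∈ filt p j, ((π j x : filt p j) : L) = x := fun j x hx => by
    have := LinearMap.congr_fun (hπ j) ⟨x, hx⟩
    exact congrArg Subtype.val this
  -- `Q i` is a linear projection onto `F^{-N+1+i}`. On `F^{-N+j}` it is the identity for `i < j`,
  -- and for `i ≥ j` its values lie one degree higher, so the sum of all `Q i` acts as `j` there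
  -- modulo higher degree.
  let Q : ℕ → Module.End ℝ L := fun i => (filt p (-N + 1 + i)).subtype ∘ₗ π (-N + 1 + i)
  have key : ∀ (M : ℕ) (j : ℕ), ∀ x ∈ filt p (-N + j), j ≤ M →
      ∑ i ∈ Finset.range M, Q i x - (j : ℝ) • x ∈ filt p (-N + j + 1) := by
    intro M j x hx hj
    induction M, hj using Nat.le_induction with
    | base =>
      have : ∑ i ∈ Finset.range j, Q i x = (j : ℝ) • x := by
        rw [Finset.sum_congr rfl (g := fun _ => x), Finset.sum_const, Finset.card_range,
          Nat.cast_smul_eq_nsmul]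
        intro i hi
        refine hπ1 _ _ (filt_antitone hp ?_ hx)
        have := Finset.mem_range.1 hi
        omega
      rw [this, sub_self]
      exact zero_mem _
    | succ M hM ih =>
      rw [Finset.sum_range_succ, add_sub_right_comm]
      refine add_mem ih ?_
      refine filt_antitone hp ?_ (π (-N + 1 + M) x).2
      omega
  -- The sum counts degrees from `-N`; subtracting `N` shifts the count to start at `0`.
  refine ⟨∑ i ∈ Finset.range (N + N), Q i - (N : ℝ) • 1, fun j x hx => ?_⟩
  have e : (∑ i ∈ Finset.range (N + N), Q i - (N : ℝ) • (1 : Module.End ℝ L)) x - (j : ℝ) • x =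
      ∑ i ∈ Finset.range (N + N), Q i x - ((N : ℝ) + j) • x := by
    simp only [LinearMap.sub_apply, LinearMap.sum_apply, LinearMap.smul_apply, Module.End.one_apply]
    module
  rw [e]
  rcases lt_or_ge j (-N) with hj | hj
  · have : filt p (j + 1) = ⊤ := eq_top_iff.2 (h1 ▸ filt_antitone hp (by omega))
    rw [this]; exact Submodule.mem_top
  obtain ⟨k, hk⟩ := Int.eq_ofNat_of_zero_le (by omega : 0 ≤ N + j)
  rcases le_or_gt k (N + N) with hk2 | hk2
  · have := key (N + N) k x (by rwa [show -(N : ℤ) + k = j by omega]) hk2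
    rw [show -(N : ℤ) + k + 1 = j + 1 by omega] at this
    rwa [show (N : ℝ) + j = (k : ℝ) by exact_mod_cast hk]
  · have : filt p j = ⊥ := eq_bot_iff.2 (h0 ▸ filt_antitone hp (by omega))
    rw [this, Submodule.mem_bot] at hx
    subst hx
    simp

/-- `z` is a grading element for `p`. -/
def IsGrading (p : LieSubalgebra ℝ L) (z : L) : Prop :=
  ∀ j : ℤ, ∀ x ∈ filt p j, ⁅z, x⁆ - (j : ℝ) • x ∈ filt p (j + 1)

/-- The Killing form represents the functional `y ↦ tr(D ∘ ad y)`, where `D` is the grading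
operator, by an element `z`. With `X = ad x`, `Y = ad y`, invariance gives `K([z, x] - j x, y) =
tr(([D, X] - j X) Y)`. For `x ∈ Fʲ` and `y ∈ F⁻ʲ` the operator in this trace raises degrees by `1`,
so it is nilpotent and has trace zero; duality concludes. -/
lemma exists_isGrading (hp : IsParabolic p) : ∃ z : L, IsGrading p z := by
  obtain ⟨D, hD⟩ := exists_grading_operator hp
  let τ : Module.Dual ℝ L :=
    LinearMap.trace ℝ L ∘ₗ LinearMap.mulLeft ℝ D ∘ₗ
      LinearMap.mk₂ ℝ (fun a b : L => ⁅a, b⁆) add_lie smul_lie lie_add lie_smul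
  obtain ⟨z, hz⟩ := ((killingForm ℝ L).toDual (killingForm_nondegenerate' L)).surjective τ
  have hzy : ∀ y, killingForm ℝ L z y = LinearMap.trace ℝ L (D * LieAlgebra.ad ℝ L y) := fun y => by
    rw [← LinearMap.BilinForm.toDual_def (killingForm_nondegenerate' L), hz]
    rfl
  refine ⟨z, fun j x hx => mem_filt_succ hp j fun y hy => ?_⟩
  have hk : ∀ a b : L, killingForm ℝ L a b =
      LinearMap.trace ℝ L (LieAlgebra.ad ℝ L a * LieAlgebra.ad ℝ L b) := fun a b => rfl
  have had : LieAlgebra.ad ℝ L ⁅x, y⁆ = LieAlgebra.ad ℝ L x * LieAlgebra.ad ℝ L y -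
      LieAlgebra.ad ℝ L y * LieAlgebra.ad ℝ L x := by
    ext w
    exact lie_lie x y w
  rw [map_sub, LinearMap.sub_apply, map_smul, LinearMap.smul_apply, killingForm_lie, hzy, hk,
    had, smul_eq_mul]
  set X := LieAlgebra.ad ℝ L x
  set Y := LieAlgebra.ad ℝ L y
  have h1 : LinearMap.trace ℝ L (D * (X * Y - Y * X)) = LinearMap.trace ℝ L ((D * X - X * D) * Y) := by
    rw [mul_sub, sub_mul, map_sub, map_sub, ← mul_assoc, ← mul_assoc,
      LinearMap.trace_mul_comm ℝ (D * Y) X, mul_assoc X D Y]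
  have h2 : (D * X - X * D - (j : ℝ) • X) * Y ∈ degGE p 1 := by
    have hXY : D * X - X * D - (j : ℝ) • X ∈ degGE p (j + 1) := by
      intro i w hw
      have hX := ad_mem_degGE hp hx i w hw
      have e : (D * X - X * D - (j : ℝ) • X) w =
          (D (X w) - ((i + j : ℤ) : ℝ) • X w) - X (D w - (i : ℝ) • w) := by
        simp only [LinearMap.sub_apply, Module.End.mul_apply, LinearMap.smul_apply, map_sub, map_smul]
        push_cast
        module
      rw [e, ← add_assoc]
      refine sub_mem (hD _ _ hX) ?_
      have := ad_mem_degGE hp hx _ _ (hD i w hw)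
      rwa [add_right_comm] at this
    have := mul_mem_degGE hXY (ad_mem_degGE hp hy)
    rwa [show j + 1 + -j = 1 by ring] at this
  have h3 := trace_eq_zero_of_mem_degGE hp h2
  rw [sub_mul, map_sub, smul_mul_assoc, map_smul, smul_eq_mul] at h3
  rw [h1, h3]

lemma IsGrading.add {z w : L} (hp : IsParabolic p) (hz : IsGrading p z) (hw : w ∈ radicalIn p) :
    IsGrading p (z + w) := fun j x hx => by
  rw [add_lie, add_sub_right_comm]
  refine add_mem (hz j x hx) ?_
  rw [add_comm]
  exact lie_mem_filt hp (by rwa [filt_one hp]) hx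

/-- In degree `0` the grading condition says `[z, p] ⊆ n`, and `p` is self-normalizing. -/
lemma IsGrading.mem {q : LieSubalgebra ℝ L} (h : IsOpposite p q) {z : L} (hz : IsGrading p z) :
    z ∈ p := by
  refine h.mem_of_normalizes fun y hy => ?_
  have := hz 0 y (by rwa [filt_zero h.left])
  rw [Int.cast_zero, zero_smul, sub_zero, zero_add, filt_one h.left] at this
  exact radicalIn_le p this

/-- A grading element stays one when an element of `n` is added, so its component in `n` along `n ⊕
q` can be removed. -/
lemma exists_isGrading_inf {q : LieSubalgebra ℝ L} (h : IsOpposite p q) :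
    ∃ z : L, IsGrading p z ∧ z ∈ p ∧ z ∈ q := by
  obtain ⟨z, hz⟩ := exists_isGrading h.left
  obtain ⟨b, hb, a, ha, hab⟩ :=
    Submodule.mem_sup.1 (h.isCompl'.sup_eq_top ▸ Submodule.mem_top (x := z))
  have e : a = z + -b := by rw [← hab]; abel
  have hg : IsGrading p a := e ▸ hz.add h.left (neg_mem hb)
  exact ⟨a, hg, hg.mem h, ha⟩

end Filtration

/-! ### Unipotent operators against a grading element. -/

section NilpotentExponential

variable {L : Type*} [LieRing L] [LieAlgebra ℝ L]

/-- The truncated exponential series. -/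
def truncExp (M : ℕ) (T : Module.End ℝ L) : Module.End ℝ L :=
  ∑ i ∈ Finset.range M, ((i.factorial : ℝ)⁻¹) • T ^ i

lemma truncExp_zero {M : ℕ} (hM : 1 ≤ M) : truncExp M (0 : Module.End ℝ L) = 1 := by
  unfold truncExp
  rw [Finset.sum_eq_single_of_mem 0 (Finset.mem_range.2 hM)]
  · simp
  · intro i _ hi
    simp [zero_pow hi]

variable [FiniteDimensional ℝ L] [LieAlgebra.IsSemisimple ℝ L] {p : LieSubalgebra ℝ L}

/-- Each word in the expansion contains a `B`, of degree `i`, and at least one further factor of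
degree at least `1`. -/
lemma pow_add_sub_pow_mem_degGE (hp : IsParabolic p) {i : ℤ} (hi : 1 ≤ i) {A B : Module.End ℝ L}
    (hA : A ∈ degGE p 1) (hB : B ∈ degGE p i) (k : ℕ) :
    (A + B) ^ (k + 2) - A ^ (k + 2) ∈ degGE p (i + 1) := by
  have hAB : A + B ∈ degGE p 1 := add_mem hA (degGE_antitone hp hi hB)
  have e : ∀ k : ℕ, (A + B) ^ (k + 1) - A ^ (k + 1) = (A + B) * ((A + B) ^ k - A ^ k) + B * A ^ k := by
    intro k
    rw [pow_succ', pow_succ']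
    noncomm_ring
  induction k with
  | zero =>
    rw [e, pow_one, pow_one, add_sub_cancel_left]
    refine add_mem ?_ (mul_mem_degGE hB hA)
    rw [add_comm i]
    exact mul_mem_degGE hAB hB
  | succ k ih =>
    rw [e]
    refine add_mem ?_ ?_
    · exact degGE_antitone hp (by linarith) (mul_mem_degGE hAB ih)
    · refine degGE_antitone hp ?_ (mul_mem_degGE hB (pow_mem_degGE hA (k + 2)))
      push_cast
      linarith

/-- To first order in the filtration the exponential is additive: the linear terms differ by exactly
`B`, and all later ones differ in degree `i + 1`. -/
lemma truncExp_add_mem_degGE (hp : IsParabolic p) {i : ℤ} (hi : 1 ≤ i) {A B : Module.End ℝ L}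
    (hA : A ∈ degGE p 1) (hB : B ∈ degGE p i) (M : ℕ) :
    truncExp (M + 2) (A + B) - truncExp (M + 2) A - B ∈ degGE p (i + 1) := by
  unfold truncExp
  have e : ∑ i ∈ Finset.range (M + 2), ((i.factorial : ℝ)⁻¹) • (A + B) ^ i -
      ∑ i ∈ Finset.range (M + 2), ((i.factorial : ℝ)⁻¹) • A ^ i - B =
      ∑ k ∈ Finset.range M, (((k + 2).factorial : ℝ)⁻¹) • ((A + B) ^ (k + 2) - A ^ (k + 2)) := by
    rw [← Finset.sum_sub_distrib, Finset.sum_range_succ', Finset.sum_range_succ']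
    simp only [smul_sub]
    simp
  rw [e]
  exact sum_mem fun k _ => Submodule.smul_mem _ _ (pow_add_sub_pow_mem_degGE hp hi hA hB k)

lemma truncExp_sub_one_mem_degGE (hp : IsParabolic p) {A : Module.End ℝ L}
    (hA : A ∈ degGE p 1) (M : ℕ) : truncExp (M + 2) A - 1 ∈ degGE p 1 := by
  have h0 : (0 : Module.End ℝ L) ∈ degGE p 1 := zero_mem _
  have := truncExp_add_mem_degGE hp le_rfl h0 hA M
  rw [zero_add, truncExp_zero (by omega)] at this
  have h2 := add_mem (degGE_antitone hp (by norm_num : (1 : ℤ) ≤ 1 + 1) this) hA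
  rwa [sub_add_cancel] at h2

lemma ad_mem_degGE_of_radicalIn (hp : IsParabolic p) {x : L} (hx : x ∈ radicalIn p) :
    LieAlgebra.ad ℝ L x ∈ degGE p 1 := ad_mem_degGE hp (by rwa [filt_one hp])

/-- Changing the exponent in degree `i` moves a grading element in degree `i`. -/
lemma truncExp_ad_add_apply (hp : IsParabolic p) {z : L} (hz : IsGrading p z) (hzp : z ∈ p)
    {i : ℤ} (hi : 1 ≤ i) {x d w : L} (hx : x ∈ radicalIn p) (hd : d ∈ filt p i)
    (hw : w ∈ radicalIn p) (M : ℕ) :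
    truncExp (M + 2) (LieAlgebra.ad ℝ L (x + d)) (z + w) -
      truncExp (M + 2) (LieAlgebra.ad ℝ L x) (z + w) + (i : ℝ) • d ∈ filt p (i + 1) := by
  have h1 := truncExp_add_mem_degGE hp hi (ad_mem_degGE_of_radicalIn hp hx) (ad_mem_degGE hp hd) M
  rw [← map_add] at h1
  have hzw : z + w ∈ filt p 0 := by
    rw [filt_zero hp]; exact add_mem hzp (radicalIn_le p hw)
  have h2 := h1 0 _ hzw
  rw [zero_add] at h2
  have h3 : ⁅d, w⁆ ∈ filt p (i + 1) := lie_mem_filt hp hd (by rwa [filt_one hp])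
  have h4 := add_mem (sub_mem h2 (hz i d hd)) h3
  convert h4 using 1
  simp only [LinearMap.sub_apply, LieAlgebra.ad_apply, lie_add]
  rw [← lie_skew d z]
  abel

/-- For `x ∈ F^{k+1}` one has `exp(ad x) z ≡ z - (k+1) x` modulo `F^{k+2}`, so fixing `z` pushes `x`
one step deeper, indefinitely. -/
lemma eq_zero_of_truncExp_ad_apply (hp : IsParabolic p) {z : L} (hz : IsGrading p z) (hzp : z ∈ p)
    {x : L} (hx : x ∈ radicalIn p) {M : ℕ}
    (h : truncExp (M + 2) (LieAlgebra.ad ℝ L x) z = z) : x = 0 := by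
  have : ∀ k : ℕ, x ∈ filt p (k + 1) := by
    intro k
    induction k with
    | zero => simpa [filt_one hp] using hx
    | succ k ih =>
      have h1 := truncExp_ad_add_apply hp hz hzp (by omega) (zero_mem (radicalIn p)) ih
        (zero_mem (radicalIn p)) M
      rw [zero_add, add_zero, h, map_zero, truncExp_zero (by omega), Module.End.one_apply, sub_self,
        zero_add] at h1
      have h2 := Submodule.smul_mem _ ((((k : ℤ) + 1 : ℤ) : ℝ)⁻¹) h1
      rw [smul_smul, inv_mul_cancel₀ (by exact_mod_cast (by omega : (k : ℤ) + 1 ≠ 0)), one_smul] at h2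
      exact_mod_cast h2
  obtain ⟨N, h0, -⟩ := exists_filt_eq_bot hp
  have h2 := filt_antitone hp (by omega : (N : ℤ) ≤ N + 1) (this N)
  rw [h0] at h2
  exact (Submodule.mem_bot ℝ).1 h2

/-- A unipotent automorphism fixing a grading element is trivial. -/
lemma eq_one_of_apply_grading (hp : IsParabolic p) {z : L} (hz : IsGrading p z)
    {φ : Module.End ℝ L} (hφ : ∀ x y : L, φ ⁅x, y⁆ = ⁅φ x, φ y⁆) (hφ1 : φ - 1 ∈ degGE p 1)
    (hφz : φ z = z) : φ = 1 := by
  rw [← sub_eq_zero]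
  refine eq_zero_of_mem_degGE hp fun k => ?_
  induction k with
  | zero => simpa using hφ1
  | succ k ih =>
    intro j x hx
    set N := φ - 1
    have hN : ∀ x, N ⁅z, x⁆ = ⁅z, N x⁆ := fun x => by
      simp only [N, LinearMap.sub_apply, Module.End.one_apply, hφ, hφz, lie_sub]
    -- `N` commutes with `ad z`, so modulo `F^{j+k+2}` the element `z` acts on `N x` by `j`. As `N x
    -- ∈ F^{j+k+1}`, it also acts by `j + k + 1`; the difference `k + 1` is invertible, which raises
    -- the degree of `N x`.
    have h1 := ih _ _ (hz j x hx)
    have h2 := hz _ _ (ih j x hx)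
    rw [map_sub, map_smul, hN] at h1
    rw [add_right_comm] at h1
    have h3 := sub_mem h1 h2
    have h4 := Submodule.smul_mem _ ((((k : ℤ) + 1 : ℤ) : ℝ)⁻¹) h3
    have e : (⁅z, N x⁆ - (j : ℝ) • N x - (⁅z, N x⁆ - ((j + (k + 1) : ℤ) : ℝ) • N x)) =
        (((k : ℤ) + 1 : ℤ) : ℝ) • N x := by
      push_cast
      module
    rw [e, smul_smul, inv_mul_cancel₀ (by exact_mod_cast (by omega : (k : ℤ) + 1 ≠ 0)),
      one_smul] at h4
    rw [show j + (((k + 1 : ℕ) : ℤ) + 1) = j + (k + 1) + 1 by push_cast; ring]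
    exact h4

/-- A complement of the nilpotent radical is determined by a grading element in it, if it is stable
under this element. -/
lemma le_of_stable_grading (hp : IsParabolic p) {z : L} (hz : IsGrading p z)
    {A B : Submodule ℝ L} (hA : Disjoint (radicalIn p) A) (hB : IsCompl (radicalIn p) B)
    (hzA : ∀ x ∈ A, ⁅z, x⁆ ∈ A) (hzB : ∀ x ∈ B, ⁅z, x⁆ ∈ B) : A ≤ B := by
  -- Descending induction on the filtration degree `1 - k`, starting from `F¹ = n`, which meets `A`
  -- trivially.
  have key : ∀ k : ℕ, ∀ x ∈ A, x ∈ filt p (1 - k) → x ∈ B := by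
    intro k
    induction k with
    | zero =>
      intro x hx hx1
      rw [Nat.cast_zero, sub_zero, filt_one hp] at hx1
      rw [Submodule.disjoint_def.1 hA x hx1 hx]
      exact zero_mem _
    | succ k ih =>
      intro x hx hx1
      obtain ⟨v, hv, b, hb, rfl⟩ :=
        Submodule.mem_sup.1 (hB.sup_eq_top ▸ Submodule.mem_top (x := x))
      set j : ℤ := 1 - ((k + 1 : ℕ) : ℤ) with hj
      have h1 : ⁅z, v + b⁆ - (j : ℝ) • (v + b) ∈ B := by
        refine ih _ (sub_mem (hzA _ hx) (Submodule.smul_mem _ _ hx)) ?_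
        have := hz _ _ hx1
        rwa [show j + 1 = 1 - (k : ℤ) by rw [hj]; push_cast; ring] at this
      have hvp : ⁅z, v⁆ ∈ radicalIn p := by
        rw [← filt_one hp] at hv ⊢
        have := add_mem (filt_antitone hp (by norm_num) (hz _ _ hv)) (Submodule.smul_mem _ ((1 : ℤ) : ℝ) hv)
        rwa [sub_add_cancel] at this
      -- Applying `ad z - j` to `x = v + b` lands in `A ∩ F^{j+1} ⊆ B`, and `B` is stable; hence the
      -- image of `v` lies in `n ∩ B = 0`.
      have h2 : ⁅z, v⁆ - (j : ℝ) • v = 0 := by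
        refine Submodule.disjoint_def.1 hB.disjoint _
          (sub_mem hvp (Submodule.smul_mem _ _ hv)) ?_
        have := sub_mem h1 (sub_mem (hzB b hb) (Submodule.smul_mem _ (j : ℝ) hb))
        convert this using 1
        rw [lie_add]
        module
      -- An eigenvector in `n` with eigenvalue `j ≤ 0` vanishes, because the degrees occurring in
      -- `n` are all positive.
      have h3 : ∀ i : ℕ, v ∈ filt p (i + 1) := by
        intro i
        induction i with
        | zero => simpa [filt_one hp] using hv
        | succ i ih2 =>
          have h4 := hz _ _ ih2
          have e : ⁅z, v⁆ - ((i + 1 : ℤ) : ℝ) • v = ((j - (i + 1) : ℤ) : ℝ) • v := by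
            rw [sub_eq_zero.1 h2]
            push_cast
            module
          rw [e] at h4
          have h5 := Submodule.smul_mem _ (((j - (i + 1) : ℤ) : ℝ)⁻¹) h4
          rw [smul_smul, inv_mul_cancel₀ (by exact_mod_cast (by omega : j - ((i : ℤ) + 1) ≠ 0)),
            one_smul] at h5
          exact_mod_cast h5
      obtain ⟨N, h0, -⟩ := exists_filt_eq_bot hp
      have h6 := filt_antitone hp (by omega : (N : ℤ) ≤ N + 1) (h3 N)
      rw [h0, Submodule.mem_bot] at h6
      rw [h6, zero_add]
      exact hb
  obtain ⟨N, -, h1⟩ := exists_filt_eq_bot hp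
  intro x hx
  refine key (N + 1) x hx ?_
  rw [show 1 - ((N + 1 : ℕ) : ℤ) = -(N : ℤ) by push_cast; ring, h1]
  exact Submodule.mem_top

end NilpotentExponential

/-! ### Smoothness of the adjoint action, in the chart at the identity. -/

section AdjointAction

open Filter Topology

variable {E G : Type*} [NormedAddCommGroup E] [NormedSpace ℝ E]
  [TopologicalSpace G] [ChartedSpace E G] [Group G] [LieGroup 𝓘(ℝ, E) ∞ G]

variable (E G) in
/-- The preferred chart at the identity. -/
abbrev chart1 : PartialEquiv G E := extChartAt 𝓘(ℝ, E) (1 : G)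

variable (E G) in
/-- The multiplication in the chart at the identity. -/
def chartMul (v : E × E) : E := chart1 E G ((chart1 E G).symm v.1 * (chart1 E G).symm v.2)

variable (E G) in
/-- The conjugation in the chart at the identity. -/
def chartConj (v : E × E) : E :=
  chart1 E G ((chart1 E G).symm v.1 * (chart1 E G).symm v.2 * ((chart1 E G).symm v.1)⁻¹)

lemma chart1_symm_one : (chart1 E G).symm (chart1 E G 1) = 1 :=
  extChartAt_to_inv (I := 𝓘(ℝ, E)) (1 : G)

lemma contMDiffAt_chart1_symm : ContMDiffAt 𝓘(ℝ, E) 𝓘(ℝ, E) ∞ (chart1 E G).symm (chart1 E G 1) :=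
  (contMDiffOn_extChartAt_symm (n := ∞) (1 : G)).contMDiffAt (extChartAt_target_mem_nhds (1 : G))

lemma contMDiffAt_chart1 : ContMDiffAt 𝓘(ℝ, E) 𝓘(ℝ, E) ∞ (chart1 E G) (1 : G) :=
  contMDiffAt_extChartAt

lemma contDiffAt_chartMul : ContDiffAt ℝ ∞ (chartMul E G) (chart1 E G 1, chart1 E G 1) := by
  rw [← contMDiffAt_iff_contDiffAt]
  have h1 : ContMDiffAt 𝓘(ℝ, E × E) 𝓘(ℝ, E) ∞ (fun v : E × E => (chart1 E G).symm v.1)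
      (chart1 E G 1, chart1 E G 1) :=
    ContMDiffAt.comp (x := (chart1 E G 1, chart1 E G 1)) (g := (chart1 E G).symm)
      (f := Prod.fst) contMDiffAt_chart1_symm contDiff_fst.contMDiff.contMDiffAt
  have h2 : ContMDiffAt 𝓘(ℝ, E × E) 𝓘(ℝ, E) ∞ (fun v : E × E => (chart1 E G).symm v.2)
      (chart1 E G 1, chart1 E G 1) :=
    ContMDiffAt.comp (x := (chart1 E G 1, chart1 E G 1)) (g := (chart1 E G).symm)
      (f := Prod.snd) contMDiffAt_chart1_symm contDiff_snd.contMDiff.contMDiffAt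
  refine ContMDiffAt.comp_of_eq (g := chart1 E G) contMDiffAt_chart1 (h1.mul h2) ?_
  simp

lemma contDiffAt_chartConj : ContDiffAt ℝ ∞ (chartConj E G) (chart1 E G 1, chart1 E G 1) := by
  rw [← contMDiffAt_iff_contDiffAt]
  have h1 : ContMDiffAt 𝓘(ℝ, E × E) 𝓘(ℝ, E) ∞ (fun v : E × E => (chart1 E G).symm v.1)
      (chart1 E G 1, chart1 E G 1) :=
    ContMDiffAt.comp (x := (chart1 E G 1, chart1 E G 1)) (g := (chart1 E G).symm)
      (f := Prod.fst) contMDiffAt_chart1_symm contDiff_fst.contMDiff.contMDiffAt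
  have h2 : ContMDiffAt 𝓘(ℝ, E × E) 𝓘(ℝ, E) ∞ (fun v : E × E => (chart1 E G).symm v.2)
      (chart1 E G 1, chart1 E G 1) :=
    ContMDiffAt.comp (x := (chart1 E G 1, chart1 E G 1)) (g := (chart1 E G).symm)
      (f := Prod.snd) contMDiffAt_chart1_symm contDiff_snd.contMDiff.contMDiffAt
  refine ContMDiffAt.comp_of_eq (g := chart1 E G) contMDiffAt_chart1 ((h1.mul h2).mul h1.inv) ?_
  simp

/-- The derivative at the identity, in the chart. -/
lemma mfderiv_one_eq_fderiv {f : G → G} (hf : MDifferentiableAt 𝓘(ℝ, E) 𝓘(ℝ, E) f 1)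
    (h1 : f 1 = 1) : (mfderiv 𝓘(ℝ, E) 𝓘(ℝ, E) f 1 : E →L[ℝ] E) =
      fderiv ℝ (fun y => chart1 E G (f ((chart1 E G).symm y))) (chart1 E G 1) := by
  refine (MDifferentiableAt.mfderiv hf).trans ?_
  have e : writtenInExtChartAt 𝓘(ℝ, E) 𝓘(ℝ, E) 1 f =
      fun y => chart1 E G (f ((chart1 E G).symm y)) := by
    simp only [writtenInExtChartAt, h1]
    rfl
  rw [ModelWithCorners.range_eq_univ, e]
  exact congrFun (fderivWithin_univ (𝕜 := ℝ)) (chart1 E G 1)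

lemma mfderiv_one_eq_fderiv' {F : Type*} [NormedAddCommGroup F] [NormedSpace ℝ F] {f : G → F}
    (hf : MDifferentiableAt 𝓘(ℝ, E) 𝓘(ℝ, F) f 1) :
    (mfderiv 𝓘(ℝ, E) 𝓘(ℝ, F) f 1 : E →L[ℝ] F) =
      fderiv ℝ (fun y => f ((chart1 E G).symm y)) (chart1 E G 1) := by
  refine (MDifferentiableAt.mfderiv hf).trans ?_
  rw [ModelWithCorners.range_eq_univ]
  exact congrFun (fderivWithin_univ (𝕜 := ℝ)) (chart1 E G 1)

/-- The adjoint action by continuous linear maps of the model space. -/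
def AdL (g : G) : E →L[ℝ] E :=
  (mfderiv 𝓘(ℝ, E) 𝓘(ℝ, E) (fun x : G => g * x * g⁻¹) 1 : E →L[ℝ] E)

lemma AdL_mul (g h : G) : (AdL (g * h) : E →L[ℝ] E) = AdL g * AdL h :=
  ContinuousLinearMap.ext fun ξ => LinearMap.congr_fun (Ad_mul (E := E) g h) ξ

lemma AdL_one : (AdL (1 : G) : E →L[ℝ] E) = 1 :=
  ContinuousLinearMap.ext fun ξ => LinearMap.congr_fun (Ad_one (E := E) (G := G)) ξ

lemma AdL_eq_fderiv (g : G) : (AdL g : E →L[ℝ] E) =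
    fderiv ℝ (fun y => chart1 E G (g * (chart1 E G).symm y * g⁻¹)) (chart1 E G 1) :=
  mfderiv_one_eq_fderiv (mdifferentiable_conj g 1) (by simp)

/-- Near the identity `Ad` becomes a partial derivative of a smooth map of two variables, so it is
smooth there. -/
lemma eventually_AdL_chart : ∀ᶠ x in 𝓝 (chart1 E G 1),
    (AdL ((chart1 E G).symm x) : E →L[ℝ] E) =
      (fderiv ℝ (chartConj E G) (x, chart1 E G 1)).comp (ContinuousLinearMap.inr ℝ E E) := by
  have h := ((contDiffAt_chartConj (E := E) (G := G)).of_le (m := 1) (by norm_cast)).eventually (by simp)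
  have hc : Continuous fun x : E => (x, chart1 E G 1) := by fun_prop
  filter_upwards [hc.continuousAt.eventually h] with x hx
  rw [AdL_eq_fderiv]
  have h1 := (hx.differentiableAt (by simp)).hasFDerivAt
  have h2 : HasFDerivAt (fun y : E => (x, y)) (ContinuousLinearMap.inr ℝ E E) (chart1 E G 1) :=
    hasFDerivAt_prodMk_right x (chart1 E G 1)
  exact (h1.comp (chart1 E G 1) h2).fderiv

lemma contDiffAt_AdL_chart : ContDiffAt ℝ ∞
    (fun x => (AdL ((chart1 E G).symm x) : E →L[ℝ] E)) (chart1 E G 1) := by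
  refine ContDiffAt.congr_of_eventuallyEq ?_ eventually_AdL_chart
  have h1 : ContDiffAt ℝ ∞ (fderiv ℝ (chartConj E G)) (chart1 E G 1, chart1 E G 1) :=
    contDiffAt_chartConj.fderiv_right (by simp)
  have h2 : ContDiffAt ℝ ∞ (fun x : E => (x, chart1 E G 1)) (chart1 E G 1) := by fun_prop
  exact (ContDiffAt.comp (f := fun x : E => (x, chart1 E G 1)) (chart1 E G 1) h1 h2).clm_comp contDiffAt_const

lemma contMDiffAt_AdL_one : ContMDiffAt 𝓘(ℝ, E) 𝓘(ℝ, E →L[ℝ] E) ∞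
    (fun g => (AdL g : E →L[ℝ] E)) (1 : G) := by
  have h : ContMDiffAt 𝓘(ℝ, E) 𝓘(ℝ, E →L[ℝ] E) ∞
      (fun g : G => (AdL ((chart1 E G).symm (chart1 E G g)) : E →L[ℝ] E)) 1 :=
    ContMDiffAt.comp (1 : G) (contDiffAt_AdL_chart (E := E) (G := G)).contMDiffAt contMDiffAt_chart1
  refine h.congr_of_eventuallyEq ?_
  filter_upwards [extChartAt_source_mem_nhds (I := 𝓘(ℝ, E)) (1 : G)] with g hg
  rw [(chart1 E G).left_inv hg]

/-- The adjoint action is smooth. -/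
lemma contMDiff_AdL : ContMDiff 𝓘(ℝ, E) 𝓘(ℝ, E →L[ℝ] E) ∞
    (fun g : G => (AdL g : E →L[ℝ] E)) := by
  intro g
  -- Smoothness at `g` follows from smoothness at `1` through `Ad h = Ad g ∘ Ad (g⁻¹ h)`.
  have h1 : ContMDiffAt 𝓘(ℝ, E) 𝓘(ℝ, E →L[ℝ] E) ∞
      (fun h : G => (AdL (g⁻¹ * h) : E →L[ℝ] E)) g :=
    ContMDiffAt.comp_of_eq (contMDiffAt_AdL_one (E := E) (G := G))
      (contMDiff_mul_left (n := ∞) (a := g⁻¹)).contMDiffAt (by simp)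
  have h2 : ContDiff ℝ ∞ fun T : E →L[ℝ] E => (AdL g).comp T := by fun_prop
  have h3 := h2.contMDiff.contMDiffAt.comp g h1
  refine h3.congr_of_eventuallyEq (Eventually.of_forall fun h => ?_)
  change (AdL h : E →L[ℝ] E) = AdL g * AdL (g⁻¹ * h)
  rw [← AdL_mul, mul_inv_cancel_left]

variable (E G) in
/-- The left-invariant frame in the chart. -/
def chartLeft (x : E) : E →L[ℝ] E :=
  (fderiv ℝ (chartMul E G) (x, chart1 E G 1)).comp (ContinuousLinearMap.inr ℝ E E)

variable (E G) in
/-- The right-invariant frame in the chart. -/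
def chartRight (x : E) : E →L[ℝ] E :=
  (fderiv ℝ (chartMul E G) (chart1 E G 1, x)).comp (ContinuousLinearMap.inl ℝ E E)

lemma chart1_target_mem : (chart1 E G).target ∈ 𝓝 (chart1 E G 1) :=
  extChartAt_target_mem_nhds (1 : G)

lemma eventually_chart_mulInvariantVectorField (η : LieAlg E G) :
    ∀ᶠ x in 𝓝 (chart1 E G 1),
    VectorField.mpullbackWithin 𝓘(ℝ, E) 𝓘(ℝ, E) (chart1 E G).symm (mulInvariantVectorField η)
      (range 𝓘(ℝ, E)) x = chartLeft E G x η := by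
  have h := ((contDiffAt_chartMul (E := E) (G := G)).of_le (m := 1) (by norm_cast)).eventually (by simp)
  have hc : Continuous fun x : E => (x, chart1 E G 1) := by fun_prop
  filter_upwards [hc.continuousAt.eventually h, chart1_target_mem (E := E) (G := G)] with x hx hxt
  rw [VectorField.mpullbackWithin_apply]
  have hinv : (mfderivWithin 𝓘(ℝ, E) 𝓘(ℝ, E) (chart1 E G).symm (range 𝓘(ℝ, E)) x).inverse =
      mfderiv 𝓘(ℝ, E) 𝓘(ℝ, E) (chart1 E G) ((chart1 E G).symm x) :=
    ContinuousLinearMap.inverse_eq (mfderivWithin_extChartAt_symm_comp_mfderiv_extChartAt hxt)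
      (mfderiv_extChartAt_comp_mfderivWithin_extChartAt_symm hxt)
  rw [hinv]
  set g := (chart1 E G).symm x with hg
  have hgs : g ∈ (chartAt E (1 : G)).source := by
    rw [← extChartAt_source 𝓘(ℝ, E)]
    exact (chart1 E G).map_target hxt
  have hd : MDifferentiableAt 𝓘(ℝ, E) 𝓘(ℝ, E) (chart1 E G) (g * 1) := by
    rw [mul_one]; exact mdifferentiableAt_extChartAt hgs
  have hcomp := mfderiv_comp (1 : G) hd (mdifferentiable_mul_left' (E := E) g 1)
  have hd2 : MDifferentiableAt 𝓘(ℝ, E) 𝓘(ℝ, E) (chart1 E G ∘ fun y => g * y) 1 :=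
    hd.comp (1 : G) (mdifferentiable_mul_left' (E := E) g 1)
  have h1 := (hx.differentiableAt (by simp)).hasFDerivAt
  have h2 : HasFDerivAt (fun y : E => (x, y)) (ContinuousLinearMap.inr ℝ E E) (chart1 E G 1) :=
    hasFDerivAt_prodMk_right x (chart1 E G 1)
  have h3 := (h1.comp (chart1 E G 1) h2).fderiv
  have h4 := mfderiv_one_eq_fderiv' hd2
  have h5 : (mfderiv 𝓘(ℝ, E) 𝓘(ℝ, E) (chart1 E G ∘ fun y => g * y) 1 : E →L[ℝ] E) =
    chartLeft E G x := h4.trans h3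
  rw [← h5]
  have h6 := congrArg (fun T : E →L[ℝ] E => T η) hcomp
  refine Eq.trans ?_ h6.symm
  change (mfderiv 𝓘(ℝ, E) 𝓘(ℝ, E) (chart1 E G) g : E →L[ℝ] E) _ =
    (mfderiv 𝓘(ℝ, E) 𝓘(ℝ, E) (chart1 E G) (g * 1) : E →L[ℝ] E) _
  rw [mul_one]
  rfl

end AdjointAction

/-! ### The derivative of `Ad` at the identity is the Lie bracket. -/

section AdjointDerivative

open Filter Topology

variable {E G : Type*} [NormedAddCommGroup E] [NormedSpace ℝ E]
  [TopologicalSpace G] [ChartedSpace E G] [Group G] [LieGroup 𝓘(ℝ, E) ∞ G]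

/-- Differentiating `(x y x⁻¹) x = x y` in `y` at the identity expresses the left frame as the right
frame after `Ad x`. -/
lemma eventually_chartRight_comp_AdL : ∀ᶠ x in 𝓝 (chart1 E G 1),
    (chartRight E G x).comp (AdL ((chart1 E G).symm x) : E →L[ℝ] E) = chartLeft E G x := by
  set e := chart1 E G 1 with he
  have hC := ((contDiffAt_chartConj (E := E) (G := G)).of_le (m := 1) (by norm_cast)).eventually
    (by simp)
  have hM := ((contDiffAt_chartMul (E := E) (G := G)).of_le (m := 1) (by norm_cast)).eventually
    (by simp)
  have hc1 : ContinuousAt (fun x : E => (x, e)) e := by fun_prop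
  have hc2 : ContinuousAt (fun x : E => (e, x)) e := by fun_prop
  -- the identity `C(x, y) x = x y` near `(e, e)`
  have hs : ∀ᶠ v in 𝓝 (e, e), chartMul E G (chartConj E G v, v.1) = chartMul E G v := by
    have h1 : ContMDiffAt 𝓘(ℝ, E × E) 𝓘(ℝ, E) ∞ (fun v : E × E => (chart1 E G).symm v.1) (e, e) :=
      ContMDiffAt.comp (x := (e, e)) (g := (chart1 E G).symm)
        (f := Prod.fst) contMDiffAt_chart1_symm contDiff_fst.contMDiff.contMDiffAt
    have h2 : ContMDiffAt 𝓘(ℝ, E × E) 𝓘(ℝ, E) ∞ (fun v : E × E => (chart1 E G).symm v.2) (e, e) :=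
      ContMDiffAt.comp (x := (e, e)) (g := (chart1 E G).symm)
        (f := Prod.snd) contMDiffAt_chart1_symm contDiff_snd.contMDiff.contMDiffAt
    have h3 := ((h1.mul h2).mul h1.inv).continuousAt
    have hmem : (chart1 E G).source ∈ 𝓝 ((chart1 E G).symm (e, e).1 * (chart1 E G).symm (e, e).2 *
        ((chart1 E G).symm (e, e).1)⁻¹) := by
      have : (chart1 E G).symm (e, e).1 * (chart1 E G).symm (e, e).2 *
        ((chart1 E G).symm (e, e).1)⁻¹ = 1 := by simp [he]
      rw [this]
      exact extChartAt_source_mem_nhds (1 : G)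
    filter_upwards [h3.eventually hmem] with v hv
    have hv' : (chart1 E G).symm v.1 * (chart1 E G).symm v.2 * ((chart1 E G).symm v.1)⁻¹ ∈
      (chart1 E G).source := hv
    unfold chartMul chartConj
    rw [(chart1 E G).left_inv hv', inv_mul_cancel_right]
  have hs2 := hc1.eventually hs.eventually_nhds
  filter_upwards [hc1.eventually hC, hc1.eventually hM, hc2.eventually hM, hs2,
    eventually_AdL_chart (E := E) (G := G), chart1_target_mem (E := E) (G := G)]
    with x hCx hM1 hM2 hsx hA hxt
  have hCe : chartConj E G (x, e) = e := by
    unfold chartConj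
    rw [he, chart1_symm_one, mul_one, mul_inv_cancel]
  rw [hA]
  have d1 := (hCx.differentiableAt (by simp)).hasFDerivAt
  have d2 : HasFDerivAt (fun y : E => (x, y)) (ContinuousLinearMap.inr ℝ E E) e :=
    hasFDerivAt_prodMk_right x e
  have d3 := d1.comp e d2
  have d4 := (hM2.differentiableAt (by simp)).hasFDerivAt
  have d5 : HasFDerivAt (fun y : E => (y, x)) (ContinuousLinearMap.inl ℝ E E) e :=
    hasFDerivAt_prodMk_left e x
  have d6 : HasFDerivAt (fun y : E => chartMul E G (y, x)) (chartRight E G x) (chartConj E G (x, e)) := by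
    rw [hCe]; exact d4.comp e d5
  have d7 := d6.comp e d3
  have d8 := ((hM1.differentiableAt (by simp)).hasFDerivAt).comp e d2
  have hev : (fun y => chartMul E G (chartConj E G (x, y), x)) =ᶠ[𝓝 e]
      fun y => chartMul E G (x, y) := by
    have hc3 : ContinuousAt (fun y : E => (x, y)) e := by fun_prop
    exact hc3.eventually hsx
  exact HasFDerivAt.unique (d7.congr_of_eventuallyEq hev.symm) d8

lemma chartLeft_one : chartLeft E G (chart1 E G 1) = ContinuousLinearMap.id ℝ E := by
  have h := ((contDiffAt_chartMul (E := E) (G := G)).of_le (m := 1) (by norm_cast)).differentiableAt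
    (by simp)
  have d := h.hasFDerivAt.comp (chart1 E G 1) (hasFDerivAt_prodMk_right (chart1 E G 1) (chart1 E G 1))
  refine HasFDerivAt.unique d ((hasFDerivAt_id (chart1 E G 1)).congr_of_eventuallyEq ?_)
  filter_upwards [chart1_target_mem (E := E) (G := G)] with x hx
  change chartMul E G (chart1 E G 1, x) = x
  unfold chartMul
  rw [chart1_symm_one, one_mul, (chart1 E G).right_inv hx]

lemma chartRight_one : chartRight E G (chart1 E G 1) = ContinuousLinearMap.id ℝ E := by
  have h := ((contDiffAt_chartMul (E := E) (G := G)).of_le (m := 1) (by norm_cast)).differentiableAt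
    (by simp)
  have d := HasFDerivAt.comp (f := fun x : E => (x, chart1 E G 1)) (chart1 E G 1) h.hasFDerivAt
    (hasFDerivAt_prodMk_left (chart1 E G 1) (chart1 E G 1))
  refine HasFDerivAt.unique d ((hasFDerivAt_id (chart1 E G 1)).congr_of_eventuallyEq ?_)
  filter_upwards [chart1_target_mem (E := E) (G := G)] with x hx
  change chartMul E G (x, chart1 E G 1) = x
  unfold chartMul
  rw [chart1_symm_one, mul_one, (chart1 E G).right_inv hx]

lemma hasFDerivAt_fderiv_chartMul : HasFDerivAt (fderiv ℝ (chartMul E G))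
    (fderiv ℝ (fderiv ℝ (chartMul E G)) (chart1 E G 1, chart1 E G 1))
    (chart1 E G 1, chart1 E G 1) := by
  have h1 : ContDiffAt ℝ ∞ (fderiv ℝ (chartMul E G)) (chart1 E G 1, chart1 E G 1) :=
    contDiffAt_chartMul.fderiv_right (by simp)
  exact (h1.differentiableAt (by simp)).hasFDerivAt

lemma hasFDerivAt_chartLeft (η : E) : HasFDerivAt (fun x => chartLeft E G x η)
    (((fderiv ℝ (fderiv ℝ (chartMul E G)) (chart1 E G 1, chart1 E G 1)).comp
      (ContinuousLinearMap.inl ℝ E E)).flip (0, η)) (chart1 E G 1) := by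
  have h := HasFDerivAt.comp (f := fun x : E => (x, chart1 E G 1)) (chart1 E G 1)
    (hasFDerivAt_fderiv_chartMul (E := E) (G := G)) (hasFDerivAt_prodMk_left (chart1 E G 1) (chart1 E G 1))
  exact h.clm_apply (hasFDerivAt_const ((0 : E), η) _) |>.congr_fderiv (by ext v; simp)

lemma chartMul_symm (v w : E × E) :
    fderiv ℝ (fderiv ℝ (chartMul E G)) (chart1 E G 1, chart1 E G 1) v w =
      fderiv ℝ (fderiv ℝ (chartMul E G)) (chart1 E G 1, chart1 E G 1) w v :=
  (contDiffAt_chartMul (E := E) (G := G)).isSymmSndFDerivAt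
    (by rw [minSmoothness_of_isRCLikeNormedField]; norm_cast) v w

/-- The derivatives of left-invariant fields at the identity are mixed second derivatives of the
multiplication, so the bracket of fields is their antisymmetrization. -/
lemma lie_eq_chart (ξ η : LieAlg E G) : (⁅ξ, η⁆ : LieAlg E G) =
    (fderiv ℝ (fderiv ℝ (chartMul E G)) (chart1 E G 1, chart1 E G 1) (ξ, 0) (0, η) -
      fderiv ℝ (fderiv ℝ (chartMul E G)) (chart1 E G 1, chart1 E G 1) (η, 0) (0, ξ) : E) := by
  rw [GroupLieAlgebra.bracket_def, VectorField.mlieBracket, VectorField.mlieBracketWithin_apply,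
    mfderiv_extChartAt_self]
  refine (congrArg (fun T : E →L[ℝ] E => T _) ContinuousLinearMap.inverse_id).trans ?_
  rw [ModelWithCorners.range_eq_univ, preimage_univ, univ_inter]
  have hξ := eventually_chart_mulInvariantVectorField (E := E) (G := G) ξ
  have hη := eventually_chart_mulInvariantVectorField (E := E) (G := G) η
  rw [ModelWithCorners.range_eq_univ] at hξ hη
  have d1 : fderiv ℝ (VectorField.mpullbackWithin 𝓘(ℝ, E) 𝓘(ℝ, E) (chart1 E G).symm
      (mulInvariantVectorField ξ) univ : E → E) (chart1 E G 1) = _ :=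
    ((hasFDerivAt_chartLeft (E := E) (G := G) ξ).congr_of_eventuallyEq hξ).fderiv
  have d2 : fderiv ℝ (VectorField.mpullbackWithin 𝓘(ℝ, E) 𝓘(ℝ, E) (chart1 E G).symm
      (mulInvariantVectorField η) univ : E → E) (chart1 E G 1) = _ :=
    ((hasFDerivAt_chartLeft (E := E) (G := G) η).congr_of_eventuallyEq hη).fderiv
  have gen : ∀ V W : E → E, VectorField.lieBracketWithin ℝ V W univ (chart1 E G 1) =
      fderiv ℝ W (chart1 E G 1) (V (chart1 E G 1)) -
      fderiv ℝ V (chart1 E G 1) (W (chart1 E G 1)) := fun V W => by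
    rw [VectorField.lieBracketWithin_univ, VectorField.lieBracket]
  refine (gen _ _).trans ?_
  have e1 := hξ.self_of_nhds
  have e2 := hη.self_of_nhds
  rw [chartLeft_one] at e1 e2
  refine congrArg₂ (fun a b : E => a - b) ?_ ?_
  · refine (congrArg (fun T : E →L[ℝ] E => T _) d2).trans ?_
    refine (congrArg (fun w : E => _) e1).trans ?_
    rfl
  · refine (congrArg (fun T : E →L[ℝ] E => T _) d1).trans ?_
    refine (congrArg (fun w : E => _) e2).trans ?_
    rfl

/-- Differentiating `R(x) ∘ Ad x = L(x)` at the identity, where `R` and `L` are the identity map,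
gives `dAd = dL - dR`; symmetry of second derivatives brings the result to the form of
`lie_eq_chart`. -/
lemma fderiv_AdL_chart (ξ η : E) :
    fderiv ℝ (fun y : E => (AdL ((chart1 E G).symm y) : E →L[ℝ] E)) (chart1 E G 1) ξ η =
    fderiv ℝ (fderiv ℝ (chartMul E G)) (chart1 E G 1, chart1 E G 1) (ξ, 0) (0, η) -
      fderiv ℝ (fderiv ℝ (chartMul E G)) (chart1 E G 1, chart1 E G 1) (η, 0) (0, ξ) := by
  set A : E → E →L[ℝ] E := fun y => AdL ((chart1 E G).symm y) with hA
  have dA : HasFDerivAt A (fderiv ℝ A (chart1 E G 1)) (chart1 E G 1) :=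
    ((contDiffAt_AdL_chart (E := E) (G := G)).differentiableAt (by simp)).hasFDerivAt
  have dAη := dA.clm_apply (hasFDerivAt_const η (chart1 E G 1))
  have dR : HasFDerivAt (chartRight E G) _ (chart1 E G 1) :=
    ((hasFDerivAt_fderiv_chartMul (E := E) (G := G)).comp (chart1 E G 1)
      (hasFDerivAt_prodMk_right (chart1 E G 1) (chart1 E G 1))).clm_comp
      (hasFDerivAt_const (ContinuousLinearMap.inl ℝ E E) _)
  have hev : (fun x => chartRight E G x (A x η)) =ᶠ[𝓝 (chart1 E G 1)] fun x => chartLeft E G x η := by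
    filter_upwards [eventually_chartRight_comp_AdL (E := E) (G := G)] with x hx
    exact congrArg (fun T : E →L[ℝ] E => T η) hx
  have d := (dR.clm_apply dAη).congr_of_eventuallyEq hev.symm
  have hA1 : A (chart1 E G 1) = 1 := by
    simp only [hA, chart1_symm_one, AdL_one]
  have key := congrArg (fun T : E →L[ℝ] E => T ξ) (d.unique (hasFDerivAt_chartLeft (E := E) (G := G) η))
  rw [hA1, chartRight_one] at key
  rw [chartMul_symm (η, 0)]
  simp at key
  rw [eq_sub_iff_add_eq]
  exact key

variable (E G) in
/-- The derivative at the identity of the adjoint action. -/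
def adL : E →L[ℝ] E →L[ℝ] E :=
  mfderiv 𝓘(ℝ, E) 𝓘(ℝ, E →L[ℝ] E) (fun g : G => (AdL g : E →L[ℝ] E)) 1

/-- The derivative at the identity of the adjoint action is the Lie bracket. -/
lemma adL_apply (ξ η : LieAlg E G) : adL E G ξ η = ⁅ξ, η⁆ := by
  have hd := (contMDiff_AdL (E := E) (G := G)).mdifferentiable (by simp) 1
  have hfd : adL E G = _ := mfderiv_one_eq_fderiv' hd
  rw [hfd]
  exact (fderiv_AdL_chart (E := E) (G := G) ξ η).trans (lie_eq_chart ξ η).symm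

end AdjointDerivative

/-! ### One-parameter subgroups, and `Ad` as Lie algebra automorphisms. -/

section Exponential

open Filter Topology

variable {E G : Type*} [NormedAddCommGroup E] [NormedSpace ℝ E]
  [TopologicalSpace G] [ChartedSpace E G] [Group G] [LieGroup 𝓘(ℝ, E) ∞ G]

/-- The left translate of an invariant field. -/
lemma mfderiv_AdL (g : G) (ξ : LieAlg E G) :
    (mfderiv 𝓘(ℝ, E) 𝓘(ℝ, E →L[ℝ] E) (fun g : G => (AdL g : E →L[ℝ] E)) g : E →L[ℝ] E →L[ℝ] E)
      (mulInvariantVectorField ξ g) = AdL g * adL E G ξ := by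
  have hd := (contMDiff_AdL (E := E) (G := G)).mdifferentiable (by simp)
  have hcomp : (fun h : G => (AdL (g * h) : E →L[ℝ] E)) = fun h => AdL g * AdL h := by
    ext1 h; exact AdL_mul g h
  have h1 : HasMFDerivAt 𝓘(ℝ, E) 𝓘(ℝ, E →L[ℝ] E) (fun h : G => (AdL (g * h) : E →L[ℝ] E)) 1 _ :=
    (show HasMFDerivAt 𝓘(ℝ, E) 𝓘(ℝ, E →L[ℝ] E) (fun g : G => (AdL g : E →L[ℝ] E)) (g * 1) _ from
      (hd (g * 1)).hasMFDerivAt).comp 1 (mdifferentiable_mul_left' (E := E) g 1).hasMFDerivAt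
  have h2 : HasFDerivAt (fun T : E →L[ℝ] E => AdL g * T)
      (ContinuousLinearMap.mul ℝ (E →L[ℝ] E) (AdL g)) (AdL (1 : G)) :=
    (ContinuousLinearMap.mul ℝ (E →L[ℝ] E) (AdL g)).hasFDerivAt
  have h3 : HasMFDerivAt 𝓘(ℝ, E) 𝓘(ℝ, E →L[ℝ] E) (fun h : G => (AdL g * AdL h : E →L[ℝ] E)) 1 _ :=
    h2.hasMFDerivAt.comp (1 : G) (hd 1).hasMFDerivAt
  rw [← hcomp] at h3
  have h4 := hasMFDerivAt_unique h1 h3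
  have h5 := congrArg (fun T : E →L[ℝ] E →L[ℝ] E => T ξ) h4
  refine Eq.trans ?_ h5
  unfold mulInvariantVectorField
  change (mfderiv 𝓘(ℝ, E) 𝓘(ℝ, E →L[ℝ] E) (fun g : G => (AdL g : E →L[ℝ] E)) g :
      E →L[ℝ] E →L[ℝ] E) _ =
    (mfderiv 𝓘(ℝ, E) 𝓘(ℝ, E →L[ℝ] E) (fun g : G => (AdL g : E →L[ℝ] E)) (g * 1) :
      E →L[ℝ] E →L[ℝ] E) _
  rw [mul_one]
  rfl

variable [FiniteDimensional ℝ E] [T2Space G]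

lemma isMIntegralCurve_unique {ξ : LieAlg E G} {γ γ' : ℝ → G}
    (h : IsMIntegralCurve (I := 𝓘(ℝ, E)) γ (mulInvariantVectorField ξ))
    (h' : IsMIntegralCurve (I := 𝓘(ℝ, E)) γ' (mulInvariantVectorField ξ)) (h0 : γ 0 = γ' 0) :
    γ = γ' := by
  have := FiniteDimensional.complete ℝ E
  exact isMIntegralCurve_Ioo_eq_of_contMDiff_boundaryless (t₀ := 0)
    (contMDiff_one_mulInvariant ξ) h h' h0

lemma isMIntegralCurve_mul_left {ξ : LieAlg E G} {γ : ℝ → G}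
    (h : IsMIntegralCurve (I := 𝓘(ℝ, E)) γ (mulInvariantVectorField ξ)) (g : G) :
    IsMIntegralCurve (I := 𝓘(ℝ, E)) (fun t => g * γ t) (mulInvariantVectorField ξ) := by
  intro t
  have := (mdifferentiable_mul_left' (E := E) g (γ t)).hasMFDerivAt.comp t (h t)
  refine this.congr_mfderiv (ContinuousLinearMap.ext fun s => ?_)
  exact (map_smul _ _ _).trans
    (congrArg (fun w : E => (show ℝ from s) • w) (mfderiv_mul_left_mulInvariant ξ g (γ t)))

lemma isMIntegralCurve_lieExp (ξ : LieAlg E G) :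
    IsMIntegralCurve (I := 𝓘(ℝ, E)) (fun t : ℝ => lieExp (t • ξ)) (mulInvariantVectorField ξ) := by
  have hs := (exists_integralCurve ξ).choose_spec
  convert hs.2 using 1
  ext t
  have h1 := hs.2.comp_mul t
  have h2 : t • (mulInvariantVectorField ξ : ∀ g : G, TangentSpace 𝓘(ℝ, E) g) =
      mulInvariantVectorField (t • ξ) := (mulInvariantVectorField_smul t ξ).symm
  rw [h2] at h1
  rw [lieExp_eq (t • ξ) (by simp [hs.1]) h1]
  simp

lemma lieExp_zero : lieExp (0 : LieAlg E G) = 1 := by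
  have hs := (exists_integralCurve (0 : LieAlg E G)).choose_spec
  have h1 := hs.2.comp_mul 0
  have h2 : (0 : ℝ) • (mulInvariantVectorField 0 : ∀ g : G, TangentSpace 𝓘(ℝ, E) g) =
      mulInvariantVectorField (0 : LieAlg E G) := by
    rw [← mulInvariantVectorField_smul, smul_zero]
  rw [h2] at h1
  rw [lieExp_eq (0 : LieAlg E G) (by simp [hs.1]) h1]
  simpa using hs.1

lemma lieExp_add_smul (s t : ℝ) (ξ : LieAlg E G) :
    lieExp ((s + t) • ξ) = lieExp (s • ξ) * lieExp (t • ξ) := by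
  have h1 := (isMIntegralCurve_lieExp ξ).comp_add s
  have h2 := isMIntegralCurve_mul_left (isMIntegralCurve_lieExp ξ) (lieExp (s • ξ))
  have := congrFun (isMIntegralCurve_unique h1 h2 (by simp [lieExp_zero])) t
  simpa [add_comm] using this

lemma lieExp_neg (ξ : LieAlg E G) : lieExp (-ξ) = (lieExp ξ)⁻¹ := by
  have := lieExp_add_smul (-1) 1 ξ
  rw [neg_add_cancel, zero_smul, lieExp_zero, neg_smul, one_smul] at this
  exact eq_inv_of_mul_eq_one_left this.symm

lemma lieExp_nsmul (k : ℕ) (ξ : LieAlg E G) : lieExp ((k : ℝ) • ξ) = lieExp ξ ^ k := by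
  induction k with
  | zero => simp [lieExp_zero]
  | succ k ih =>
    rw [Nat.cast_succ, lieExp_add_smul, ih, one_smul, pow_succ]

lemma continuous_lieExp_smul (ξ : LieAlg E G) : Continuous fun t : ℝ => lieExp (t • ξ) :=
  (isMIntegralCurve_lieExp ξ).continuous

lemma hasDerivAt_AdL_lieExp (ξ : LieAlg E G) (t : ℝ) :
    HasDerivAt (fun t : ℝ => (AdL (lieExp (t • ξ)) : E →L[ℝ] E))
      (AdL (lieExp (t • ξ)) * adL E G ξ) t := by
  have hd := (contMDiff_AdL (E := E) (G := G)).mdifferentiable (by simp) (lieExp (t • ξ))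
  have h1 := hd.hasMFDerivAt.comp t (isMIntegralCurve_lieExp ξ t)
  have h2 : HasFDerivAt (fun t : ℝ => (AdL (lieExp (t • ξ)) : E →L[ℝ] E)) (_ : ℝ →L[ℝ] E →L[ℝ] E) t :=
    hasMFDerivAt_iff_hasFDerivAt.1 h1
  refine h2.hasDerivAt.congr_deriv (Eq.symm ?_)
  refine (mfderiv_AdL (lieExp (t • ξ)) ξ).symm.trans ?_
  refine congrArg (mfderiv 𝓘(ℝ, E) 𝓘(ℝ, E →L[ℝ] E) (fun g : G => (AdL g : E →L[ℝ] E))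
    (lieExp (t • ξ)) : E →L[ℝ] E →L[ℝ] E) ?_
  exact (one_smul ℝ (mulInvariantVectorField ξ (lieExp (t • ξ)) : E)).symm

/-- `Ad (exp ξ) = exp (ad ξ)`. -/
lemma AdL_lieExp (ξ : LieAlg E G) :
    (AdL (lieExp ξ) : E →L[ℝ] E) = NormedSpace.exp (adL E G ξ) := by
  have := FiniteDimensional.complete ℝ E
  set A : E →L[ℝ] E := adL E G ξ with hA
  have hexp : ∀ t : ℝ, HasDerivAt (fun t : ℝ => NormedSpace.exp (t • -A))
      (-A * NormedSpace.exp (t • -A)) t := fun t => hasDerivAt_exp_smul_const' (-A) t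
  -- `Ad(exp tξ)` and `exp(t ad ξ)` solve the same linear equation: the product of the first with
  -- `exp(-t ad ξ)` has zero derivative.
  have hZ : ∀ t : ℝ, HasDerivAt
      (fun t : ℝ => (AdL (lieExp (t • ξ)) : E →L[ℝ] E) * NormedSpace.exp (t • -A)) 0 t := by
    intro t
    refine ((hasDerivAt_AdL_lieExp ξ t).mul (hexp t)).congr_deriv ?_
    rw [neg_mul, mul_neg, ← mul_assoc, add_neg_cancel]
  have hc := is_const_of_deriv_eq_zero (fun t => (hZ t).differentiableAt) (fun t => (hZ t).deriv) 1 0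
  simp only [one_smul, zero_smul, lieExp_zero, AdL_one, NormedSpace.exp_zero, mul_one] at hc
  have h2 : NormedSpace.exp (-A) * NormedSpace.exp A = 1 := by
    let _ : NormedAlgebra ℚ (E →L[ℝ] E) := NormedAlgebra.restrictScalars ℚ ℝ _
    rw [← NormedSpace.exp_add_of_commute (Commute.neg_left (Commute.refl A)), neg_add_cancel,
      NormedSpace.exp_zero]
  calc (AdL (lieExp ξ) : E →L[ℝ] E)
      = AdL (lieExp ξ) * (NormedSpace.exp (-A) * NormedSpace.exp A) := by rw [h2, mul_one]
    _ = NormedSpace.exp A := by rw [← mul_assoc, hc, one_mul]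

lemma AdL_inv_mul (g : G) : (AdL g⁻¹ : E →L[ℝ] E) * AdL g = 1 := by
  rw [← AdL_mul, inv_mul_cancel, AdL_one]

/-- This is the derivative at `t = 0` of `Ad(g exp(tξ) g⁻¹) = Ad g ∘ Ad(exp tξ) ∘ Ad g⁻¹`; evaluated
on `Ad g η`, it says that `Ad g` respects brackets. -/
lemma adL_AdL (g : G) (ξ : LieAlg E G) :
    adL E G (Ad g ξ) = (AdL g : E →L[ℝ] E) * adL E G ξ * AdL g⁻¹ := by
  have h1 := hasDerivAt_AdL_lieExp (Ad g ξ) 0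
  have h2 := ((hasDerivAt_AdL_lieExp ξ 0).const_mul (AdL g : E →L[ℝ] E)).mul_const
    (AdL g⁻¹ : E →L[ℝ] E)
  have e : (fun t : ℝ => (AdL (lieExp (t • (Ad g ξ : LieAlg E G))) : E →L[ℝ] E)) =
      fun t : ℝ => (AdL g : E →L[ℝ] E) * AdL (lieExp (t • ξ)) * AdL g⁻¹ := by
    ext1 t
    rw [← map_smul, lieExp_Ad, AdL_mul, AdL_mul]
  rw [e] at h1
  have := h1.unique h2
  simpa only [zero_smul, lieExp_zero, AdL_one, one_mul] using this

/-- The adjoint action is by Lie algebra automorphisms. -/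
lemma Ad_lie (g : G) (ξ η : LieAlg E G) : (Ad g ⁅ξ, η⁆ : LieAlg E G) = ⁅Ad g ξ, Ad g η⁆ := by
  have h1 := congrArg (fun T : E →L[ℝ] E => T (Ad g η : LieAlg E G)) (adL_AdL g ξ)
  have h2 : (AdL g⁻¹ : E →L[ℝ] E) (Ad g η : LieAlg E G) = η :=
    congrArg (fun T : E →L[ℝ] E => T η) (AdL_inv_mul (E := E) g)
  have h3 : adL E G (Ad g ξ) (Ad g η : LieAlg E G) = (AdL g : E →L[ℝ] E) (adL E G ξ η) := by
    refine h1.trans ?_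
    change (AdL g : E →L[ℝ] E) (adL E G ξ ((AdL g⁻¹ : E →L[ℝ] E) (Ad g η : LieAlg E G))) = _
    rw [h2]
  exact (congrArg (AdL g : E →L[ℝ] E) (adL_apply ξ η)).symm.trans
    (h3.symm.trans (adL_apply (Ad g ξ) (Ad g η)))

end Exponential

/-! ### Local inverses and smoothness of the exponential map. -/

section LocalInverses

open Filter Topology

variable {E G : Type*} [NormedAddCommGroup E] [NormedSpace ℝ E]
  [TopologicalSpace G] [ChartedSpace E G] [Group G] [LieGroup 𝓘(ℝ, E) ∞ G]

lemma hasFDerivAt_chartMul_one : HasFDerivAt (chartMul E G)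
    (ContinuousLinearMap.fst ℝ E E + ContinuousLinearMap.snd ℝ E E)
    (chart1 E G 1, chart1 E G 1) := by
  have h := ((contDiffAt_chartMul (E := E) (G := G)).differentiableAt (by simp)).hasFDerivAt
  refine h.congr_fderiv ?_
  have h1 := chartLeft_one (E := E) (G := G)
  have h2 := chartRight_one (E := E) (G := G)
  unfold chartLeft at h1
  unfold chartRight at h2
  ext v
  · simpa using congrArg (fun T : E →L[ℝ] E => T v) h2
  · simpa using congrArg (fun T : E →L[ℝ] E => T v) h1

/-- A smooth map to `G`, sending `0` to `1`, with derivative `A` at `0`. -/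
structure HasDerivAtOne {V : Type*} [NormedAddCommGroup V] [NormedSpace ℝ V] (T : V → G)
    (A : V →L[ℝ] E) : Prop where
  map_zero : T 0 = 1
  smooth : ContMDiffAt 𝓘(ℝ, V) 𝓘(ℝ, E) ∞ T 0
  deriv : HasFDerivAt (fun v => chart1 E G (T v)) A 0

variable {V : Type*} [NormedAddCommGroup V] [NormedSpace ℝ V]

lemma HasDerivAtOne.mul {S T : V → G} {A B : V →L[ℝ] E} (hS : HasDerivAtOne S A)
    (hT : HasDerivAtOne T B) : HasDerivAtOne (fun v => S v * T v) (A + B) := by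
  refine ⟨by rw [hS.map_zero, hT.map_zero, mul_one], hS.smooth.mul hT.smooth, ?_⟩
  have h1 : HasFDerivAt (fun v => (chart1 E G (S v), chart1 E G (T v))) (A.prod B) 0 :=
    hS.deriv.prodMk hT.deriv
  have h2 : HasFDerivAt (chartMul E G)
      (ContinuousLinearMap.fst ℝ E E + ContinuousLinearMap.snd ℝ E E)
      (chart1 E G (S 0), chart1 E G (T 0)) := by
    rw [hS.map_zero, hT.map_zero]; exact hasFDerivAt_chartMul_one
  have h3 := HasFDerivAt.comp (f := fun v => (chart1 E G (S v), chart1 E G (T v))) 0 h2 h1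
  have h4 : (ContinuousLinearMap.fst ℝ E E + ContinuousLinearMap.snd ℝ E E).comp (A.prod B) =
      A + B := by ext; simp
  rw [h4] at h3
  refine h3.congr_of_eventuallyEq ?_
  have s1 : ∀ᶠ v in 𝓝 0, S v ∈ (chart1 E G).source := hS.smooth.continuousAt.eventually
    (by rw [hS.map_zero]; exact extChartAt_source_mem_nhds (1 : G))
  have s2 : ∀ᶠ v in 𝓝 0, T v ∈ (chart1 E G).source := hT.smooth.continuousAt.eventually
    (by rw [hT.map_zero]; exact extChartAt_source_mem_nhds (1 : G))
  filter_upwards [s1, s2] with v hv1 hv2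
  simp only [Function.comp_apply, chartMul, (chart1 E G).left_inv hv1, (chart1 E G).left_inv hv2]

lemma HasDerivAtOne.comp {W : Type*} [NormedAddCommGroup W] [NormedSpace ℝ W] {T : V → G}
    {A : V →L[ℝ] E} (hT : HasDerivAtOne T A) (B : W →L[ℝ] V) :
    HasDerivAtOne (fun w => T (B w)) (A.comp B) := by
  refine ⟨by rw [_root_.map_zero, hT.map_zero], ?_, ?_⟩
  · exact hT.smooth.comp_of_eq B.contDiff.contMDiff.contMDiffAt (_root_.map_zero B)
  · exact HasFDerivAt.comp (f := B) (g := fun v => chart1 E G (T v)) 0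
      (by rw [_root_.map_zero]; exact hT.deriv) B.hasFDerivAt

lemma HasDerivAtOne.one : HasDerivAtOne (fun _ : V => (1 : G)) (0 : V →L[ℝ] E) :=
  ⟨rfl, contMDiffAt_const, hasFDerivAt_const _ _⟩

variable [FiniteDimensional ℝ E]

lemma exists_localLeftInverse {f : G → E} (hf : ContMDiffAt 𝓘(ℝ, E) 𝓘(ℝ, E) ∞ f 1)
    (hd : fderiv ℝ (fun y => f ((chart1 E G).symm y)) (chart1 E G 1) = ContinuousLinearMap.id ℝ E) :
    ∃ L : E → G, ContMDiffAt 𝓘(ℝ, E) 𝓘(ℝ, E) ∞ L (f 1) ∧ L (f 1) = 1 ∧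
      ∀ᶠ g in 𝓝 (1 : G), L (f g) = g := by
  have := FiniteDimensional.complete ℝ E
  set F : E → E := fun y => f ((chart1 E G).symm y) with hF
  have hF1 : ContDiffAt ℝ ∞ F (chart1 E G 1) := by
    rw [← contMDiffAt_iff_contDiffAt]
    exact hf.comp_of_eq contMDiffAt_chart1_symm chart1_symm_one
  have hF0 : F (chart1 E G 1) = f 1 := by rw [hF]; simp only [chart1_symm_one]
  have hF2 : HasFDerivAt F ((ContinuousLinearEquiv.refl ℝ E : E ≃L[ℝ] E) : E →L[ℝ] E)
      (chart1 E G 1) := by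
    have := (hF1.differentiableAt (by simp)).hasFDerivAt
    rwa [hd] at this
  have hst := hF1.hasStrictFDerivAt' hF2 (by simp)
  refine ⟨fun y => (chart1 E G).symm (hF1.localInverse hF2 (by simp) y), ?_, ?_, ?_⟩
  · have h1 := hF1.to_localInverse hF2 (by simp)
    rw [hF0] at h1
    refine contMDiffAt_chart1_symm.comp_of_eq h1.contMDiffAt ?_
    rw [← hF0]; exact hF1.localInverse_apply_image hF2 (by simp)
  · simp only [← hF0]
    rw [hF1.localInverse_apply_image hF2 (by simp), chart1_symm_one]
  · have h1 := (contMDiffAt_chart1 (E := E) (G := G)).continuousAt.eventually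
      hst.eventually_left_inverse
    filter_upwards [h1, extChartAt_source_mem_nhds (I := 𝓘(ℝ, E)) (1 : G)] with g hg hgs
    have h2 : F (chart1 E G g) = f g := by rw [hF]; simp only [(chart1 E G).left_inv hgs]
    have h3 : hF1.localInverse hF2 (by simp) (F (chart1 E G g)) = chart1 E G g := hg
    rw [← h2, h3, (chart1 E G).left_inv hgs]

lemma HasDerivAtOne.exists_localRightInverse {T : E → G}
    (hT : HasDerivAtOne T (ContinuousLinearMap.id ℝ E)) :
    ∃ Λ : G → E, ContMDiffAt 𝓘(ℝ, E) 𝓘(ℝ, E) ∞ Λ 1 ∧ Λ 1 = 0 ∧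
      ∀ᶠ g in 𝓝 (1 : G), T (Λ g) = g := by
  have := FiniteDimensional.complete ℝ E
  set F : E → E := fun v => chart1 E G (T v) with hF
  have hF1 : ContDiffAt ℝ ∞ F 0 := by
    rw [← contMDiffAt_iff_contDiffAt]
    exact contMDiffAt_chart1.comp_of_eq hT.smooth hT.map_zero
  have hF0 : F 0 = chart1 E G 1 := by rw [hF]; simp only [hT.map_zero]
  have hF2 : HasFDerivAt F ((ContinuousLinearEquiv.refl ℝ E : E ≃L[ℝ] E) : E →L[ℝ] E) 0 := hT.deriv
  have hst := hF1.hasStrictFDerivAt' hF2 (by simp)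
  have hinv := hF1.localInverse_apply_image hF2 (by simp)
  have hsm := hF1.to_localInverse hF2 (by simp)
  rw [hF0] at hinv hsm
  have hΛ : ContMDiffAt 𝓘(ℝ, E) 𝓘(ℝ, E) ∞
      (fun g => hF1.localInverse hF2 (by simp) (chart1 E G g)) 1 :=
    hsm.contMDiffAt.comp (1 : G) contMDiffAt_chart1
  refine ⟨fun g => hF1.localInverse hF2 (by simp) (chart1 E G g), hΛ, hinv, ?_⟩
  have h1 := hst.eventually_right_inverse
  rw [hF0] at h1
  have h2 := (contMDiffAt_chart1 (E := E) (G := G)).continuousAt.eventually h1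
  have h3 : ContinuousAt (fun g => T (hF1.localInverse hF2 (by simp) (chart1 E G g))) 1 :=
    ContinuousAt.comp_of_eq hT.smooth.continuousAt hΛ.continuousAt hinv
  have h4 := h3.eventually (show (chart1 E G).source ∈
      𝓝 (T (hF1.localInverse hF2 (by simp) (chart1 E G 1))) by
    rw [hinv, hT.map_zero]; exact extChartAt_source_mem_nhds (1 : G))
  filter_upwards [h2, h4, extChartAt_source_mem_nhds (I := 𝓘(ℝ, E)) (1 : G)] with g hg hg4 hgs
  exact (chart1 E G).injOn hg4 hgs hg

variable [T2Space G]

/-- The exponential map on the model space. -/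
def expE (x : E) : G := lieExp (E := E) (G := G) x

lemma expE_zero : (expE (0 : E) : G) = 1 := lieExp_zero

lemma expE_add_smul (s t : ℝ) (x : E) : (expE ((s + t) • x) : G) = expE (s • x) * expE (t • x) :=
  lieExp_add_smul (E := E) s t x

lemma expE_nsmul (k : ℕ) (x : E) : (expE ((k : ℝ) • x) : G) = expE x ^ k :=
  lieExp_nsmul (E := E) k x

lemma continuous_expE_smul (x : E) : Continuous fun t : ℝ => (expE (t • x) : G) :=
  continuous_lieExp_smul (E := E) x

lemma AdL_expE (x : E) : (AdL (expE x : G) : E →L[ℝ] E) = NormedSpace.exp (adL E G x) :=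
  AdL_lieExp (E := E) x

variable [LieAlgebra.IsSemisimple ℝ (LieAlg E G)]

/-- The kernel is the centre, which is zero for a semisimple algebra. -/
lemma adL_injective : Function.Injective (adL E G) := by
  rw [injective_iff_map_eq_zero]
  suffices h : ∀ ξ : LieAlg E G, adL E G ξ = 0 → ξ = 0 from h
  intro ξ hξ
  have h1 : ξ ∈ LieAlgebra.center ℝ (LieAlg E G) := by
    intro η
    have h : (⁅ξ, η⁆ : LieAlg E G) = 0 :=
      (adL_apply ξ η).symm.trans (congrArg (fun T : E →L[ℝ] E => T η) hξ)
    rw [← lie_skew, h, neg_zero]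
  rwa [LieAlgebra.center_eq_bot] at h1

/-- The adjoint action is injective near the identity, with a smooth inverse. -/
lemma exists_AdL_leftInverse : ∃ L : (E →L[ℝ] E) → G,
    ContMDiffAt 𝓘(ℝ, E →L[ℝ] E) 𝓘(ℝ, E) ∞ L 1 ∧ L 1 = 1 ∧
      ∀ᶠ g in 𝓝 (1 : G), L (AdL g) = g := by
  obtain ⟨Λ, hΛ⟩ := (adL E G : E →ₗ[ℝ] E →L[ℝ] E).exists_leftInverse_of_injective
    (LinearMap.ker_eq_bot.2 (adL_injective (E := E) (G := G)))
  set Λ' : (E →L[ℝ] E) →L[ℝ] E := LinearMap.toContinuousLinearMap Λ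
  have hf : ContMDiff 𝓘(ℝ, E) 𝓘(ℝ, E) ∞ (fun g : G => Λ' (AdL g)) :=
    Λ'.contDiff.contMDiff.comp contMDiff_AdL
  have hd : fderiv ℝ (fun y => Λ' (AdL ((chart1 E G).symm y))) (chart1 E G 1) =
      ContinuousLinearMap.id ℝ E := by
    have h1 := ((contDiffAt_AdL_chart (E := E) (G := G)).differentiableAt (by simp)).hasFDerivAt
    have h2 := (Λ'.hasFDerivAt.comp (chart1 E G 1) h1).fderiv
    refine h2.trans ?_
    have h3 : adL E G = _ :=
      mfderiv_one_eq_fderiv' ((contMDiff_AdL (E := E) (G := G)).mdifferentiable (by simp) 1)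
    rw [← h3]
    ext v
    exact LinearMap.congr_fun hΛ v
  obtain ⟨L, hL1, hL2, hL3⟩ := exists_localLeftInverse hf.contMDiffAt hd
  rw [AdL_one] at hL1 hL2
  refine ⟨fun T => L (Λ' T), ?_, hL2, hL3⟩
  exact hL1.comp (1 : E →L[ℝ] E) Λ'.contDiff.contMDiff.contMDiffAt

lemma eventually_eq_one_of_AdL : ∀ᶠ g in 𝓝 (1 : G), (AdL g : E →L[ℝ] E) = 1 → g = 1 := by
  obtain ⟨L, -, h1, h2⟩ := exists_AdL_leftInverse (E := E) (G := G)
  filter_upwards [h2] with g hg h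
  rw [← hg, h, h1]

lemma contDiff_exp_adL : ContDiff ℝ ∞ (fun x : E => NormedSpace.exp (adL E G x)) := by
  have := FiniteDimensional.complete ℝ E
  have h : ContDiff ℝ ∞ (NormedSpace.exp : (E →L[ℝ] E) → (E →L[ℝ] E)) :=
    contDiff_iff_contDiffAt.2 fun x => (NormedSpace.exp_analytic (𝕂 := ℝ) x).contDiffAt
  exact h.comp (adL E G).contDiff

/-- Near zero, the exponential map is a smooth function of the exponential of the adjoint. -/
lemma eventually_expE_eq : ∃ Ψ : E → G, ContMDiffAt 𝓘(ℝ, E) 𝓘(ℝ, E) ∞ Ψ 0 ∧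
    ∀ᶠ x in 𝓝 (0 : E), (expE x : G) = Ψ x := by
  obtain ⟨L, hL1, hL2, hL3⟩ := exists_AdL_leftInverse (E := E) (G := G)
  set Ψ : E → G := fun x => L (NormedSpace.exp (adL E G x)) with hΨ
  have hexp0 : NormedSpace.exp (adL E G 0) = 1 := by
    rw [map_zero, NormedSpace.exp_zero]
  have hΨs : ContMDiffAt 𝓘(ℝ, E) 𝓘(ℝ, E) ∞ Ψ 0 :=
    hL1.comp_of_eq contDiff_exp_adL.contMDiff.contMDiffAt hexp0
  have hΨ0 : Ψ 0 = 1 := by rw [hΨ]; simp only [hexp0, hL2]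
  refine ⟨Ψ, hΨs, ?_⟩
  obtain ⟨O, hO1, hO2, hO3⟩ := mem_nhds_iff.1 hL3
  have e1 : ∀ᶠ x in 𝓝 (0 : E), ContinuousAt Ψ x := by
    have := (contMDiffAt_iff_contMDiffAt_nhds (n := 1) (by simp)).1
      (hΨs.of_le (by norm_cast))
    exact this.mono fun x hx => hx.continuousAt
  have e2 : ∀ᶠ x in 𝓝 (0 : E), Ψ x ∈ O :=
    hΨs.continuousAt.eventually (by rw [hΨ0]; exact hO2.mem_nhds hO3)
  obtain ⟨r, hr, hball⟩ := Metric.eventually_nhds_iff_ball.1 (e1.and e2)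
  filter_upwards [Metric.ball_mem_nhds (0 : E) hr] with x hx
  have hball' : ∀ t ∈ Icc (0 : ℝ) 1, t • x ∈ Metric.ball (0 : E) r := by
    intro t ht
    rw [mem_ball_zero_iff] at hx ⊢
    rw [norm_smul, Real.norm_of_nonneg ht.1]
    exact (mul_le_of_le_one_left (norm_nonneg x) ht.2).trans_lt hx
  -- Continuity of `exp` in `x` is not yet available, only continuity along rays. The set of `t ∈
  -- [0, 1]` with `exp(tx) = Ψ(tx)` contains `0` and is closed. At such a `t` the value lies in the
  -- open set where `L` inverts `Ad`, so `exp(ux) = L(exp(ad ux))` persists for nearby `u`.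
  set s : Set ℝ := {t | (expE (t • x) : G) = Ψ (t • x)} with hs
  have hcl : IsClosed (s ∩ Icc 0 1) := by
    have h1 : ContinuousOn (fun t : ℝ => (((expE (t • x) : G) : G), Ψ (t • x))) (Icc 0 1) := by
      refine ContinuousOn.prodMk (continuous_expE_smul (G := G) x).continuousOn ?_
      intro t ht
      refine ContinuousAt.continuousWithinAt ?_
      exact ContinuousAt.comp (f := fun t : ℝ => t • x) (hball _ (hball' t ht)).1 (by fun_prop)
    have := h1.preimage_isClosed_of_isClosed isClosed_Icc isClosed_diagonal
    rwa [inter_comm] at this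
  have hsub := hcl.Icc_subset_of_forall_exists_gt (by
      change (expE ((0 : ℝ) • x) : G) = Ψ ((0 : ℝ) • x)
      rw [zero_smul, hΨ0, expE_zero]) (by
      rintro t ⟨ht, ht01⟩ y hy
      have hO : (expE (t • x) : G) ∈ O := by
        rw [show (expE (t • x) : G) = Ψ (t • x) from ht]
        exact (hball _ (hball' t ⟨ht01.1, ht01.2.le⟩)).2
      have hev : ∀ᶠ u in 𝓝 t, u ∈ s := by
        filter_upwards [(continuous_expE_smul (G := G) x).continuousAt.eventually
          (hO2.mem_nhds hO)] with u hu
        have h1 : L (AdL ((expE (u • x) : G))) = (expE (u • x) : G) := hO1 hu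
        rw [AdL_expE] at h1
        exact h1.symm
      have h2 : s ∩ Ioc t y ∈ 𝓝[>] t :=
        inter_mem (mem_nhdsWithin_of_mem_nhds hev) (Ioc_mem_nhdsGT hy)
      exact nonempty_of_mem h2)
  have := hsub (right_mem_Icc.2 zero_le_one)
  have h1 : (expE ((1 : ℝ) • x) : G) = Ψ ((1 : ℝ) • x) := this
  rwa [one_smul] at h1

lemma contMDiffAt_expE_zero :
    ContMDiffAt 𝓘(ℝ, E) 𝓘(ℝ, E) ∞ (expE : E → G) 0 := by
  obtain ⟨Ψ, h1, h2⟩ := eventually_expE_eq (E := E) (G := G)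
  exact h1.congr_of_eventuallyEq h2

/-- The exponential map is smooth. -/
lemma contMDiff_expE :
    ContMDiff 𝓘(ℝ, E) 𝓘(ℝ, E) ∞ (expE : E → G) := by
  intro x
  rw [contMDiffAt_infty]
  intro n
  have h0 := (contMDiffAt_iff_contMDiffAt_nhds (n := n) (by simp)).1
    ((contMDiffAt_expE_zero (E := E) (G := G)).of_le (by exact_mod_cast le_top))
  -- Globalization by `exp y = exp(y/(k+1))^(k+1)`, with `k` large enough for `x/(k+1)` to lie where
  -- `exp` is already `Cⁿ`.
  have ht : Tendsto (fun k : ℕ => ((k : ℝ) + 1)⁻¹ • x) atTop (𝓝 ((0 : ℝ) • x)) := by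
    refine Tendsto.smul_const ?_ x
    simpa using tendsto_one_div_add_atTop_nhds_zero_nat (𝕜 := ℝ)
  rw [zero_smul] at ht
  obtain ⟨k, hk⟩ := (ht.eventually h0).exists
  have h1 : ContMDiffAt 𝓘(ℝ, E) 𝓘(ℝ, E) n
      (fun y : E => (expE (((k : ℝ) + 1)⁻¹ • y) : G) ^ (k + 1)) x := by
    have h2 : ContMDiffAt 𝓘(ℝ, E) 𝓘(ℝ, E) n
        (fun y : E => (expE (((k : ℝ) + 1)⁻¹ • y) : G)) x := ContMDiffAt.comp (g := fun x : E => (expE x : G))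
      (f := fun y : E => ((k : ℝ) + 1)⁻¹ • y) x hk
      (by fun_prop : ContDiff ℝ n fun y : E => ((k : ℝ) + 1)⁻¹ • y).contMDiff.contMDiffAt
    exact ((contMDiff_pow (I := 𝓘(ℝ, E)) (n := ∞) (k + 1)).of_le
      (by exact_mod_cast le_top)).contMDiffAt.comp x h2
  convert h1 using 1
  ext y
  rw [← expE_nsmul]
  refine congrArg expE ?_
  have h2 : ((k : ℝ) + 1) ≠ 0 := by positivity
  have h3 : (y : E) = ((k + 1 : ℕ) : ℝ) • ((k : ℝ) + 1)⁻¹ • y := by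
    rw [smul_smul, Nat.cast_succ, mul_inv_cancel₀ h2, one_smul]
  exact h3

/-- Differentiability is known, so the derivative in direction `v` can be read off from the curve `t
↦ exp(tv)`, whose velocity at `0` is `v`. -/
lemma hasDerivAtOne_expE :
    HasDerivAtOne (expE : E → G) (ContinuousLinearMap.id ℝ E) := by
  refine ⟨expE_zero, contMDiffAt_expE_zero, ?_⟩
  have hs : ContDiffAt ℝ ∞ (fun v : E => chart1 E G ((expE v : G))) 0 := by
    rw [← contMDiffAt_iff_contDiffAt]
    exact contMDiffAt_chart1.comp_of_eq contMDiffAt_expE_zero expE_zero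
  have hd := (hs.differentiableAt (by simp)).hasFDerivAt
  refine hd.congr_fderiv ?_
  ext v
  have h1 : HasDerivAt (fun t : ℝ => chart1 E G ((expE (t • v) : G))) _ 0 :=
    HasFDerivAt.comp_hasDerivAt (f := fun t : ℝ => t • v)
      (l := fun v : E => chart1 E G ((expE v : G))) 0
      (by rw [zero_smul]; exact hd) ((hasDerivAt_id (0 : ℝ)).smul_const v)
  have h2 := isMIntegralCurve_lieExp (E := E) (G := G) v 0
  have e0 : (expE ((0 : ℝ) • v) : G) = 1 := by rw [zero_smul, expE_zero]
  have h3 : HasMFDerivAt 𝓘(ℝ, E) 𝓘(ℝ, E) (chart1 E G)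
      (expE ((0 : ℝ) • v) : G) (ContinuousLinearMap.id ℝ E) := by
    rw [e0]
    have := (mdifferentiableAt_extChartAt (I := 𝓘(ℝ, E)) (mem_chart_source E (1 : G))).hasMFDerivAt
    rwa [mfderiv_extChartAt_self] at this
  have h4 : HasFDerivAt (fun t : ℝ => chart1 E G ((expE (t • v) : G))) (_ : ℝ →L[ℝ] E) 0 :=
    hasMFDerivAt_iff_hasFDerivAt.1 (h3.comp (0 : ℝ) h2)
  have h5 := h1.unique h4.hasDerivAt
  have h6 : ∀ ξ : LieAlg E G, mulInvariantVectorField ξ (1 : G) = ξ := by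
    intro ξ
    unfold mulInvariantVectorField
    have : (fun x : G => 1 * x) = id := by ext; simp
    rw [this, mfderiv_id]
    rfl
  have h7 : (mulInvariantVectorField (G := G) (I := 𝓘(ℝ, E)) v (expE ((0 : ℝ) • v)) : E) = v := by
    rw [e0]; exact h6 v
  rw [one_smul] at h5
  refine h5.trans ?_
  exact (one_smul ℝ (_ : E)).trans h7

end LocalInverses

/-! ### The unipotent subgroup `exp n` and conjugation of grading elements. -/

section Unipotent

open Filter Topology

variable {E G : Type*} [NormedAddCommGroup E] [NormedSpace ℝ E]
  [TopologicalSpace G] [ChartedSpace E G] [Group G] [LieGroup 𝓘(ℝ, E) ∞ G]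
  [FiniteDimensional ℝ E] [T2Space G]

lemma adL_pow_apply (x : LieAlg E G) (i : ℕ) (y : LieAlg E G) :
    (adL E G x ^ i : E →L[ℝ] E) y = (LieAlgebra.ad ℝ (LieAlg E G) x ^ i) y := by
  induction i generalizing y with
  | zero => rfl
  | succ i ih =>
    rw [pow_succ, pow_succ]
    exact (congrArg (adL E G x ^ i : E →L[ℝ] E) (adL_apply x y)).trans (ih ⁅x, y⁆)

variable [LieAlgebra.IsSemisimple ℝ (LieAlg E G)] {p q : LieSubalgebra ℝ (LieAlg E G)}

/-- For `x ∈ n` the operator `ad x` raises degrees by `1`, so its `2N`-th power vanishes. The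
truncation order depends only on the length of the filtration, not on `x`. -/
lemma exists_Ad_lieExp_eq_truncExp (hp : IsParabolic p) :
    ∃ M : ℕ, ∀ x ∈ radicalIn p, (Ad (lieExp x) : Module.End ℝ (LieAlg E G)) =
      truncExp (M + 2) (LieAlgebra.ad ℝ (LieAlg E G) x) := by
  obtain ⟨N, h0, h1⟩ := exists_filt_eq_bot hp
  refine ⟨N + N, fun x hx => ?_⟩
  have hpow : ∀ y : LieAlg E G, (LieAlgebra.ad ℝ (LieAlg E G) x ^ (N + N)) y = 0 := by
    intro y
    have := pow_mem_degGE (ad_mem_degGE_of_radicalIn hp hx) (N + N) (-N) y (h1 ▸ Submodule.mem_top)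
    rw [show -(N : ℤ) + ((N + N : ℕ) : ℤ) * 1 = N by push_cast; ring, h0] at this
    exact (Submodule.mem_bot ℝ).1 this
  have hA : (adL E G x ^ (N + N) : E →L[ℝ] E) = 0 :=
    ContinuousLinearMap.ext fun y => (adL_pow_apply x (N + N) y).trans (hpow y)
  have hexp : NormedSpace.exp (adL E G x) =
      ∑ i ∈ Finset.range (N + N + 2), ((i.factorial : ℝ)⁻¹) • (adL E G x) ^ i := by
    rw [NormedSpace.exp_eq_tsum ℝ]
    refine tsum_eq_sum fun i hi => ?_
    rw [Finset.mem_range, not_lt] at hi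
    obtain ⟨k, rfl⟩ := Nat.exists_eq_add_of_le (show N + N ≤ i by omega)
    rw [pow_add, hA, zero_mul, smul_zero]
  apply LinearMap.ext
  intro y
  have h2 : Ad (lieExp x) y = (NormedSpace.exp (adL E G x) : E →L[ℝ] E) y :=
    congrArg (fun T : E →L[ℝ] E => T y) (AdL_lieExp x)
  rw [h2, hexp]
  unfold truncExp
  rw [LinearMap.sum_apply]
  refine (_root_.sum_apply _ _ y).trans ?_
  refine Finset.sum_congr rfl fun i _ => ?_
  exact congrArg (fun v : E => ((i.factorial : ℝ)⁻¹) • v) (adL_pow_apply x i y)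

lemma Ad_lieExp_sub_one_mem (hp : IsParabolic p) {x : LieAlg E G} (hx : x ∈ radicalIn p) :
    (Ad (lieExp x) : Module.End ℝ (LieAlg E G)) - 1 ∈ degGE p 1 := by
  obtain ⟨M, hM⟩ := exists_Ad_lieExp_eq_truncExp (E := E) (G := G) hp
  rw [hM x hx]
  exact truncExp_sub_one_mem_degGE hp (ad_mem_degGE_of_radicalIn hp hx) M

lemma Ad_mul_sub_one_mem (hp : IsParabolic p) {g h : G}
    (hg : (Ad g : Module.End ℝ (LieAlg E G)) - 1 ∈ degGE p 1)
    (hh : (Ad h : Module.End ℝ (LieAlg E G)) - 1 ∈ degGE p 1) :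
    (Ad (g * h) : Module.End ℝ (LieAlg E G)) - 1 ∈ degGE p 1 := by
  have e : (Ad (g * h) : Module.End ℝ (LieAlg E G)) - 1 =
      (Ad g - 1) * (Ad h - 1) + (Ad g - 1) + (Ad h - 1) := by
    rw [show (Ad (g * h) : Module.End ℝ (LieAlg E G)) = Ad g * Ad h from Ad_mul g h]
    noncomm_ring
  rw [e]
  exact add_mem (add_mem (degGE_antitone hp (by norm_num) (mul_mem_degGE hg hh)) hg) hh

lemma apply_sub_self_mem_radicalIn (hp : IsParabolic p) {φ : Module.End ℝ (LieAlg E G)}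
    (hφ : φ - 1 ∈ degGE p 1) {z : LieAlg E G} (hz : z ∈ p) : φ z - z ∈ radicalIn p := by
  have := hφ 0 z (by rw [filt_zero hp]; exact hz)
  rwa [zero_add, filt_one hp] at this

/-- An element of the nilpotent radical whose exponential fixes a grading element is zero. -/
lemma eq_zero_of_Ad_lieExp_apply (hp : IsParabolic p) {z : LieAlg E G} (hz : IsGrading p z)
    (hzp : z ∈ p) {x : LieAlg E G} (hx : x ∈ radicalIn p) (h : Ad (lieExp x) z = z) : x = 0 := by
  obtain ⟨M, hM⟩ := exists_Ad_lieExp_eq_truncExp (E := E) (G := G) hp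
  refine eq_zero_of_truncExp_ad_apply hp hz hzp hx (M := M) ?_
  rw [← hM x hx, h]

/-- All elements of `z + n` are conjugate to the grading element `z`, smoothly. -/
lemma exists_smooth_conjugation (hp : IsParabolic p) {z : LieAlg E G} (hz : IsGrading p z)
    (hzp : z ∈ p) : ∃ ψ : LieAlg E G → LieAlg E G, ContDiff ℝ ∞ (E := E) (F := E) ψ ∧ ∀ w ∈ radicalIn p,
      ψ w ∈ radicalIn p ∧ Ad (lieExp (ψ w)) (z + w) = z := by
  obtain ⟨M, hM⟩ := exists_Ad_lieExp_eq_truncExp (E := E) (G := G) hp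
  -- Successive approximation: after `k` corrections `z + w` is conjugated to `z` up to an error in
  -- `F^{k+1}`.
  have key : ∀ k : ℕ, ∃ ψ : LieAlg E G → LieAlg E G, ContDiff ℝ ∞ (E := E) (F := E) ψ ∧ ∀ w ∈ radicalIn p,
      ψ w ∈ radicalIn p ∧ (Ad (lieExp (ψ w)) (z + w) - z : LieAlg E G) ∈ filt p (k + 1) := by
    intro k
    induction k with
    | zero =>
      refine ⟨fun _ => 0, contDiff_const, fun w hw => ⟨zero_mem (radicalIn p), ?_⟩⟩
      have e : (lieExp (0 : LieAlg E G) : G) = 1 := lieExp_zero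
      change (Ad (lieExp (0 : LieAlg E G)) (z + w) - z : LieAlg E G) ∈ _
      rw [e, Ad_one, LinearMap.id_apply, add_sub_cancel_left]
      simpa [filt_one hp] using hw
    | succ k ih =>
      obtain ⟨ψ, hψ, h⟩ := ih
      -- Adding `d ∈ F^{k+1}` to the exponent changes the conjugate by `-(k+1) d` modulo `F^{k+2}`,
      -- so dividing the error by `k + 1` gives the right correction.
      refine ⟨fun w => ψ w + (((k : ℝ) + 1)⁻¹) • (Ad (lieExp (ψ w)) (z + w) - z), ?_,
        fun w hw => ?_⟩
      · have h1 := (contDiff_exp_adL (E := E) (G := G)).comp hψ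
        have h2 : ContDiff ℝ ∞ fun w : E =>
            (NormedSpace.exp (adL E G (ψ w)) : E →L[ℝ] E) ((show E from z) + w) :=
          h1.clm_apply (contDiff_const.add contDiff_id)
        have h3 : ContDiff ℝ ∞ (fun w : E => (show E from ψ w) + (((k : ℝ) + 1)⁻¹) •
            ((NormedSpace.exp (adL E G (ψ w)) : E →L[ℝ] E) ((show E from z) + w) - (show E from z))) :=
          hψ.add ((h2.sub contDiff_const).const_smul _)
        refine (congrArg (ContDiff ℝ ∞) (funext fun w : E => ?_)).mp h3
        exact congrArg (fun T : E →L[ℝ] E => (show E from ψ w) + (((k : ℝ) + 1)⁻¹) •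
          (T ((show E from z) + w) - (show E from z))) (AdL_lieExp (ψ w)).symm
      · obtain ⟨h1, h2⟩ := h w hw
        set x : LieAlg E G := ψ w with hx
        set d : LieAlg E G := (((k : ℝ) + 1)⁻¹) • (Ad (lieExp x) (z + w) - z) with hd
        have hdm : d ∈ filt p (k + 1) := Submodule.smul_mem _ _ h2
        have hdn : d ∈ radicalIn p := by
          rw [← filt_one hp]; exact filt_antitone hp (by linarith) hdm
        have hxd : x + d ∈ radicalIn p := add_mem h1 hdn
        refine ⟨hxd, ?_⟩
        have h3 := truncExp_ad_add_apply hp hz hzp (i := k + 1) (by linarith) h1 hdm hw M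
        rw [← hM _ h1, ← hM _ hxd] at h3
        have e3 : (((k : ℤ) + 1 : ℤ) : ℝ) • d = Ad (lieExp x) (z + w) - z := by
          rw [hd, smul_smul]
          push_cast
          rw [mul_inv_cancel₀ (by positivity), one_smul]
        rw [e3] at h3
        push_cast
        convert h3 using 1
        abel
  obtain ⟨N, h0, -⟩ := exists_filt_eq_bot hp
  obtain ⟨ψ, hψ, h⟩ := key N
  refine ⟨ψ, hψ, fun w hw => ⟨(h w hw).1, ?_⟩⟩
  have := filt_antitone hp (by linarith : (N : ℤ) ≤ N + 1) (h w hw).2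
  rw [h0] at this
  exact sub_eq_zero.1 ((Submodule.mem_bot ℝ).1 this)

/-- The exponentials of the nilpotent radical are closed under multiplication. -/
lemma exists_lieExp_mul (h : IsOpposite p q) {x y : LieAlg E G} (hx : x ∈ radicalIn p)
    (hy : y ∈ radicalIn p) : ∃ w ∈ radicalIn p, (lieExp x * lieExp y : G) = lieExp w := by
  have hp := h.left
  have := topologicalGroup_of_lieGroup (G := G) 𝓘(ℝ, E) ∞
  obtain ⟨z, hz, hzp, -⟩ := exists_isGrading_inf h
  obtain ⟨ψ, hψ, hψ'⟩ := exists_smooth_conjugation hp hz hzp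
  set γ : ℝ → G := fun t => lieExp (t • x) * lieExp (t • y) with hγ
  have hγc : Continuous γ := (continuous_lieExp_smul x).mul (continuous_lieExp_smul y)
  have hγ1 : ∀ t, (Ad (γ t) : Module.End ℝ (LieAlg E G)) - 1 ∈ degGE p 1 := fun t =>
    Ad_mul_sub_one_mem hp (Ad_lieExp_sub_one_mem hp (Submodule.smul_mem _ t hx))
      (Ad_lieExp_sub_one_mem hp (Submodule.smul_mem _ t hy))
  set v : ℝ → LieAlg E G := fun t => Ad (γ t) z - z with hv
  have hvn : ∀ t, v t ∈ radicalIn p := fun t => apply_sub_self_mem_radicalIn hp (hγ1 t) hzp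
  have hvc : Continuous (v : ℝ → E) := by
    have h1 : Continuous fun t => (AdL (γ t) : E →L[ℝ] E) :=
      (contMDiff_AdL (E := E) (G := G)).continuous.comp hγc
    exact (h1.clm_apply (continuous_const (y := (show E from z)))).sub
      (continuous_const (y := (show E from z)))
  -- `Ad(γ t) z` lies in `z + n`, and `exp ψ(v t)` conjugates it back to `z`. Thus `Ad(c t)` is a
  -- unipotent automorphism fixing `z`, hence trivial.
  set c : ℝ → G := fun t => lieExp (ψ (v t)) * γ t with hc
  have hcc : Continuous c := by
    have h1 : Continuous fun t => (lieExp (ψ (v t)) : G) :=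
      (contMDiff_expE (E := E) (G := G)).continuous.comp (hψ.continuous.comp hvc)
    exact h1.mul hγc
  have hAd : ∀ t, (AdL (c t) : E →L[ℝ] E) = 1 := by
    intro t
    have h1 : (Ad (lieExp (ψ (v t)) * γ t) : Module.End ℝ (LieAlg E G)) = 1 := by
      refine eq_one_of_apply_grading hp hz (Ad_lie _)
        (Ad_mul_sub_one_mem hp (Ad_lieExp_sub_one_mem hp (hψ' _ (hvn t)).1) (hγ1 t)) ?_
      have h2 := (hψ' _ (hvn t)).2
      rw [Ad_mul]
      rw [show z + v t = Ad (γ t) z from add_sub_cancel z _] at h2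
      exact h2
    exact ContinuousLinearMap.ext fun y => LinearMap.congr_fun h1 y
  have hγ0 : γ 0 = 1 := by simp [hγ, lieExp_zero]
  have hc0 : c 0 = 1 := by
    have h1 : v 0 = 0 := by rw [hv]; simp only [hγ0, Ad_one, LinearMap.id_apply, sub_self]
    have h2 := hψ' 0 (zero_mem _)
    have h3 : (ψ (0 : LieAlg E G) : LieAlg E G) = 0 :=
      eq_zero_of_Ad_lieExp_apply hp hz hzp h2.1 (by simpa using h2.2)
    change lieExp (ψ (v 0)) * γ 0 = 1
    rw [h1, h3, lieExp_zero, hγ0, one_mul]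
  -- The kernel of `Ad` may be nontrivial but is discrete, so the continuous path `c` starting at
  -- `1` stays at `1`.
  have hclopen : IsClopen {t | c t = 1} := by
    refine ⟨isClosed_eq hcc continuous_const, isOpen_iff_mem_nhds.2 fun t ht => ?_⟩
    have h1 := hcc.continuousAt.eventually (p := fun g => (AdL g : E →L[ℝ] E) = 1 → g = 1)
      (by rw [show c t = 1 from ht]; exact eventually_eq_one_of_AdL)
    filter_upwards [h1] with s hs
    exact hs (hAd s)
  have huniv := hclopen.eq_univ ⟨0, hc0⟩
  have h1 : c 1 = 1 := (huniv ▸ mem_univ (1 : ℝ) : (1 : ℝ) ∈ {t | c t = 1})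
  have h2 : lieExp (ψ (v 1)) * (lieExp x * lieExp y) = (1 : G) := by
    have : γ 1 = lieExp x * lieExp y := by simp [hγ]
    rw [← this]; exact h1
  refine ⟨-ψ (v 1), neg_mem (hψ' _ (hvn 1)).1, ?_⟩
  rw [lieExp_neg]
  exact eq_inv_of_mul_eq_one_right h2

/-- The unipotent radical: the subgroup `exp n`. -/
def radicalGroup (h : IsOpposite p q) : Subgroup G where
  carrier := lieExp '' (radicalIn p : Set (LieAlg E G))
  one_mem' := ⟨0, zero_mem (radicalIn p), lieExp_zero⟩
  mul_mem' := by
    rintro _ _ ⟨x, hx, rfl⟩ ⟨y, hy, rfl⟩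
    obtain ⟨w, hw, e⟩ := exists_lieExp_mul h hx hy
    exact ⟨w, hw, e.symm⟩
  inv_mem' := by
    rintro _ ⟨x, hx, rfl⟩
    exact ⟨-x, neg_mem (S := Submodule ℝ (LieAlg E G)) (s := radicalIn p) hx, lieExp_neg x⟩

end Unipotent

/-! ### Normalizers of parabolics and the smooth splitting of the big cell. -/

section Decomposition

open Filter Topology

variable {E G : Type*} [NormedAddCommGroup E] [NormedSpace ℝ E]
  [TopologicalSpace G] [ChartedSpace E G] [Group G] [LieGroup 𝓘(ℝ, E) ∞ G]

lemma Ad_inv_apply (g : G) (x : LieAlg E G) : Ad g⁻¹ (Ad g x) = x :=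
  congrArg (fun T : E →L[ℝ] E => T x) (by rw [← AdL_mul, inv_mul_cancel, AdL_one] :
    (AdL g⁻¹ : E →L[ℝ] E) * AdL g = 1)

lemma Ad_apply_inv (g : G) (x : LieAlg E G) : Ad g (Ad g⁻¹ x) = x := by
  simpa using Ad_inv_apply g⁻¹ x

/-- The normalizer in `G` of a subspace of the Lie algebra. -/
def stab (A : Submodule ℝ (LieAlg E G)) : Subgroup G where
  carrier := {g | A.map (Ad g) = A}
  one_mem' := by
    change A.map (Ad 1) = A
    rw [Ad_one, Submodule.map_id]
  mul_mem' {a b} (ha : A.map (Ad a) = A) (hb : A.map (Ad b) = A) := by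
    change A.map (Ad (a * b)) = A
    rw [Ad_mul, Submodule.map_comp, hb, ha]
  inv_mem' {a} (ha : A.map (Ad a) = A) := by
    change A.map (Ad a⁻¹) = A
    conv_lhs => rw [← ha]
    rw [← Submodule.map_comp, ← Ad_mul, inv_mul_cancel, Ad_one, Submodule.map_id]

lemma Ad_mem_of_mem_stab {A : Submodule ℝ (LieAlg E G)} {g : G} (hg : g ∈ stab A) {x : LieAlg E G}
    (hx : x ∈ A) : Ad g x ∈ A := by
  have : A.map (Ad g) = A := hg
  rw [← this]
  exact Submodule.mem_map_of_mem hx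

variable [FiniteDimensional ℝ E] [T2Space G]

lemma isClosed_submodule (A : Submodule ℝ (LieAlg E G)) :
    IsClosed (X := E) (A : Set (LieAlg E G)) := by
  let A' : Submodule ℝ E := A
  exact A'.closed_of_finiteDimensional

lemma mem_stab_of_map_le {A : Submodule ℝ (LieAlg E G)} {g : G} (h : ∀ x ∈ A, Ad g x ∈ A) :
    g ∈ stab A := by
  refine Submodule.eq_of_le_of_finrank_eq (Submodule.map_le_iff_le_comap.2 h) ?_
  exact LinearEquiv.finrank_map_eq (LinearEquiv.ofLinearMap (Ad g) (Ad g⁻¹)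
    (LinearMap.ext (Ad_apply_inv g)) (LinearMap.ext (Ad_inv_apply g))) A

/-- The adjoint action as a Lie algebra automorphism. -/
def AdEquiv (g : G) : LieAlg E G ≃ₗ⁅ℝ⁆ LieAlg E G :=
  { (Ad g : LieAlg E G →ₗ[ℝ] LieAlg E G) with
    map_lie' := fun {x y} => Ad_lie g x y
    invFun := Ad g⁻¹
    left_inv := Ad_inv_apply g
    right_inv := Ad_apply_inv g }

lemma killingForm_Ad (g : G) (x y : LieAlg E G) :
    killingForm ℝ (LieAlg E G) (Ad g x) (Ad g y) = killingForm ℝ (LieAlg E G) x y :=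
  LieAlgebra.killingForm_of_equiv_apply (AdEquiv g) x y

variable {p q : LieSubalgebra ℝ (LieAlg E G)}

/-- The normalizer of a parabolic subalgebra preserves the nilpotent radical. -/
lemma stab_le_stab_radicalIn (hp : IsParabolic p) :
    (stab p.toSubmodule : Subgroup G) ≤ stab (radicalIn p) := by
  intro g hg
  refine mem_stab_of_map_le fun x hx => ?_
  rw [hp] at hx ⊢
  intro y hy
  rw [← Ad_apply_inv g y]
  change killingForm ℝ (LieAlg E G) (Ad g (Ad g⁻¹ y)) (Ad g x) = 0
  rw [killingForm_Ad]
  exact hx _ (Ad_mem_of_mem_stab (inv_mem hg) hy)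

/-- `Ad(exp x)` is the sum of the exponential series of `ad x`; its partial sums preserve the
subalgebra, which is closed, being finite dimensional. -/
lemma lieExp_mem_stab {x : LieAlg E G} (hx : x ∈ p) : lieExp x ∈ stab p.toSubmodule := by
  have hA : ∀ (i : ℕ), ∀ y ∈ p, (LieAlgebra.ad ℝ (LieAlg E G) x ^ i) y ∈ p := by
    intro i
    induction i with
    | zero => exact fun y hy => hy
    | succ i ih => exact fun y hy => by rw [pow_succ]; exact ih _ (p.lie_mem hx hy)
  refine mem_stab_of_map_le fun y hy => ?_
  have := FiniteDimensional.complete ℝ E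
  have hcl := isClosed_submodule p.toSubmodule
  have h1 : HasSum (fun i : ℕ => (((i.factorial : ℝ)⁻¹) • (adL E G x) ^ i : E →L[ℝ] E))
      (NormedSpace.exp (adL E G x)) := by
    let _ : NormedAlgebra ℚ (E →L[ℝ] E) := NormedAlgebra.restrictScalars ℚ ℝ _
    exact NormedSpace.exp_series_hasSum_exp' (𝕂 := ℝ) (adL E G x)
  have h2 := h1.mapL (ContinuousLinearMap.apply ℝ E (show E from y))
  have h3 : (NormedSpace.exp (adL E G x) : E →L[ℝ] E) y = Ad (lieExp x) y :=
    (congrArg (fun T : E →L[ℝ] E => T y) (AdL_lieExp x)).symm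
  change Ad (lieExp x) y ∈ p.toSubmodule
  rw [← h3]
  refine hcl.mem_of_tendsto h2 (Eventually.of_forall fun s => ?_)
  refine Submodule.sum_mem _ fun i _ => ?_
  have h4 : (((i.factorial : ℝ)⁻¹) • (adL E G x) ^ i : E →L[ℝ] E) y =
      ((i.factorial : ℝ)⁻¹) • (LieAlgebra.ad ℝ (LieAlg E G) x ^ i) y :=
    congrArg (fun v : E => ((i.factorial : ℝ)⁻¹) • v) (adL_pow_apply x i y)
  change (((i.factorial : ℝ)⁻¹) • (adL E G x) ^ i : E →L[ℝ] E) y ∈ p.toSubmodule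
  rw [h4]
  exact Submodule.smul_mem _ _ (hA i y hy)

variable [LieAlgebra.IsSemisimple ℝ (LieAlg E G)]

lemma IsOpposite.disjoint (h : IsOpposite p q) {x : LieAlg E G} (hx : x ∈ radicalIn p)
    (hq : x ∈ q) : x = 0 :=
  Submodule.disjoint_def.1 h.isCompl'.disjoint x hx hq

/-- The normalizer of the opposite parabolic meets the unipotent radical trivially. -/
lemma eq_zero_of_lieExp_mem_stab (h : IsOpposite p q) {x : LieAlg E G} (hx : x ∈ radicalIn p)
    (hs : (lieExp x : G) ∈ stab q.toSubmodule) : x = 0 := by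
  obtain ⟨z, hz, hzp, hzq⟩ := exists_isGrading_inf h
  refine eq_zero_of_Ad_lieExp_apply h.left hz hzp hx (sub_eq_zero.1 (h.disjoint ?_ ?_))
  · exact apply_sub_self_mem_radicalIn h.left (Ad_lieExp_sub_one_mem h.left hx) hzp
  · exact q.toSubmodule.sub_mem (Ad_mem_of_mem_stab hs hzq) hzq

lemma eq_one_of_mem_radicalGroup (h : IsOpposite p q) {g : G} (hg : g ∈ radicalGroup h)
    (hs : g ∈ stab q.toSubmodule) : g = 1 := by
  obtain ⟨x, hx, rfl⟩ := hg
  rw [eq_zero_of_lieExp_mem_stab h hx hs, lieExp_zero]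

variable (p q) in
/-- The elements of `G` moving `q` to a complement of the nilpotent radical of `p`. -/
def bigCell : Set G := {g | ∀ x ∈ q, (Ad g x : LieAlg E G) ∈ radicalIn p → x = 0}

lemma mul_mem_bigCell (h : IsOpposite p q) {g : G} {a b : G} (hg : g ∈ bigCell p q)
    (ha : a ∈ stab p.toSubmodule) (hb : b ∈ stab q.toSubmodule) : a * g * b ∈ bigCell p q := by
  intro x hx hxn
  rw [Ad_mul, Ad_mul] at hxn
  have h1 := Ad_mem_of_mem_stab (inv_mem (stab_le_stab_radicalIn h.left ha)) hxn
  rw [show Ad a⁻¹ (((Ad a ∘ₗ Ad g) ∘ₗ Ad b) x) = Ad g (Ad b x) from Ad_inv_apply a _] at h1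
  have h2 := hg _ (Ad_mem_of_mem_stab hb hx) h1
  rw [← Ad_inv_apply b x, h2, map_zero]

lemma one_mem_bigCell (h : IsOpposite p q) : (1 : G) ∈ bigCell p q := fun x hx hxn => by
  rw [Ad_one] at hxn
  exact h.disjoint hxn hx

/-- An element of the big cell decomposes, smoothly, into an element of the unipotent radical
and an element normalizing `q`. -/
lemma exists_unipotentPart (h : IsOpposite p q) : IsOpen (bigCell p q : Set G) ∧
    ∃ τ : G → LieAlg E G, ContMDiffOn 𝓘(ℝ, E) 𝓘(ℝ, E) ∞ (M' := E) τ (bigCell p q) ∧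
      ∀ g ∈ bigCell p q, τ g ∈ radicalIn p ∧ (lieExp (τ g))⁻¹ * g ∈ stab q.toSubmodule := by
  have := FiniteDimensional.complete ℝ E
  have hp := h.left
  obtain ⟨z, hz, hzp, hzq⟩ := exists_isGrading_inf h
  obtain ⟨ψ, hψ, hψ'⟩ := exists_smooth_conjugation hp hz hzp
  set π₁ : LieAlg E G →ₗ[ℝ] LieAlg E G :=
    Submodule.projection q.toSubmodule (radicalIn p) h.isCompl'.symm with hπ₁
  have hπmem : ∀ x, π₁ x ∈ q.toSubmodule := fun x =>
    Submodule.projection_apply_mem _ _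
  have hπq : ∀ x ∈ q.toSubmodule, π₁ x = x := fun x hx =>
    Submodule.projection_apply_of_mem_left _ hx
  have hπker : ∀ x, π₁ x = 0 ↔ x ∈ radicalIn p := fun x =>
    Submodule.projection_apply_eq_zero_iff _
  set π : E →L[ℝ] E := LinearMap.toContinuousLinearMap (E := E) π₁ with hπ
  -- With `π` the projection onto `q` along `n`, the operator `π ∘ Ad g ∘ π + (1 - π)` is invertible
  -- exactly when `Ad g` moves `q` to a complement of `n`. Openness of the cell and smoothness of
  -- the inverse follow from those of inversion on units.
  set B : G → E →L[ℝ] E := fun g => π * AdL g * π + (1 - π) with hB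
  have hBs : ContMDiff 𝓘(ℝ, E) 𝓘(ℝ, E →L[ℝ] E) ∞ B := by
    have h1 : ContDiff ℝ ∞ fun T : E →L[ℝ] E => π * T * π + (1 - π) := by fun_prop
    exact h1.contMDiff.comp contMDiff_AdL
  have hBapp : ∀ (g : G) (y : LieAlg E G), B g y = π₁ (Ad g (π₁ y)) + (y - π₁ y) := fun _ _ => rfl
  have hBπ : ∀ (g : G) (y v : LieAlg E G), B g y = v → π₁ (Ad g (π₁ y)) = π₁ v := by
    intro g y v hy
    rw [← (hBapp g y).symm.trans hy, map_add, map_sub, hπq _ (hπmem y), sub_self, add_zero,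
      hπq _ (hπmem _)]
  have hunit : (bigCell p q : Set G) = {g | IsUnit (B g)} := by
    ext g
    constructor
    · intro hg
      change IsUnit (B g)
      rw [ContinuousLinearMap.isUnit_iff_bijective]
      have hinj : Function.Injective (B g : E →ₗ[ℝ] E) := by
        rw [injective_iff_map_eq_zero]
        suffices hs : ∀ y : LieAlg E G, B g y = (0 : LieAlg E G) → y = 0 from hs
        intro y hy
        have h1 := hBπ g y 0 hy
        rw [map_zero, hπker] at h1
        have h2 := hg _ (hπmem y) h1
        have h3 : (π₁ (Ad g (π₁ y)) + (y - π₁ y) : LieAlg E G) = 0 := (hBapp g y).symm.trans hy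
        simpa [h2] using h3
      exact ⟨hinj, LinearMap.injective_iff_surjective.1 hinj⟩
    · intro hg x hx hxn
      have hinj := (ContinuousLinearMap.isUnit_iff_bijective.1 hg).1
      have h1 : B g x = (0 : LieAlg E G) := by
        rw [hBapp, hπq x hx, (hπker _).2 hxn, sub_self, add_zero]
      exact hinj (h1.trans (map_zero (B g)).symm)
  -- `c g` is the intersection point of `Ad g q` with `z + n`: it lies in `Ad g q`, and its
  -- projection to `q` along `n` is `z`.
  set c : G → LieAlg E G := fun g => Ad g (π₁ (Ring.inverse (B g) z)) with hc
  have hcs : ContMDiffOn 𝓘(ℝ, E) 𝓘(ℝ, E) ∞ (M' := E) c (bigCell p q) := by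
    intro g hg
    rw [hunit] at hg
    obtain ⟨u, hu⟩ : IsUnit (B g) := hg
    have h1 : ContMDiffAt 𝓘(ℝ, E) 𝓘(ℝ, E →L[ℝ] E) ∞ (fun g => Ring.inverse (B g)) g :=
      ContMDiffAt.comp_of_eq (contDiffAt_ringInverse ℝ u).contMDiffAt (hBs g) hu.symm
    have h2 : ContMDiffAt 𝓘(ℝ, E) 𝓘(ℝ, E) ∞
        (fun g : G => (AdL g : E →L[ℝ] E) (π (Ring.inverse (B g) (show E from z)))) g :=
      (contMDiff_AdL g).clm_apply (contMDiffAt_const.clm_apply (h1.clm_apply contMDiffAt_const))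
    exact h2.contMDiffWithinAt
  have hcw : ∀ g ∈ bigCell p q, c g - z ∈ radicalIn p := by
    intro g hg
    rw [hunit] at hg
    have h1 : B g (Ring.inverse (B g) z) = z :=
      congrArg (fun T : E →L[ℝ] E => T z) (Ring.mul_inverse_cancel _ hg)
    have h2 := hBπ g (Ring.inverse (B g) z) z h1
    rw [← hπker, map_sub]
    exact sub_eq_zero.2 h2
  refine ⟨?_, fun g => -ψ (c g - z), ?_, fun g hg => ⟨neg_mem (hψ' _ (hcw g hg)).1, ?_⟩⟩
  · rw [hunit]
    exact Units.isOpen.preimage hBs.continuous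
  · have h1 : ContDiff ℝ ∞ (fun y : E => -(show E from ψ (y - (show E from z)))) :=
      (hψ.comp (contDiff_id.sub contDiff_const)).neg
    exact h1.contMDiff.comp_contMDiffOn hcs
  · rw [lieExp_neg, inv_inv]
    obtain ⟨hw1, hw2⟩ := hψ' _ (hcw g hg)
    rw [add_sub_cancel] at hw2
    set u : G := lieExp (ψ (c g - z)) with hu
    refine mem_stab_of_map_le (Submodule.map_le_iff_le_comap.1 ?_)
    have hun : u ∈ stab (radicalIn p) :=
      stab_le_stab_radicalIn hp (lieExp_mem_stab (radicalIn_le p hw1))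
    -- After conjugation by `u`, the subalgebra `Ad (u g) q` contains `z`, so it is `ad z`-stable;
    -- it still meets `n` trivially because `u` normalizes `n`. Hence it lies in `q`.
    refine le_of_stable_grading hp hz ?_ h.isCompl' ?_ fun x hx => q.lie_mem hzq hx
    · rw [Submodule.disjoint_def]
      rintro _ hx ⟨y, hy, rfl⟩
      have h1 := Ad_mem_of_mem_stab (inv_mem hun) hx
      rw [Ad_mul, LinearMap.comp_apply, Ad_inv_apply] at h1
      rw [hg y hy h1, map_zero]
    · rintro _ ⟨y, hy, rfl⟩
      have h1 : z = Ad (u * g) (π₁ (Ring.inverse (B g) z)) := by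
        rw [Ad_mul]; exact hw2.symm
      have h2 := q.lie_mem (hπmem (Ring.inverse (B g) z)) hy
      refine ⟨_, h2, ?_⟩
      rw [Ad_lie, ← h1]

end Decomposition

namespace ParabolicModel

/-! ### The open cell, its triple decomposition and the flat Weyl structure. -/

section Cell

open Filter Topology

variable {E G : Type*} [NormedAddCommGroup E] [NormedSpace ℝ E]
  [FiniteDimensional ℝ E] [TopologicalSpace G] [ChartedSpace E G] [Group G]
  [LieGroup 𝓘(ℝ, E) ∞ G] [T2Space G] (D : ParabolicModel E G)

lemma isOpposite : IsOpposite D.p D.q := ⟨D.parabolic_p, D.parabolic_q, D.opposite⟩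

lemma P_le_stab : D.P ≤ stab D.p.toSubmodule := fun a ha =>
  mem_stab_of_map_le (D.p_le_comap_Ad ⟨a, ha⟩)

lemma lieExp_mem_P {x : LieAlg E G} (hx : x ∈ D.p) : lieExp x ∈ D.P := by
  simpa using (D.mem_p x).1 hx 1

lemma expN_subset_P {e : G} (he : e ∈ D.expN) : e ∈ D.P := by
  obtain ⟨x, hx, rfl⟩ := he
  exact D.lieExp_mem_P (radicalIn_le _ hx)

lemma mem_P₀_iff {g : G} : g ∈ D.P₀ ↔ g ∈ D.P ∧ g ∈ stab D.q.toSubmodule := Iff.rfl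

lemma expM_subset_stab {u : G} (hu : u ∈ D.expM) : u ∈ stab D.q.toSubmodule := by
  obtain ⟨x, hx, rfl⟩ := hu
  exact lieExp_mem_stab (radicalIn_le _ hx)

variable [LieAlgebra.IsSemisimple ℝ (LieAlg E G)]

lemma expM_eq : D.expM = (radicalGroup D.isOpposite.symm : Set G) := rfl

lemma expN_eq : D.expN = (radicalGroup D.isOpposite : Set G) := rfl

lemma conj_mem_expM {z u : G} (hz : z ∈ stab D.q.toSubmodule) (hu : u ∈ D.expM) :
    z * u * z⁻¹ ∈ D.expM := by
  obtain ⟨x, hx, rfl⟩ := hu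
  exact ⟨Ad z x, Ad_mem_of_mem_stab (stab_le_stab_radicalIn D.parabolic_q hz) hx, lieExp_Ad z x⟩

lemma conj_mem_expN {a e : G} (ha : a ∈ D.P) (he : e ∈ D.expN) : a * e * a⁻¹ ∈ D.expN := by
  obtain ⟨x, hx, rfl⟩ := he
  exact ⟨Ad a x, Ad_mem_of_mem_stab (stab_le_stab_radicalIn D.parabolic_p (D.P_le_stab ha)) hx,
    lieExp_Ad a x⟩

lemma eq_one_of_mem_expM {u : G} (hu : u ∈ D.expM) (h : u ∈ stab D.p.toSubmodule) : u = 1 :=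
  eq_one_of_mem_radicalGroup D.isOpposite.symm hu h

lemma eq_one_of_mem_expN {e : G} (he : e ∈ D.expN) (h : e ∈ stab D.q.toSubmodule) : e = 1 :=
  eq_one_of_mem_radicalGroup D.isOpposite he h

/-- `P` is open in the normalizer of its Lie algebra. -/
lemma eventually_mem_P : ∀ᶠ g in 𝓝 (1 : G), g ∈ stab D.p.toSubmodule → g ∈ D.P := by
  have hc := D.isOpposite.symm.isCompl'
  let A₁ : LieAlg E G →ₗ[ℝ] LieAlg E G := Submodule.projection _ _ hc
  let B₁ : LieAlg E G →ₗ[ℝ] LieAlg E G := Submodule.projection _ _ hc.symm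
  let A : E →L[ℝ] E := LinearMap.toContinuousLinearMap (E := E) A₁
  let B : E →L[ℝ] E := LinearMap.toContinuousLinearMap (E := E) B₁
  -- Near `1` every `g` is `exp a · exp b` with `a ∈ m`, `b ∈ p`. If `g` normalizes `p`, so does
  -- `exp a`, which is then trivial, and `g = exp b ∈ P`.
  have hT : HasDerivAtOne (fun v : E => (expE (A v) * expE (B v) : G))
      (ContinuousLinearMap.id ℝ E) := by
    have h := ((hasDerivAtOne_expE (E := E) (G := G)).comp A).mul
      ((hasDerivAtOne_expE (E := E) (G := G)).comp B)
    have e : (ContinuousLinearMap.id ℝ E).comp A + (ContinuousLinearMap.id ℝ E).comp B =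
        ContinuousLinearMap.id ℝ E :=
      ContinuousLinearMap.ext fun v => Submodule.projection_add_projection_eq_self hc v
    rwa [e] at h
  obtain ⟨Λ, -, -, hΛ⟩ := hT.exists_localRightInverse
  filter_upwards [hΛ] with g hg hs
  have h1 : lieExp (B₁ (Λ g)) ∈ D.P :=
    D.lieExp_mem_P (Submodule.projection_apply_mem hc.symm (Λ g : LieAlg E G))
  have h2 : (lieExp (A₁ (Λ g)) : G) = 1 := by
    refine D.eq_one_of_mem_expM ⟨_, Submodule.projection_apply_mem hc (Λ g : LieAlg E G), rfl⟩ ?_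
    have h3 : (lieExp (A₁ (Λ g)) : G) * lieExp (B₁ (Λ g)) = g := hg
    rw [eq_mul_inv_of_mul_eq h3]
    exact mul_mem hs (inv_mem (D.P_le_stab h1))
  have h3 : (lieExp (A₁ (Λ g)) : G) * lieExp (B₁ (Λ g)) = g := hg
  rw [h2, one_mul] at h3
  rwa [← h3]

/-- The `exp m`-component. -/
def mPart (g : G) : G := lieExp ((exists_unipotentPart D.isOpposite.symm).2.choose g)

/-- The `P`-component. -/
def pPart (g : G) : G := (D.mPart g)⁻¹ * g

/-- The inverse of the `exp n`-component of an element of `P`. -/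
def nPart (a : G) : G := lieExp ((exists_unipotentPart D.isOpposite).2.choose a⁻¹)

/-- The `P₀`-component. -/
def zPart (g : G) : G := D.pPart g * D.nPart (D.pPart g)

lemma mPart_mem {g : G} (hg : g ∈ bigCell D.q D.p) :
    D.mPart g ∈ D.expM ∧ D.pPart g ∈ stab D.p.toSubmodule := by
  have h := (exists_unipotentPart D.isOpposite.symm).2.choose_spec.2 g hg
  exact ⟨⟨_, h.1, rfl⟩, h.2⟩

/-- Uniqueness of the `exp m`-component: two choices differ by an element of the group `exp m`
normalizing `p`, which is `1`. -/
lemma mPart_eq {u g : G} (hu : u ∈ D.expM) (hg : u⁻¹ * g ∈ stab D.p.toSubmodule) :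
    g ∈ bigCell D.q D.p ∧ D.mPart g = u := by
  have h1 : g ∈ bigCell D.q D.p := by
    have := mul_mem_bigCell D.isOpposite.symm (one_mem_bigCell D.isOpposite.symm)
      (D.expM_subset_stab hu) hg
    rwa [mul_one, mul_inv_cancel_left] at this
  refine ⟨h1, ?_⟩
  obtain ⟨h2, h3⟩ := D.mPart_mem h1
  have h4 : u⁻¹ * D.mPart g = 1 := by
    refine D.eq_one_of_mem_expM ?_ ?_
    · rw [expM_eq] at hu h2 ⊢
      exact mul_mem (inv_mem hu) h2
    · have := mul_mem hg (inv_mem h3)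
      rw [pPart] at this
      convert this using 1
      group
  exact (inv_mul_eq_one.1 h4).symm

lemma P_subset_bigCell {a : G} (ha : a ∈ D.P) : a⁻¹ ∈ bigCell D.p D.q := by
  have := mul_mem_bigCell D.isOpposite (one_mem_bigCell D.isOpposite)
      (D.P_le_stab (inv_mem ha)) (one_mem _)
  rwa [mul_one, mul_one] at this

lemma nPart_mem {a : G} (ha : a ∈ D.P) : D.nPart a ∈ D.expN ∧ a * D.nPart a ∈ D.P₀ := by
  have h := (exists_unipotentPart D.isOpposite).2.choose_spec.2 _ (D.P_subset_bigCell ha)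
  have hn : D.nPart a ∈ D.expN := ⟨_, h.1, rfl⟩
  refine ⟨hn, D.mem_P₀_iff.2 ⟨mul_mem ha (D.expN_subset_P hn), ?_⟩⟩
  have := inv_mem h.2
  rwa [mul_inv_rev, inv_inv, inv_inv] at this

lemma mem_above_cell_iff_exists {g : G} :
    g ∈ D.above D.cell ↔ ∃ u ∈ D.expM, u⁻¹ * g ∈ D.P := by
  constructor
  · rintro ⟨u, hu, h⟩
    exact ⟨u, hu, QuotientGroup.eq.1 h⟩
  · rintro ⟨u, hu, h⟩
    exact ⟨u, hu, QuotientGroup.eq.2 h⟩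

lemma mPart_pPart_mem {g : G} (hg : g ∈ D.above D.cell) :
    g ∈ bigCell D.q D.p ∧ D.mPart g ∈ D.expM ∧ D.pPart g ∈ D.P := by
  obtain ⟨u, hu, h⟩ := D.mem_above_cell_iff_exists.1 hg
  obtain ⟨h1, h2⟩ := D.mPart_eq hu (D.P_le_stab h)
  exact ⟨h1, h2 ▸ hu, by rw [pPart, h2]; exact h⟩

lemma mPart_mul_pPart (g : G) : D.mPart g * D.pPart g = g := mul_inv_cancel_left _ _

/-- The big cell only provides a second factor normalizing `p`. The group `P` may be smaller than
that normalizer, so membership in `P` is a separate condition. -/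
lemma above_cell_eq : D.above D.cell = {g | g ∈ bigCell D.q D.p ∧ D.pPart g ∈ D.P} := by
  ext g
  refine ⟨fun hg => ?_, fun hg => ?_⟩
  · obtain ⟨h1, -, h2⟩ := D.mPart_pPart_mem hg
    exact ⟨h1, h2⟩
  · exact D.mem_above_cell_iff_exists.2 ⟨_, (D.mPart_mem hg.1).1, hg.2⟩

lemma contMDiffOn_mPart : ContMDiffOn 𝓘(ℝ, E) 𝓘(ℝ, E) ∞ D.mPart (bigCell D.q D.p) :=
  (contMDiff_expE (E := E) (G := G)).comp_contMDiffOn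
    (exists_unipotentPart D.isOpposite.symm).2.choose_spec.1

lemma contMDiffOn_pPart : ContMDiffOn 𝓘(ℝ, E) 𝓘(ℝ, E) ∞ D.pPart (bigCell D.q D.p) :=
  D.contMDiffOn_mPart.inv.mul contMDiffOn_id

/-- The `P`-component varies continuously within the normalizer of `p`, in which `P` is open, so it
stays in `P` near a point where it belongs to `P`. -/
lemma isOpen_above_cell : IsOpen (D.above D.cell) := by
  have := topologicalGroup_of_lieGroup (G := G) 𝓘(ℝ, E) ∞
  have hopen : IsOpen (bigCell D.q D.p : Set G) := (exists_unipotentPart D.isOpposite.symm).1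
  rw [isOpen_iff_mem_nhds]
  intro g hg
  obtain ⟨h1, -, h2⟩ := D.mPart_pPart_mem hg
  have h3 : ContinuousAt (fun h => (D.pPart g)⁻¹ * D.pPart h) g :=
    continuousAt_const.mul (D.contMDiffOn_pPart.continuousOn.continuousAt (hopen.mem_nhds h1))
  have h4 := h3.eventually (p := fun a => a ∈ stab D.p.toSubmodule → a ∈ D.P)
    (by simpa only [inv_mul_cancel] using D.eventually_mem_P)
  rw [D.above_cell_eq]
  filter_upwards [h4, hopen.mem_nhds h1] with h hh hb
  refine ⟨hb, ?_⟩
  have := mul_mem h2 (hh (mul_mem (inv_mem (D.P_le_stab h2)) (D.mPart_mem hb).2))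
  rwa [mul_inv_cancel_left] at this

lemma isOpen_cell : IsOpen D.cell := D.isOpen_above_cell

lemma contMDiffOn_zPart : ContMDiffOn 𝓘(ℝ, E) 𝓘(ℝ, E) ∞ D.zPart (D.above D.cell) := by
  have h1 : ContMDiffOn 𝓘(ℝ, E) 𝓘(ℝ, E) ∞ D.pPart (D.above D.cell) :=
    D.contMDiffOn_pPart.mono fun g hg => (D.mPart_pPart_mem hg).1
  have h2 : ContMDiffOn 𝓘(ℝ, E) 𝓘(ℝ, E) ∞ (fun g => D.nPart (D.pPart g)) (D.above D.cell) :=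
    (contMDiff_expE (E := E) (G := G)).comp_contMDiffOn
      ((exists_unipotentPart D.isOpposite).2.choose_spec.1.comp h1.inv
        fun g hg => D.P_subset_bigCell (D.mPart_pPart_mem hg).2.2)
  exact h1.mul h2

lemma zPart_mem {g : G} (hg : g ∈ D.above D.cell) : D.zPart g ∈ D.P₀ :=
  (D.nPart_mem (D.mPart_pPart_mem hg).2.2).2

/-- Every element over the open cell is `u * z * e` with `u ∈ exp m`, `z ∈ P₀`, `e ∈ exp n`. -/
lemma exists_eq_of_mem_above {g : G} (hg : g ∈ D.above D.cell) :
    ∃ e ∈ D.expN, g = D.mPart g * D.zPart g * e := by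
  have h := (D.nPart_mem (D.mPart_pPart_mem hg).2.2).1
  refine ⟨(D.nPart (D.pPart g))⁻¹, ?_, ?_⟩
  · rw [expN_eq] at h ⊢
    exact inv_mem h
  · rw [zPart, mul_assoc, mul_inv_cancel_right, mPart_mul_pPart]

lemma exists_decomposition {g : G} (hg : g ∈ D.above D.cell) :
    ∃ u ∈ D.expM, ∃ z ∈ D.P₀, ∃ e ∈ D.expN, g = u * (z * e) := by
  obtain ⟨e, he, h⟩ := D.exists_eq_of_mem_above hg
  exact ⟨_, (D.mPart_pPart_mem hg).2.1, _, D.zPart_mem hg, e, he, by rw [← mul_assoc]; exact h⟩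

lemma mem_above_of_eq {u a : G} (hu : u ∈ D.expM) (ha : a ∈ D.P) : u * a ∈ D.above D.cell :=
  D.mem_above_cell_iff_exists.2 ⟨u, hu, by rwa [inv_mul_cancel_left]⟩

lemma mPart_mul {u a : G} (hu : u ∈ D.expM) (ha : a ∈ D.P) :
    D.mPart (u * a) = u ∧ D.pPart (u * a) = a := by
  have h := (D.mPart_eq (g := u * a) hu (by rw [inv_mul_cancel_left]; exact D.P_le_stab ha)).2
  exact ⟨h, by rw [pPart, h, inv_mul_cancel_left]⟩

/-- Uniqueness of the `P₀`-component: `exp n` meets the normalizer of `q` only in `1`. -/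
lemma zPart_mul {u z e : G} (hu : u ∈ D.expM) (hz : z ∈ D.P₀) (he : e ∈ D.expN) :
    D.zPart (u * (z * e)) = z := by
  have ha : z * e ∈ D.P := mul_mem hz.1 (D.expN_subset_P he)
  obtain ⟨h1, h2⟩ := D.nPart_mem ha
  rw [zPart, (D.mPart_mul hu ha).2]
  have h3 : e * D.nPart (z * e) = 1 := by
    refine D.eq_one_of_mem_expN ?_ ?_
    · rw [expN_eq] at he h1 ⊢
      exact mul_mem he h1
    · have := (mul_mem (inv_mem hz) h2).2
      rwa [mul_assoc, inv_mul_cancel_left] at this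
  rw [mul_assoc, h3, mul_one]

/-- The normal flat Weyl structure. -/
def flat (g : G) : G := D.mPart g * D.zPart g

lemma flat_mul {u z e : G} (hu : u ∈ D.expM) (hz : z ∈ D.P₀) (he : e ∈ D.expN) :
    D.flat (u * (z * e)) = u * z := by
  rw [flat, D.zPart_mul hu hz he, (D.mPart_mul hu (mul_mem hz.1 (D.expN_subset_P he))).1]

lemma one_mem_expN : (1 : G) ∈ D.expN := one_mem (radicalGroup D.isOpposite)

lemma isNormalFlat_flat : D.IsNormalFlat D.flat := by
  refine ⟨⟨?_, ?_, ?_, ?_⟩, ?_⟩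
  · exact (D.contMDiffOn_mPart.mono fun g hg => (D.mPart_pPart_mem hg).1).mul D.contMDiffOn_zPart
  · intro g hg e' he'
    obtain ⟨u, hu, z, hz, e, he, rfl⟩ := D.exists_decomposition hg
    have : e * e' ∈ D.expN := (radicalGroup D.isOpposite).mul_mem he he'
    rw [mul_assoc, mul_assoc, D.flat_mul hu hz he, D.flat_mul hu hz this]
  · intro g hg z' hz'
    obtain ⟨u, hu, z, hz, e, he, rfl⟩ := D.exists_decomposition hg
    have h1 : z'⁻¹ * e * z'⁻¹⁻¹ ∈ D.expN := D.conj_mem_expN (inv_mem hz'.1) he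
    have h2 : u * (z * e) * z' = u * (z * z' * (z'⁻¹ * e * z'⁻¹⁻¹)) := by group
    rw [h2, D.flat_mul hu hz he, D.flat_mul hu (mul_mem hz hz') h1, mul_assoc]
  · intro g hg
    obtain ⟨u, hu, z, hz, e, he, rfl⟩ := D.exists_decomposition hg
    refine ⟨e⁻¹, (radicalGroup D.isOpposite).inv_mem he, ?_⟩
    rw [D.flat_mul hu hz he]
    group
  · ext g
    constructor
    · rintro ⟨g, hg, rfl⟩
      obtain ⟨u, hu, z, hz, e, he, rfl⟩ := D.exists_decomposition hg
      exact ⟨u, hu, z, hz, D.flat_mul hu hz he⟩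
    · rintro ⟨u, hu, z, hz, rfl⟩
      refine ⟨u * z, D.mem_above_of_eq hu hz.1, ?_⟩
      have := D.flat_mul hu hz D.one_mem_expN
      rwa [mul_one] at this

end Cell

end ParabolicModel

namespace ParabolicModel

/-! ### Vanishing of the Weyl covariant derivative. -/

section CovariantDerivative

open Filter Topology

variable {E G : Type*} [NormedAddCommGroup E] [NormedSpace ℝ E]
  [FiniteDimensional ℝ E] [TopologicalSpace G] [ChartedSpace E G] [Group G]
  [LieGroup 𝓘(ℝ, E) ∞ G] [T2Space G]

/-- The derivative of a function along a left-invariant field is the derivative along the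
one-parameter subgroup. -/
lemma hasDerivAt_comp_lieExp {F : Type*} [NormedAddCommGroup F] [NormedSpace ℝ F] {f : G → F}
    {g : G} (hf : MDifferentiableAt 𝓘(ℝ, E) 𝓘(ℝ, F) f g) (ξ : LieAlg E G) :
    HasDerivAt (fun t : ℝ => f (g * lieExp (t • ξ)))
      ((mfderiv 𝓘(ℝ, E) 𝓘(ℝ, F) f g : E →L[ℝ] F) (mulInvariantVectorField ξ g)) 0 := by
  have h1 := isMIntegralCurve_mul_left (isMIntegralCurve_lieExp ξ) g 0
  have e : g * lieExp ((0 : ℝ) • ξ) = g := by rw [zero_smul, lieExp_zero, mul_one]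
  have h2 : HasMFDerivAt 𝓘(ℝ, E) 𝓘(ℝ, F) f (g * lieExp ((0 : ℝ) • ξ))
      (mfderiv 𝓘(ℝ, E) 𝓘(ℝ, F) f (g * lieExp ((0 : ℝ) • ξ))) := by
    rw [e]; exact hf.hasMFDerivAt
  have h3 : HasFDerivAt (fun t : ℝ => f (g * lieExp (t • ξ))) (_ : ℝ →L[ℝ] F) 0 :=
    hasMFDerivAt_iff_hasFDerivAt.1 (h2.comp (0 : ℝ) h1)
  refine h3.hasDerivAt.congr_deriv ?_
  change (mfderiv 𝓘(ℝ, E) 𝓘(ℝ, F) f (g * lieExp ((0 : ℝ) • ξ)) : E →L[ℝ] F)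
    ((1 : ℝ) • (mulInvariantVectorField ξ (g * lieExp ((0 : ℝ) • ξ)) : E)) = _
  rw [one_smul, e]

/-- A subspace valued function has derivative in the subspace. -/
lemma mfderiv_mem_of_eventually_mem {f : G → E} {g : G} (A : Submodule ℝ E)
    (hf : MDifferentiableAt 𝓘(ℝ, E) 𝓘(ℝ, E) f g) (h : ∀ᶠ x in 𝓝 g, f x ∈ A)
    (v : TangentSpace 𝓘(ℝ, E) g) : (mfderiv 𝓘(ℝ, E) 𝓘(ℝ, E) f g : E →L[ℝ] E) v ∈ A := by
  obtain ⟨K, hK⟩ := A.exists_isCompl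
  let π : E →L[ℝ] E := LinearMap.toContinuousLinearMap (Submodule.projection K A hK.symm)
  have h0 : (fun x => π (f x)) =ᶠ[𝓝 g] fun _ => 0 := by
    filter_upwards [h] with x hx
    exact (Submodule.projection_apply_eq_zero_iff hK.symm).2 hx
  have h1 : HasMFDerivAt 𝓘(ℝ, E) 𝓘(ℝ, E) (fun x => π (f x)) g _ :=
    (π.hasFDerivAt (x := f g)).hasMFDerivAt.comp g hf.hasMFDerivAt
  have h2 : HasMFDerivAt 𝓘(ℝ, E) 𝓘(ℝ, E) (fun x => π (f x)) g (0 : E →L[ℝ] E) :=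
    (hasMFDerivAt_const (0 : E) g).congr_of_eventuallyEq h0
  have h3 := congrArg (fun T : E →L[ℝ] E => T v) (hasMFDerivAt_unique h1 h2)
  exact (Submodule.projection_apply_eq_zero_iff hK.symm).1 h3

/-- The derivative at a point mapped to `1` of a map to the normalizer of `q`. -/
lemma mfderiv_mem_of_mem_stab [LieAlgebra.IsSemisimple ℝ (LieAlg E G)]
    {p q : LieSubalgebra ℝ (LieAlg E G)} (h : IsOpposite q p) {k : G → G} {g : G}
    (hk : MDifferentiableAt 𝓘(ℝ, E) 𝓘(ℝ, E) k g) (hg : k g = 1)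
    (hs : ∀ᶠ x in 𝓝 g, k x ∈ stab q.toSubmodule) (v : TangentSpace 𝓘(ℝ, E) g) :
    ((mfderiv 𝓘(ℝ, E) 𝓘(ℝ, E) k g : E →L[ℝ] E) v : LieAlg E G) ∈ q := by
  refine h.mem_of_normalizes fun y hy => ?_
  have hd : HasMFDerivAt 𝓘(ℝ, E) 𝓘(ℝ, E →L[ℝ] E) (fun g : G => (AdL g : E →L[ℝ] E)) (k g)
      (adL E G) := by
    rw [hg]
    exact ((contMDiff_AdL (E := E) (G := G)).mdifferentiable (by simp) 1).hasMFDerivAt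
  have h1 : HasMFDerivAt 𝓘(ℝ, E) 𝓘(ℝ, E →L[ℝ] E) (fun x : G => (AdL (k x) : E →L[ℝ] E)) g _ :=
    hd.comp g hk.hasMFDerivAt
  have h2 : HasMFDerivAt 𝓘(ℝ, E) 𝓘(ℝ, E) (fun x : G => (AdL (k x) : E →L[ℝ] E) (show E from y)) g _ :=
    ((ContinuousLinearMap.apply ℝ E (show E from y)).hasFDerivAt
      (x := (AdL (k g) : E →L[ℝ] E))).hasMFDerivAt.comp g h1
  have h3 := mfderiv_mem_of_eventually_mem (E := E) (G := G) q.toSubmodule h2.mdifferentiableAt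
    (hs.mono fun x hx => Ad_mem_of_mem_stab hx hy) v
  rw [h2.mfderiv] at h3
  have h4 := adL_apply ((mfderiv 𝓘(ℝ, E) 𝓘(ℝ, E) k g : E →L[ℝ] E) v : LieAlg E G) y
  rw [← h4]
  exact h3

/-- A tangent vector is the value of the invariant field given by the Maurer-Cartan form. -/
lemma mulInvariantVectorField_maurerCartan (g : G) (v : TangentSpace 𝓘(ℝ, E) g) :
    mulInvariantVectorField (maurerCartan g v) g = v := by
  have h := mfderiv_comp_of_eq' (E := E) (x := g) (y := 1) (mdifferentiable_mul_left' g⁻¹)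
    (mdifferentiable_mul_left' g) (inv_mul_cancel g) v
  have e : (fun x : G => g * x) ∘ (fun x : G => g⁻¹ * x) = id := by ext; simp
  rw [e, mfderiv_id] at h
  exact h.symm

variable (D : ParabolicModel E G) [LieAlgebra.IsSemisimple ℝ (LieAlg E G)]

/-- A function on the total space which is invariant under `exp m` along a Weyl structure whose
image is contained in a left coset of the normalizer of `q` is covariantly constant. -/
lemma covDeriv_eq_zero {U : Set (G ⧸ D.P)} (hU : IsOpen (D.above U)) {σ : G → G}
    (hσ : D.IsWeylStructure U σ)
    (hs : ∀ g ∈ D.above U, ∀ h ∈ D.above U, (σ g)⁻¹ * σ h ∈ stab D.q.toSubmodule)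
    {F : Type*} [NormedAddCommGroup F] [NormedSpace ℝ F] {f : G → F}
    (hf : ContMDiffOn 𝓘(ℝ, E) 𝓘(ℝ, F) ∞ f (D.above U))
    (hfm : ∀ g ∈ D.above U, ∀ u ∈ D.expM, f (σ g * u) = f (σ g))
    {g : G} (hg : g ∈ D.above U) (v : TangentSpace 𝓘(ℝ, E) g) : D.covDeriv σ f g v = 0 := by
  have hσg : σ g ∈ D.above U := by
    obtain ⟨e, he, h⟩ := hσ.splitting g hg
    rw [h]
    have : ((g * e : G) : G ⧸ D.P) = (g : G ⧸ D.P) :=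
      QuotientGroup.eq.2 (by simpa using D.expN_subset_P he)
    change ((g * e : G) : G ⧸ D.P) ∈ U
    rw [this]; exact hg
  have hσd : MDifferentiableAt 𝓘(ℝ, E) 𝓘(ℝ, E) σ g :=
    (hσ.smooth.contMDiffAt (hU.mem_nhds hg)).mdifferentiableAt (by simp)
  have hfd : MDifferentiableAt 𝓘(ℝ, E) 𝓘(ℝ, F) f (σ g) :=
    (hf.contMDiffAt (hU.mem_nhds hσg)).mdifferentiableAt (by simp)
  set w : LieAlg E G := maurerCartan (σ g) (mfderiv 𝓘(ℝ, E) 𝓘(ℝ, E) σ g v) with hw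
  set c : LieAlg E G := D.weylConnection σ g v with hc
  -- `w` is the velocity at `1` of a map into the normalizer of `q`, and `q` is self-normalizing.
  have hwq : w ∈ D.q := by
    have h1 : HasMFDerivAt 𝓘(ℝ, E) 𝓘(ℝ, E) (fun x => (σ g)⁻¹ * σ x) g _ :=
      (mdifferentiable_mul_left' (E := E) (σ g)⁻¹ (σ g)).hasMFDerivAt.comp g hσd.hasMFDerivAt
    have h2 := mfderiv_mem_of_mem_stab D.isOpposite.symm h1.mdifferentiableAt
      (inv_mul_cancel (σ g)) (Filter.eventually_of_mem (hU.mem_nhds hg) fun x hx => hs g hg x hx) v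
    rw [h1.mfderiv] at h2
    exact h2
  have hdec := isCompl_levi D.parabolic_p D.parabolic_q D.opposite
  have hcp : c ∈ D.p₀ := Submodule.projection_apply_mem hdec w
  -- Removing the `p₀`-component leaves an element of `m + n` that lies in `q`; its `n`-part is then
  -- in `n ∩ q = 0`.
  have hμ : w - c ∈ D.m := by
    have h1 : w - c ∈ D.m ⊔ D.n := by
      refine (Submodule.projection_apply_eq_zero_iff hdec).1 ?_
      rw [map_sub]
      exact sub_eq_zero.2 (Submodule.projection_apply_of_mem_left hdec hcp).symm
    obtain ⟨a, ha, b, hb, hab⟩ := Submodule.mem_sup.1 h1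
    have hbq : b ∈ D.q := by
      have : b = w - c - a := by rw [← hab]; abel
      rw [this]
      exact D.q.toSubmodule.sub_mem (D.q.toSubmodule.sub_mem hwq hcp.2) (radicalIn_le _ ha)
    have hb0 : b = 0 := D.isOpposite.disjoint hb hbq
    rw [← hab, hb0, add_zero]
    exact ha
  have h1 : mfderiv 𝓘(ℝ, E) 𝓘(ℝ, E) σ g v = mulInvariantVectorField w (σ g) :=
    (mulInvariantVectorField_maurerCartan (σ g) _).symm
  have hcomp : HasMFDerivAt 𝓘(ℝ, E) 𝓘(ℝ, F) (f ∘ σ) g _ :=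
    hfd.hasMFDerivAt.comp g hσd.hasMFDerivAt
  have e1 : (mfderiv 𝓘(ℝ, E) 𝓘(ℝ, F) (f ∘ σ) g : E →L[ℝ] F) v =
      (mfderiv 𝓘(ℝ, E) 𝓘(ℝ, F) f (σ g) : E →L[ℝ] F) (mulInvariantVectorField w (σ g)) := by
    rw [hcomp.mfderiv, ← h1]
    rfl
  have hP₀ : ∀ t : ℝ, lieExp (t • c) ∈ D.P₀ := fun t =>
    D.mem_P₀_iff.2 ⟨D.lieExp_mem_P (D.p.smul_mem t hcp.1), lieExp_mem_stab (D.q.smul_mem t hcp.2)⟩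
  -- Since `exp(tc) ∈ P₀`, equivariance of `σ` carries the vertical direction `c` at `g` to the same
  -- direction at `σ g`. The covariant derivative is therefore the derivative of `f` at `σ g` along
  -- `w - c ∈ m`, which vanishes.
  have e2 : (mfderiv 𝓘(ℝ, E) 𝓘(ℝ, F) (f ∘ σ) g : E →L[ℝ] F) (mulInvariantVectorField c g) =
      (mfderiv 𝓘(ℝ, E) 𝓘(ℝ, F) f (σ g) : E →L[ℝ] F) (mulInvariantVectorField c (σ g)) := by
    have k1 := hasDerivAt_comp_lieExp hcomp.mdifferentiableAt c
    have k2 := hasDerivAt_comp_lieExp hfd c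
    refine k1.unique ?_
    have : (fun t : ℝ => (f ∘ σ) (g * lieExp (t • c))) = fun t => f (σ g * lieExp (t • c)) :=
      funext fun t => congrArg f (hσ.equivariant g hg _ (hP₀ t))
    rw [this]
    exact k2
  have e3 : (mfderiv 𝓘(ℝ, E) 𝓘(ℝ, F) f (σ g) : E →L[ℝ] F)
      (mulInvariantVectorField (w - c) (σ g)) = 0 := by
    have k1 := hasDerivAt_comp_lieExp hfd (w - c)
    refine k1.unique ?_
    have : (fun t : ℝ => f (σ g * lieExp (t • (w - c)))) = fun _ => f (σ g) := by
      ext1 t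
      exact hfm g hg _ ⟨_, D.m.smul_mem t hμ, rfl⟩
    rw [this]
    exact hasDerivAt_const _ _
  have e4 : (mulInvariantVectorField (w - c) (σ g) : E) =
      (show E from mulInvariantVectorField w (σ g)) - (show E from mulInvariantVectorField c (σ g)) :=
    map_sub (mfderiv 𝓘(ℝ, E) 𝓘(ℝ, E) (fun x : G => σ g * x) 1 : E →L[ℝ] E) w c
  let T₁ : E →L[ℝ] F := mfderiv 𝓘(ℝ, E) 𝓘(ℝ, F) (f ∘ σ) g
  let T₂ : E →L[ℝ] F := mfderiv 𝓘(ℝ, E) 𝓘(ℝ, F) f (σ g)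
  exact (map_sub T₁ _ _).trans ((congrArg₂ (fun a b : F => a - b) e1 e2).trans
    ((map_sub T₂ _ _).symm.trans ((congrArg T₂ e4.symm).trans e3)))

end CovariantDerivative

end ParabolicModel

/-! ### Continuous representations of `P₀` are smooth; sections constant on `exp m`. -/

/-- A continuous one-parameter group in a Banach algebra is smooth. -/
lemma contDiff_of_continuous_of_map_add {A : Type*} [NormedRing A] [NormedAlgebra ℝ A]
    [CompleteSpace A] {c : ℝ → A} (hc : Continuous c) (h0 : c 0 = 1)
    (hadd : ∀ s t, c (s + t) = c s * c t) : ContDiff ℝ ∞ c := by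
  set I : ℝ → A := fun t => ∫ x in (0 : ℝ)..t, c x with hI
  have hd : ∀ t, HasDerivAt I (c t) t := fun t => intervalIntegral.integral_hasDerivAt_right
    (hc.intervalIntegrable _ _) hc.aestronglyMeasurable.stronglyMeasurableAtFilter hc.continuousAt
  -- `I t / t` tends to `c 0 = 1`, and the units are open.
  obtain ⟨h, hu⟩ : ∃ h, IsUnit (I h) := by
    have h1 := (hasDerivAt_iff_tendsto_slope_zero.1 (hd 0))
    rw [h0] at h1
    have h2 := h1.eventually (Units.isOpen.mem_nhds (isUnit_one : IsUnit (1 : A)))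
    obtain ⟨t, ht, ht0⟩ := (h2.and self_mem_nhdsWithin).exists
    refine ⟨t, ?_⟩
    have h3 : I 0 = 0 := intervalIntegral.integral_same
    rw [zero_add, h3, sub_zero] at ht
    have ht' : IsUnit (t⁻¹ • I t) := ht
    have h4 : t⁻¹ ≠ 0 := inv_ne_zero ht0
    rw [show t⁻¹ • I t = (Units.mk0 t⁻¹ h4) • I t from rfl] at ht'
    exact (isUnit_smul_iff _ _).1 ht'
  -- Integrating `c(t) c(x) = c(t + x)` over `x ∈ [0, h]` expresses `c` through its primitive; as `I
  -- h` is invertible, `c` gains one derivative at each step of the induction below.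
  have hmul : ∀ t, c t * I h = I (t + h) - I t := by
    intro t
    have h1 : c t * I h = ∫ x in (0 : ℝ)..h, c t * c x :=
      ((ContinuousLinearMap.mul ℝ A (c t)).intervalIntegral_comp_comm
        (hc.intervalIntegrable 0 h)).symm
    have h2 : ∫ x in (0 : ℝ)..h, c t * c x = ∫ x in (0 : ℝ)..h, c (t + x) := by
      simp only [hadd]
    rw [h1, h2, intervalIntegral.integral_comp_add_left, add_zero]
    exact (intervalIntegral.integral_interval_sub_left (hc.intervalIntegrable _ _)
      (hc.intervalIntegrable _ _)).symm
  obtain ⟨u, hu⟩ := hu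
  have hc' : c = fun t => (I (t + h) - I t) * ((u⁻¹ : Aˣ) : A) := by
    ext1 t
    rw [← hmul, ← hu, Units.mul_inv_cancel_right]
  have hdI : deriv I = c := funext fun t => (hd t).deriv
  refine contDiff_infty.2 fun k => ?_
  induction k with
  | zero => exact contDiff_zero.2 hc
  | succ k ih =>
    have h1 : ContDiff ℝ ((k : WithTop ℕ∞) + 1) I := by
      rw [contDiff_succ_iff_deriv]
      exact ⟨fun t => (hd t).differentiableAt, by simp, hdI ▸ ih⟩
    push_cast
    rw [hc']
    exact ((h1.comp (contDiff_id.add contDiff_const)).sub h1).mul contDiff_const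

namespace ParabolicModel

section Sections

open Filter Topology

variable {E G : Type*} [NormedAddCommGroup E] [NormedSpace ℝ E]
  [FiniteDimensional ℝ E] [TopologicalSpace G] [ChartedSpace E G] [Group G]
  [LieGroup 𝓘(ℝ, E) ∞ G] [T2Space G] (D : ParabolicModel E G)

lemma lieExp_mem_P₀ {x : LieAlg E G} (hx : x ∈ D.p₀) : lieExp x ∈ D.P₀ :=
  D.mem_P₀_iff.2 ⟨D.lieExp_mem_P hx.1, lieExp_mem_stab hx.2⟩

variable {V : Type*} [NormedAddCommGroup V] [NormedSpace ℝ V] [FiniteDimensional ℝ V]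
  {ρ : Representation ℝ D.P₀ V}

/-- The operators of a representation. -/
def repL (ρ : Representation ℝ D.P₀ V) (z : D.P₀) : V →L[ℝ] V :=
  LinearMap.toContinuousLinearMap (ρ z)

lemma repL_mul (z w : D.P₀) : D.repL ρ (z * w) = D.repL ρ z * D.repL ρ w := by
  ext v
  simp [repL]

lemma repL_one : D.repL ρ 1 = 1 := by
  ext v
  simp [repL]

variable [LieAlgebra.IsSemisimple ℝ (LieAlg E G)]

/-- A substitute for `exp` on `p₀`: products of one-parameter subgroups along `A` of a basis. On
each factor the representation is a continuous one-parameter group, hence smooth, and products add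
derivatives. -/
lemma exists_section_P₀ (hρ : ∀ v : V, Continuous fun z => ρ z v) (A : E →L[ℝ] E)
    (hA : ∀ v, (A v : LieAlg E G) ∈ D.p₀) :
    ∃ s : E → G, HasDerivAtOne s A ∧ ∃ hs : ∀ v, s v ∈ D.P₀,
      ContDiff ℝ ∞ fun v => D.repL ρ ⟨s v, hs v⟩ := by
  let Q : (E →L[ℝ] E) → Prop := fun A => ∃ s : E → G, HasDerivAtOne s A ∧
    ∃ hs : ∀ v, s v ∈ D.P₀, ContDiff ℝ ∞ fun v => D.repL ρ ⟨s v, hs v⟩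
  have hadd : ∀ A B, Q A → Q B → Q (A + B) := by
    rintro A B ⟨s, h1, h2, h3⟩ ⟨t, k1, k2, k3⟩
    refine ⟨fun v => s v * t v, h1.mul k1, fun v => mul_mem (h2 v) (k2 v), ?_⟩
    have := h3.mul k3
    simp only [← D.repL_mul] at this
    exact this
  have hzero : Q 0 := ⟨fun _ => 1, HasDerivAtOne.one, fun _ => one_mem _, contDiff_const⟩
  have hone : ∀ (l : E →L[ℝ] ℝ) (ζ : E), (ζ : LieAlg E G) ∈ D.p₀ → Q (l.smulRight ζ) := by
    intro l ζ hζ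
    have hmem : ∀ t : ℝ, (expE (t • ζ) : G) ∈ D.P₀ := fun t =>
      D.lieExp_mem_P₀ (D.p₀.smul_mem t hζ)
    have hT := (hasDerivAtOne_expE (E := E) (G := G)).comp (l.smulRight ζ)
    rw [ContinuousLinearMap.id_comp] at hT
    refine ⟨fun v => expE (l v • ζ), hT, fun v => hmem (l v), ?_⟩
    have hsm : ContDiff ℝ ∞ fun t : ℝ => D.repL ρ ⟨expE (t • ζ), hmem t⟩ := by
      have := FiniteDimensional.complete ℝ V
      refine contDiff_of_continuous_of_map_add ?_ ?_ ?_
      · rw [continuous_clm_apply]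
        exact fun v => (hρ v).comp ((continuous_expE_smul (G := G) ζ).subtype_mk hmem)
      · rw [← D.repL_one (ρ := ρ)]
        congr 1
        exact Subtype.ext ((congrArg expE (zero_smul ℝ ζ)).trans expE_zero)
      · intro s t
        rw [← D.repL_mul]
        congr 1
        exact Subtype.ext (expE_add_smul (G := G) s t ζ)
    exact hsm.comp l.contDiff
  have hsum : A = ∑ i, ((LinearMap.toContinuousLinearMap
      ((Module.finBasis ℝ E).coord i)).smulRight (A (Module.finBasis ℝ E i))) := by
    refine ContinuousLinearMap.coe_injective ((Module.finBasis ℝ E).ext fun j => ?_)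
    simp [Finsupp.single_apply]
  have : Q A := by
    rw [hsum]
    exact Finset.sum_induction _ Q hadd hzero fun i _ => hone _ _ (hA _)
  exact this

/-- A continuous representation of `P₀` is locally the restriction of a smooth function on `G`. -/
lemma exists_smooth_repL (hρ : ∀ v : V, Continuous fun z => ρ z v) :
    ∃ Φ : G → V →L[ℝ] V, ContMDiffAt 𝓘(ℝ, E) 𝓘(ℝ, V →L[ℝ] V) ∞ Φ 1 ∧
      ∀ᶠ k in 𝓝 (1 : G), ∀ hk : k ∈ D.P₀, D.repL ρ ⟨k, hk⟩ = Φ k := by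
  have hcp := D.isOpposite.symm.isCompl'.symm
  have hcq := D.isOpposite.isCompl'.symm
  let πp₁ : LieAlg E G →ₗ[ℝ] LieAlg E G := Submodule.projection _ _ hcp
  let πq₁ : LieAlg E G →ₗ[ℝ] LieAlg E G := Submodule.projection _ _ hcq
  have hm : ∀ v : LieAlg E G, v - πp₁ v ∈ radicalIn D.q := fun v => by
    have := Submodule.projection_apply_mem hcp.symm v
    rwa [Submodule.projection_eq_self_sub_projection] at this
  have hn : ∀ v : LieAlg E G, v - πq₁ v ∈ radicalIn D.p := fun v => by
    have := Submodule.projection_apply_mem hcq.symm v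
    rwa [Submodule.projection_eq_self_sub_projection] at this
  let πp : E →L[ℝ] E := LinearMap.toContinuousLinearMap (E := E) πp₁
  let πq : E →L[ℝ] E := LinearMap.toContinuousLinearMap (E := E) πq₁
  -- The three components of `v` along `m ⊕ p₀ ⊕ n` are `v - πp v`, `πp v - (v - πq v)` and `v - πq
  -- v`.
  have h₀ : ∀ v : LieAlg E G, πp₁ v - (v - πq₁ v) ∈ D.p₀ := fun v => by
    refine ⟨?_, ?_⟩
    · exact Submodule.sub_mem _ (Submodule.projection_apply_mem hcp v) (radicalIn_le _ (hn v))
    · have : πp₁ v - (v - πq₁ v) = πq₁ v - (v - πp₁ v) := by abel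
      rw [this]
      exact Submodule.sub_mem _ (Submodule.projection_apply_mem hcq v) (radicalIn_le _ (hm v))
  obtain ⟨s, hs1, hs2, hs3⟩ := D.exists_section_P₀ hρ (πp - (1 - πq)) h₀
  have hT : HasDerivAtOne (fun v : E => s v * expE ((1 - πq) v) * expE ((1 - πp) v))
      (ContinuousLinearMap.id ℝ E) := by
    have h := (hs1.mul ((hasDerivAtOne_expE (E := E) (G := G)).comp (1 - πq))).mul
      ((hasDerivAtOne_expE (E := E) (G := G)).comp (1 - πp))
    rw [ContinuousLinearMap.id_comp, ContinuousLinearMap.id_comp] at h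
    have e : πp - (1 - πq) + (1 - πq) + (1 - πp) = ContinuousLinearMap.id ℝ E := by
      rw [sub_add_cancel, add_sub_cancel]; rfl
    rwa [e] at h
  obtain ⟨Λ, hΛ1, hΛ2, hΛ3⟩ := hT.exists_localRightInverse
  refine ⟨fun k => D.repL ρ ⟨s (Λ k), hs2 _⟩, ?_, ?_⟩
  · exact hs3.contMDiff.contMDiffAt.comp (1 : G) hΛ1
  · filter_upwards [hΛ3] with k hk hkP
    congr 1
    apply Subtype.ext
    change k = s (Λ k)
    set a : G := expE ((1 - πq) (Λ k)) with ha
    set b : G := expE ((1 - πp) (Λ k)) with hb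
    have han : a ∈ D.expN := ⟨_, hn (Λ k : LieAlg E G), rfl⟩
    have hbm : b ∈ D.expM := ⟨_, hm (Λ k : LieAlg E G), rfl⟩
    have hk' : s (Λ k) * a * b = k := hk
    -- For `k ∈ P₀` the `exp m`- and `exp n`-factors are trivial, so `k` is the value of the
    -- section, on which the representation is smooth.
    have hb1 : b = 1 := by
      refine D.eq_one_of_mem_expM hbm (D.P_le_stab ?_)
      rw [eq_inv_mul_of_mul_eq hk']
      exact mul_mem (inv_mem (mul_mem (hs2 _).1 (D.expN_subset_P han))) hkP.1
    rw [hb1, mul_one] at hk'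
    have ha1 : a = 1 := by
      refine D.eq_one_of_mem_expN han ?_
      rw [eq_inv_mul_of_mul_eq hk']
      exact (mul_mem (inv_mem (hs2 _)) hkP).2
    rw [ha1, mul_one] at hk'
    exact hk'.symm

lemma zPart_mul_expN {g : G} (hg : g ∈ D.above D.cell) {e : G} (he : e ∈ D.expN) :
    D.zPart (g * e) = D.zPart g := by
  obtain ⟨u, hu, z, hz, e', he', rfl⟩ := D.exists_decomposition hg
  have : e' * e ∈ D.expN := (radicalGroup D.isOpposite).mul_mem he' he
  rw [mul_assoc, mul_assoc, D.zPart_mul hu hz this, D.zPart_mul hu hz he']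

lemma zPart_mul_P₀ {g : G} (hg : g ∈ D.above D.cell) {z : G} (hz : z ∈ D.P₀) :
    D.zPart (g * z) = D.zPart g * z := by
  obtain ⟨u, hu, z', hz', e, he, rfl⟩ := D.exists_decomposition hg
  have h1 : z⁻¹ * e * z⁻¹⁻¹ ∈ D.expN := D.conj_mem_expN (inv_mem hz.1) he
  have h2 : u * (z' * e) * z = u * (z' * z * (z⁻¹ * e * z⁻¹⁻¹)) := by group
  rw [h2, D.zPart_mul hu (mul_mem hz' hz) h1, D.zPart_mul hu hz' he]

lemma zPart_expM {u : G} (hu : u ∈ D.expM) : D.zPart u = 1 := by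
  have := D.zPart_mul hu (one_mem D.P₀) D.one_mem_expN
  rwa [mul_one, mul_one] at this

lemma mul_mem_above {U : Set (G ⧸ D.P)} {g a : G} (hg : g ∈ D.above U) (ha : a ∈ D.P) :
    g * a ∈ D.above U := by
  have : ((g * a : G) : G ⧸ D.P) = (g : G ⧸ D.P) := QuotientGroup.eq.2 (by simpa using ha)
  change ((g * a : G) : G ⧸ D.P) ∈ U
  rw [this]
  exact hg

/-- Constant functions on `exp m` define sections of induced bundles. -/
lemma exists_isSection (hρ : ∀ v : V, Continuous fun z => ρ z v) (f₀ : V) :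
    ∃ f : G → V, D.IsSection ρ D.cell f ∧ ∀ u ∈ D.expM, f u = f₀ := by
  classical
  -- Equivariance forces `f(u z e) = ρ(z)⁻¹ f₀`; the value `0` is used only where the component is
  -- not in `P₀`, which never happens over the cell.
  let f : G → V := fun g => if h : D.zPart g ∈ D.P₀ then ρ (⟨D.zPart g, h⟩ : D.P₀)⁻¹ f₀ else 0
  have hf : ∀ g (h : D.zPart g ∈ D.P₀), f g = ρ (⟨D.zPart g, h⟩ : D.P₀)⁻¹ f₀ := fun g h => dif_pos h
  refine ⟨f, ⟨?_, ?_, ?_⟩, ?_⟩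
  · intro g hg
    obtain ⟨Φ, hΦ1, hΦ2⟩ := D.exists_smooth_repL hρ
    have hz := D.zPart_mem hg
    have hsm := D.contMDiffOn_zPart.contMDiffAt (D.isOpen_above_cell.mem_nhds hg)
    have hk : ContMDiffAt 𝓘(ℝ, E) 𝓘(ℝ, E) ∞ (fun h => (D.zPart h)⁻¹ * D.zPart g) g :=
      hsm.inv.mul contMDiffAt_const
    have hk1 : (D.zPart g)⁻¹ * D.zPart g = 1 := inv_mul_cancel _
    -- Smoothness of `ρ` is known only near `1`, so for `h` near `g` the value is written as `f h =
    -- ρ(z(h)⁻¹ z(g)) (f g)`.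
    have h1 : ContMDiffAt 𝓘(ℝ, E) 𝓘(ℝ, V) ∞
        (fun h => Φ ((D.zPart h)⁻¹ * D.zPart g) (f g)) g :=
      (hΦ1.comp_of_eq hk hk1).clm_apply contMDiffAt_const
    refine (h1.congr_of_eventuallyEq ?_).contMDiffWithinAt
    have h2 := hk.continuousAt.eventually
      (p := fun k => ∀ hk : k ∈ D.P₀, D.repL ρ ⟨k, hk⟩ = Φ k) (by simpa only [hk1] using hΦ2)
    filter_upwards [h2, D.isOpen_above_cell.mem_nhds hg] with h hh hha
    have hz' := D.zPart_mem hha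
    rw [← hh (mul_mem (inv_mem hz') hz), hf h hz', hf g hz]
    change _ = ρ _ (ρ _ f₀)
    rw [← Module.End.mul_apply, ← map_mul]
    congr 2
    exact Subtype.ext (by simp)
  · intro g hg e he
    rw [hf g (D.zPart_mem hg), hf (g * e) (D.zPart_mem (D.mul_mem_above hg (D.expN_subset_P he)))]
    congr 3
    exact Subtype.ext (D.zPart_mul_expN hg he)
  · intro g hg z
    rw [hf g (D.zPart_mem hg), hf (g * z) (D.zPart_mem (D.mul_mem_above hg z.2.1))]
    rw [← Module.End.mul_apply, ← map_mul, ← mul_inv_rev]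
    congr 3
    exact Subtype.ext (D.zPart_mul_P₀ hg z.2)
  · intro u hu
    have h1 := D.zPart_expM hu
    rw [hf u (h1 ▸ one_mem D.P₀)]
    have : (⟨D.zPart u, h1 ▸ one_mem D.P₀⟩ : D.P₀)⁻¹ = 1 := by
      rw [inv_eq_one]; exact Subtype.ext h1
    rw [this, map_one]
    rfl

end Sections

end ParabolicModel

namespace ParabolicModel

/-! ### Parallel metrics on the cell and their translates. -/

section Metrics

open Filter Topology

variable {E G : Type*} [NormedAddCommGroup E] [NormedSpace ℝ E]
  [FiniteDimensional ℝ E] [TopologicalSpace G] [ChartedSpace E G] [Group G]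
  [LieGroup 𝓘(ℝ, E) ∞ G] [T2Space G] (D : ParabolicModel E G)

lemma act_mkQ (a : D.P) (X : LieAlg E G) :
    D.act a (D.p.toSubmodule.mkQ X) = D.p.toSubmodule.mkQ (Ad (a : G) X) := rfl

lemma act_mul (a b : D.P) (x : D.QuotMod) : D.act (a * b) x = D.act a (D.act b x) := by
  obtain ⟨X, rfl⟩ := D.p.toSubmodule.mkQ_surjective x
  rw [act_mkQ, act_mkQ, act_mkQ, Subgroup.coe_mul, Ad_mul, LinearMap.comp_apply]

lemma act_one (x : D.QuotMod) : D.act 1 x = x := by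
  obtain ⟨X, rfl⟩ := D.p.toSubmodule.mkQ_surjective x
  rw [act_mkQ, Subgroup.coe_one, Ad_one, LinearMap.id_apply]

/-- The horizontal subspace is a `P`-submodule. -/
lemma act_mem_h (a : D.P) {x : D.QuotMod} (hx : x ∈ D.h) : D.act a x ∈ D.h := by
  intro Y hY ξ hξ
  obtain ⟨X, rfl⟩ := D.p.toSubmodule.mkQ_surjective x
  have ha := D.P_le_stab a.2
  have h1 := hx X rfl (Ad (a : G)⁻¹ ξ)
    (Ad_mem_of_mem_stab (inv_mem (stab_le_stab_radicalIn D.parabolic_p ha)) hξ)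
  have h2 : (⁅ξ, Ad (a : G) X⁆ : LieAlg E G) ∈ D.p := by
    have := Ad_mem_of_mem_stab ha h1
    rwa [Ad_lie, Ad_apply_inv] at this
  have h3 : Y - Ad (a : G) X ∈ D.p := (Submodule.Quotient.mk_eq_zero _).1
    (show D.p.toSubmodule.mkQ (Y - Ad (a : G) X) = 0 by rw [map_sub, hY, act_mkQ, sub_self])
  have := D.p.add_mem h2 (D.p.lie_mem (radicalIn_le _ hξ) h3)
  rwa [← lie_add, add_sub_cancel] at this

lemma act_mem {W : Submodule ℝ D.QuotMod} (hW : W = ⊤ ∨ W = D.h) (a : D.P) {x : D.QuotMod}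
    (hx : x ∈ W) : D.act a x ∈ W := by
  rcases hW with rfl | rfl
  · exact Submodule.mem_top
  · exact D.act_mem_h a hx

variable [LieAlgebra.IsSemisimple ℝ (LieAlg E G)]

/-- A bilinear form, transported by a function with values in `P`, is smooth. -/
lemma exists_isMetric {W : Submodule ℝ D.QuotMod} (hW : ∀ (a : D.P), ∀ x ∈ W, D.act a x ∈ W)
    {β : LinearMap.BilinForm ℝ W} (hs : β.IsSymm) (hβ : β.Nondegenerate) :
    ∃ b : G → LinearMap.BilinForm ℝ W, D.IsMetric W D.cell b ∧ ∀ u ∈ D.expM, b u = β := by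
  obtain ⟨pr, hpr⟩ := W.subtype.exists_leftInverse_of_injective
    (LinearMap.ker_eq_bot.2 W.injective_subtype)
  obtain ⟨sec, hsec⟩ := D.p.toSubmodule.mkQ.exists_rightInverse_of_surjective
    (LinearMap.range_eq_top.2 D.p.toSubmodule.mkQ_surjective)
  have hsec' : ∀ x, D.p.toSubmodule.mkQ (sec x) = x := fun x => LinearMap.congr_fun hsec x
  have hpr' : ∀ x : W, pr x = x := fun x => LinearMap.congr_fun hpr x
  -- Over the cell this is the action of the `P`-component of `g` on `W`. Writing it with a linear
  -- section and a retraction defines it for all `g` and makes the smooth dependence on `Ad (pPart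
  -- g)` visible.
  set M : G → W →ₗ[ℝ] W := fun g =>
    pr ∘ₗ D.p.toSubmodule.mkQ ∘ₗ Ad (D.pPart g) ∘ₗ sec ∘ₗ W.subtype with hM
  have hMact : ∀ (g : G) (a : D.P), D.pPart g = a → ∀ x : W, (M g x : D.QuotMod) = D.act a x := by
    intro g a hga x
    have h1 : D.p.toSubmodule.mkQ (Ad (D.pPart g) (sec x)) = D.act a x := by
      rw [hga, ← act_mkQ, hsec']
    change ((pr (D.p.toSubmodule.mkQ (Ad (D.pPart g) (sec x))) : W) : D.QuotMod) = _
    rw [h1]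
    exact congrArg Subtype.val (hpr' ⟨D.act a x, hW a x x.2⟩)
  refine ⟨fun g => β.comp (M g) (M g), ⟨?_, ?_, ?_, ?_⟩, ?_⟩
  · intro x y
    let N : LieAlg E G →ₗ[ℝ] W := pr ∘ₗ D.p.toSubmodule.mkQ
    let C : E →ₗ[ℝ] E →ₗ[ℝ] ℝ := β.compl₁₂ N N
    let C' : E →L[ℝ] E →L[ℝ] ℝ := LinearMap.toContinuousBilinearMap C
    have h1 : ContMDiffOn 𝓘(ℝ, E) 𝓘(ℝ, E →L[ℝ] E) ∞
        (fun g => (AdL (D.pPart g) : E →L[ℝ] E)) (D.above D.cell) :=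
      (contMDiff_AdL (E := E) (G := G)).comp_contMDiffOn
        (D.contMDiffOn_pPart.mono fun g hg => (D.mPart_pPart_mem hg).1)
    have h2 : ContDiff ℝ ∞ fun T : E →L[ℝ] E =>
        C' (T (show E from sec x)) (T (show E from sec y)) := by fun_prop
    exact h2.contMDiff.comp_contMDiffOn h1
  · intro g hg
    exact ⟨fun x y => hs.eq (M g x) (M g y)⟩
  · intro g hg
    -- Over the cell `M g` is the action of a group element, hence bijective, and nondegeneracy of
    -- `β` transfers.
    have hinj : Function.Injective (M g) := by
      rw [injective_iff_map_eq_zero]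
      intro x hx
      set a : D.P := ⟨D.pPart g, (D.mPart_pPart_mem hg).2.2⟩ with ha
      have h1 := hMact g a rfl x
      rw [hx] at h1
      apply Subtype.ext
      rw [← D.act_one x, ← inv_mul_cancel a, act_mul, ← h1]
      exact map_zero _
    have hsurj := LinearMap.injective_iff_surjective.1 hinj
    refine ⟨fun x hx => ?_, fun x hx => ?_⟩
    · refine hinj ((hβ.1 _ fun y => ?_).trans (map_zero _).symm)
      obtain ⟨y, rfl⟩ := hsurj y
      exact hx y
    · refine hinj ((hβ.2 _ fun y => ?_).trans (map_zero _).symm)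
      obtain ⟨y, rfl⟩ := hsurj y
      exact hx y
  · intro g hg a x y x' y' hx hy
    set c : D.P := ⟨D.pPart g, (D.mPart_pPart_mem hg).2.2⟩ with hc
    have hca : D.pPart (g * a) = ((c * a : D.P) : G) := by
      have h1 := (D.mPart_mul (D.mPart_pPart_mem hg).2.1 (c * a).2).2
      rw [← h1]
      congr 1
      rw [Subgroup.coe_mul, ← mul_assoc]
      exact congrArg (· * (a : G)) (D.mPart_mul_pPart g).symm
    have key : ∀ x x' : W, (x' : D.QuotMod) = D.act a x → M (g * a) x = M g x' := by
      intro x x' hx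
      apply Subtype.ext
      rw [hMact _ _ hca, hMact g c rfl, act_mul, hx]
    change β (M (g * a) x) (M (g * a) y) = β (M g x') (M g y')
    rw [key x x' hx, key y y' hy]
  · intro u hu
    have h1 : D.pPart u = ((1 : D.P) : G) := by
      have := (D.mPart_mul hu (one_mem D.P)).2
      rwa [mul_one] at this
    have h2 : M u = LinearMap.id := LinearMap.ext fun x =>
      Subtype.ext ((hMact u 1 h1 x).trans (D.act_one x))
    change β.comp (M u) (M u) = β
    rw [h2]
    rfl

lemma flat_decomposition {σ : G → G} (hσ : D.IsNormalFlat σ) {g : G} (hg : g ∈ D.above D.cell) :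
    ∃ u ∈ D.expM, ∃ z ∈ D.P₀, σ g = u * z :=
  (hσ.2 ▸ mem_image_of_mem σ hg : σ g ∈ {g | ∃ u ∈ D.expM, ∃ z ∈ D.P₀, g = u * z})

/-- Both `exp m` and `P₀` normalize `q`, so the image of the flat Weyl structure lies in the
normalizer of `q`. -/
lemma flat_mem_stab {σ : G → G} (hσ : D.IsNormalFlat σ) {g h : G} (hg : g ∈ D.above D.cell)
    (hh : h ∈ D.above D.cell) : (σ g)⁻¹ * σ h ∈ stab D.q.toSubmodule := by
  have key : ∀ g ∈ D.above D.cell, σ g ∈ stab D.q.toSubmodule := by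
    intro g hg
    obtain ⟨u, hu, z, hz, h⟩ := D.flat_decomposition hσ hg
    rw [h]
    exact mul_mem (D.expM_subset_stab hu) hz.2
  exact mul_mem (inv_mem (key g hg)) (key h hh)

/-- `P₀` normalizes `exp m`: right translation by `u` changes only the `exp m`-factor, as `v z u = v
(z u z⁻¹) z`. This is why functions constant on `exp m` become invariant after equivariant
extension. -/
lemma flat_mul_expM {σ : G → G} (hσ : D.IsNormalFlat σ) {g : G} (hg : g ∈ D.above D.cell) {u : G}
    (hu : u ∈ D.expM) :
    ∃ z : D.P₀, ∃ v ∈ D.expM, ∃ w ∈ D.expM, σ g = v * z ∧ σ g * u = w * z := by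
  obtain ⟨v, hv, z, hz, h⟩ := D.flat_decomposition hσ hg
  refine ⟨⟨z, hz⟩, v, hv, v * (z * u * z⁻¹), ?_, h, ?_⟩
  · exact (radicalGroup D.isOpposite.symm).mul_mem hv (D.conj_mem_expM hz.2 hu)
  · rw [h]
    change v * z * u = v * (z * u * z⁻¹) * z
    group

lemma mem_above_of_mem_expM {u : G} (hu : u ∈ D.expM) : u ∈ D.above D.cell := by
  simpa using D.mem_above_of_eq hu (one_mem D.P)

lemma covDeriv_section_eq_zero {σ : G → G} (hσ : D.IsNormalFlat σ) {V : Type*}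
    [NormedAddCommGroup V] [NormedSpace ℝ V] {ρ : Representation ℝ D.P₀ V} {f : G → V}
    (hf : D.IsSection ρ D.cell f) {f₀ : V} (hf₀ : ∀ u ∈ D.expM, f u = f₀) {g : G}
    (hg : g ∈ D.above D.cell) (v : TangentSpace 𝓘(ℝ, E) g) : D.covDeriv σ f g v = 0 := by
  refine D.covDeriv_eq_zero D.isOpen_above_cell hσ.1 (fun _ h₁ _ h₂ => D.flat_mem_stab hσ h₁ h₂)
    hf.smooth (fun g hg u hu => ?_) hg v
  obtain ⟨z, v, hv, w, hw, h1, h2⟩ := D.flat_mul_expM hσ hg hu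
  rw [h2, h1, hf.equivariant _ (D.mem_above_of_mem_expM hv),
    hf.equivariant _ (D.mem_above_of_mem_expM hw), hf₀ v hv, hf₀ w hw]

/-- By equivariance both sides are `β` evaluated on the images of `x` and `y` under the common
factor `z`. -/
lemma metric_mul_expM {σ : G → G} (hσ : D.IsNormalFlat σ) {W : Submodule ℝ D.QuotMod}
    (hW : ∀ (a : D.P), ∀ x ∈ W, D.act a x ∈ W) {b : G → LinearMap.BilinForm ℝ W}
    (hb : D.IsMetric W D.cell b) {β : LinearMap.BilinForm ℝ W} (hbβ : ∀ u ∈ D.expM, b u = β)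
    {g : G} (hg : g ∈ D.above D.cell) {u : G} (hu : u ∈ D.expM) (x y : W) :
    b (σ g * u) x y = b (σ g) x y := by
  obtain ⟨z, v, hv, w, hw, h1, h2⟩ := D.flat_mul_expM hσ hg hu
  let a : D.P := ⟨z, z.2.1⟩
  let x' : W := ⟨D.act a x, hW a x x.2⟩
  let y' : W := ⟨D.act a y, hW a y y.2⟩
  have key : ∀ v ∈ D.expM, b (v * z) x y = β x' y' := fun v hv => by
    rw [← hbβ v hv]
    exact hb.equivariant v (D.mem_above_of_mem_expM hv) a x y x' y' rfl rfl
  rw [h2, h1, key v hv, key w hw]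

lemma contMDiffOn_translate {U : Set (G ⧸ D.P)} (g₀ : G) {F M : Type*} [NormedAddCommGroup F]
    [NormedSpace ℝ F] [TopologicalSpace M] [ChartedSpace F M] {f : G → M}
    (hf : ContMDiffOn 𝓘(ℝ, E) 𝓘(ℝ, F) ∞ f (D.above U)) :
    ContMDiffOn 𝓘(ℝ, E) 𝓘(ℝ, F) ∞ (fun g => f (g₀⁻¹ * g))
      (D.above ((fun x => g₀⁻¹ • x) ⁻¹' U)) :=
  hf.comp (contMDiff_mul_left (I := 𝓘(ℝ, E)) (n := ∞)).contMDiffOn fun _ hg => hg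

lemma IsMetric.translate {W : Submodule ℝ D.QuotMod} {U : Set (G ⧸ D.P)}
    {b : G → LinearMap.BilinForm ℝ W} (hb : D.IsMetric W U b) (g₀ : G) :
    D.IsMetric W ((fun x => g₀⁻¹ • x) ⁻¹' U) fun g => b (g₀⁻¹ * g) where
  smooth x y := D.contMDiffOn_translate g₀ (hb.smooth x y)
  symm g hg := hb.symm _ hg
  nondegenerate g hg := hb.nondegenerate _ hg
  equivariant g hg a x y x' y' hx hy := by
    rw [← mul_assoc]
    exact hb.equivariant _ hg a x y x' y' hx hy

lemma IsWeylStructure.translate {U : Set (G ⧸ D.P)} {σ : G → G} (hσ : D.IsWeylStructure U σ)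
    (g₀ : G) : D.IsWeylStructure ((fun x => g₀⁻¹ • x) ⁻¹' U) fun g => g₀ * σ (g₀⁻¹ * g) where
  smooth := contMDiffOn_const.mul (D.contMDiffOn_translate g₀ hσ.smooth)
  invariant g hg e he := by
    rw [← mul_assoc, hσ.invariant (g₀⁻¹ * g) hg e he]
  equivariant g hg z hz := by
    rw [← mul_assoc, hσ.equivariant (g₀⁻¹ * g) hg z hz, mul_assoc]
  splitting g hg := by
    obtain ⟨e, he, h⟩ := hσ.splitting (g₀⁻¹ * g) hg
    exact ⟨e, he, by rw [h, ← mul_assoc, mul_inv_cancel_left]⟩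

/-- A finite dimensional space carries a nondegenerate symmetric bilinear form. -/
lemma exists_nondegenerate_symm (W : Type*) [AddCommGroup W] [Module ℝ W] [FiniteDimensional ℝ W] :
    ∃ β : LinearMap.BilinForm ℝ W, β.IsSymm ∧ β.Nondegenerate := by
  let b := Module.finBasis ℝ W
  let β : LinearMap.BilinForm ℝ W := LinearMap.mk₂ ℝ (fun x y => ∑ i, b.repr x i * b.repr y i)
    (fun x y z => by simp [add_mul, Finset.sum_add_distrib])
    (fun c x y => by simp [mul_assoc, Finset.mul_sum])
    (fun x y z => by simp [mul_add, Finset.sum_add_distrib])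
    (fun c x y => by simp [mul_left_comm, Finset.mul_sum])
  have hself : ∀ x, β x x = 0 → x = 0 := by
    intro x hx
    have h1 : ∑ i, b.repr x i * b.repr x i = 0 := hx
    rw [Finset.sum_eq_zero_iff_of_nonneg fun i _ => mul_self_nonneg _] at h1
    refine b.ext_elem fun i => ?_
    simpa using h1 i (Finset.mem_univ i)
  refine ⟨β, ⟨fun x y => ?_⟩, fun x hx => hself x (hx x), fun x hx => hself x (hx x)⟩
  change ∑ i, b.repr x i * b.repr y i = ∑ i, b.repr y i * b.repr x i
  exact Finset.sum_congr rfl fun i _ => mul_comm (b.repr x i) (b.repr y i)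

/-- Left translation by `g₀` moves the cell, which contains the base point, to a neighbourhood of
`g₀ P`. The quotients `(σ g)⁻¹ σ h` and the invariance under `exp m` on the right are unaffected, so
`covDeriv_eq_zero` applies to the translate. -/
lemma locallyMetrizable : D.LocallyMetrizable := by
  intro x
  obtain ⟨g₀, rfl⟩ := QuotientGroup.mk_surjective x
  obtain ⟨β, hβs, hβ⟩ := exists_nondegenerate_symm D.h
  obtain ⟨b, hb, hbβ⟩ := D.exists_isMetric (fun a _ hx => D.act_mem_h a hx) hβs hβ
  have hσ := D.isNormalFlat_flat
  have := topologicalGroup_of_lieGroup (G := G) 𝓘(ℝ, E) ∞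
  have hopen : IsOpen (D.above ((fun x => g₀⁻¹ • x) ⁻¹' D.cell)) :=
    D.isOpen_above_cell.preimage (continuous_const_mul g₀⁻¹)
  refine ⟨(fun x => g₀⁻¹ • x) ⁻¹' D.cell, hopen, ?_, _, hb.translate D g₀, _, hσ.1.translate D g₀, ?_⟩
  · have h1 : (g₀⁻¹ * g₀ : G) ∈ D.above D.cell := by
      rw [inv_mul_cancel]
      exact D.mem_above_of_mem_expM (one_mem (radicalGroup D.isOpposite.symm))
    exact h1
  · intro g hg v _ x y
    refine D.covDeriv_eq_zero hopen (hσ.1.translate D g₀) (fun g hg h hh => ?_)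
      ((hb.translate D g₀).smooth x y) (fun g hg u hu => ?_) hg v
    · rw [mul_inv_rev, mul_assoc, inv_mul_cancel_left]
      exact D.flat_mem_stab hσ hg hh
    · rw [mul_assoc, inv_mul_cancel_left, inv_mul_cancel_left]
      exact D.metric_mul_expM hσ (fun a _ hx => D.act_mem_h a hx) hb hbβ hg hu x y

end Metrics

end ParabolicModel

end ParabolicGeometry

end

theorem mainTheorem6 {E G : Type*} [NormedAddCommGroup E] [NormedSpace ℝ E]
    [FiniteDimensional ℝ E] [TopologicalSpace G] [ChartedSpace E G] [Group G]
    [LieGroup 𝓘(ℝ, E) ∞ G] [T2Space G]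
    [LieAlgebra.IsSemisimple ℝ (ParabolicGeometry.LieAlg E G)]
    (D : ParabolicGeometry.ParabolicModel E G) :
    -- the normal flat Weyl structure exists over the open cell
    IsOpen D.cell ∧ (∃ σ : G → G, D.IsNormalFlat σ) ∧
    (∀ σ : G → G, D.IsNormalFlat σ →
      -- constant functions define sections, and these are covariantly constant
      (∀ (V : Type*) [NormedAddCommGroup V] [NormedSpace ℝ V] [FiniteDimensional ℝ V]
        (ρ : Representation ℝ D.P₀ V), (∀ v : V, Continuous fun z => ρ z v) →
        ∀ f₀ : V, (∃ f : G → V, D.IsSection ρ D.cell f ∧ ∀ u ∈ D.expM, f u = f₀) ∧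
          ∀ f : G → V, D.IsSection ρ D.cell f → (∀ u ∈ D.expM, f u = f₀) →
            ∀ g ∈ D.above D.cell, ∀ v : TangentSpace 𝓘(ℝ, E) g, D.covDeriv σ f g v = 0) ∧
      -- constant nondegenerate forms on `𝔤/𝔭 ≅ 𝔪` define parallel metrics on the tangent bundle,
      -- and constant nondegenerate forms on `𝔥` define parallel horizontal metrics
      (∀ W : Submodule ℝ D.QuotMod, W = ⊤ ∨ W = D.h → ∀ β : LinearMap.BilinForm ℝ W,
        β.IsSymm → β.Nondegenerate →
        ∃ b : G → LinearMap.BilinForm ℝ W, D.IsMetric W D.cell b ∧ (∀ u ∈ D.expM, b u = β) ∧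
          ∀ g ∈ D.above D.cell, ∀ v : TangentSpace 𝓘(ℝ, E) g, ∀ x y : W,
            D.covDeriv σ (fun a => b a x y) g v = 0)) ∧
    -- hence compatible horizontal metrics, and local metrizability
    (∀ β : LinearMap.BilinForm ℝ D.h, β.IsSymm → β.Nondegenerate →
      ∃ b : G → LinearMap.BilinForm ℝ D.h,
        D.IsCompatibleMetric D.cell b ∧ ∀ u ∈ D.expM, b u = β) ∧
    D.LocallyMetrizable := by
  refine ⟨D.isOpen_cell, ⟨_, D.isNormalFlat_flat⟩, fun σ hσ => ⟨?_, ?_⟩, ?_, D.locallyMetrizable⟩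
  · intro V _ _ _ ρ hρ f₀
    exact ⟨D.exists_isSection hρ f₀,
      fun f hf hf₀ g hg v => D.covDeriv_section_eq_zero hσ hf hf₀ hg v⟩
  · intro W hW β hβs hβ
    have hact : ∀ (a : D.P), ∀ x ∈ W, D.act a x ∈ W := fun a _ hx => D.act_mem hW a hx
    obtain ⟨b, hb, hbβ⟩ := D.exists_isMetric hact hβs hβ
    refine ⟨b, hb, hbβ, fun g hg v x y => ?_⟩
    exact D.covDeriv_eq_zero D.isOpen_above_cell hσ.1
      (fun _ h₁ _ h₂ => D.flat_mem_stab hσ h₁ h₂) (hb.smooth x y)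
      (fun _ hg _ hu => D.metric_mul_expM hσ hact hb hbβ hg hu x y) hg v
  · intro β hβs hβ
    have hact : ∀ (a : D.P), ∀ x ∈ D.h, D.act a x ∈ D.h := fun a _ hx => D.act_mem_h a hx
    obtain ⟨b, hb, hbβ⟩ := D.exists_isMetric hact hβs hβ
    have hσ := D.isNormalFlat_flat
    refine ⟨b, ⟨hb, _, hσ.1, fun g hg v _ x y => ?_⟩, hbβ⟩
    exact D.covDeriv_eq_zero D.isOpen_above_cell hσ.1
      (fun _ h₁ _ h₂ => D.flat_mem_stab hσ h₁ h₂) (hb.smooth x y)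
      (fun _ hg _ hu => D.metric_mul_expM hσ hact hb hbβ hg hu x y) hg v
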